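/- **Setting.** Let $d\ge 1$. An *oriented $d$-manifold with defect* is a compact Hausdorff space $X$ with a closed subset $D$ (the *defect*) such that $X\setminus D$ (the *bulk*) is a topological $d$-manifold and $D$ is a topological $(d-1)$-manifold, both oriented, where every connected component $S$ of $D$ has an open neighbourhood $U_S$ with $U_S\cap D=S$ and a homeomorphism $U_S\cong S\times CF_S$ that is the identity on $S=S\times\{\text{apex}\}$; here $CF_S$ is the open cone on a finite set $F_S$ (two points if $X$ is a manifold). The connected components of $X\setminus D$ and of $D$ are the *strata* in the bulk and in the defect. For $i\in F_S$, the *page* $S\times(0,1)$ over $i$ is called *inbound* if the boundary orientation that the bulk orientation of the page induces on $S$ agrees with the orientation of $S$, and *outbound* otherwise. A path $p:[0,1]\to X$ is *directed* if $[0,1]$ can be divided into finitely many closed intervals on each of which $p$ either stays in the bulk, or stays in some $U_S$ and there is monotone for the preorder "points of the same page, or of $S$, are equivalent, and each inbound page precedes $S$", or stays in some $U_S$ and there is monotone for the preorder "points of the same page, or of $S$, are equivalent, and $S$ precedes each outbound page". The fundamental category ${\uparrow}\Pi_1(X,d)$ has the points of $X$ as objects and as arrows the directed paths modulo the congruence generated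 by weakly monotone reparametrization and by immediate $d$-homotopy: $p_0$ and $p_1$ from $x$ to $y$ are immediately $d$-homotopic if there is a continuous $h:[0,1]^2\to X$ that sends every path in the square which is monotone in both coordinates to a directed path, with $h(-,0)=p_0$, $h(-,1)=p_1$, $h(0,-)=x$ and $h(1,-)=y$. Let $\mathcal P(\Gamma_2)$ be the path category of the directed graph with vertices $\beta,\delta$ and edges $\iota:\beta\to\delta$ and $\omega:\delta\to\beta$. A regular fiber-finite *$\Gamma_2$-parcel* is a category $\mathcal C$ with a functor $\gamma:\mathcal C\to\mathcal P(\Gamma_2)$ that is conservative, surjective on arrows and injective on objects, and such that $\gamma^{-1}(a)$ is a finite set of arrows for every arrow $a$. Choose a base point in each stratum and let ${\uparrow}\pi_1(X,d)$ be the full subcategory of ${\uparrow}\Pi_1(X,d)$ on the base points. A *directed triangulation* $\mathcal T$ of $(X,d)$ is a finite simplicial complex with a homeomorphism of its space to $X$, such that every simplex meets $D$ in the empty set or in a face, with a total order of the vertices in each stratum. An edge inside a stratum is oriented from its earlier to its later vertex, any other edge so that it is a directed path. A *$\mathcal C$-coloring* of $\mathcal T$ assigns an arrow of $\mathcal C$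 to each edge, lying above $\mathrm{Id}_\beta$ for an edge in the bulk, above $\mathrm{Id}_\delta$ for an edge in the defect, above $\iota$ for an edge from the bulk to the defect and above $\omega$ for an edge from the defect to the bulk, such that for each 2-simplex the composition of the arrows on its two composable edges is the arrow on the third edge. **Theorem.** Let $(X,d)$ be an oriented manifold with defect, with a base point in each stratum, let $\mathcal C$ be a regular fiber-finite $\Gamma_2$-parcel and let $\mathcal T$ be any directed triangulation of $(X,d)$. There is a unique functor $\Phi:{\uparrow}\pi_1(X,d)\to\mathcal P(\Gamma_2)$ that sends base points in the bulk to $\beta$ and those in the defect to $\delta$, paths inside one stratum to identities, paths that run first in the bulk and then in the defect to $\iota$, and paths that run first in the defect and then in the bulk to $\omega$. The number $\mathcal N_{\mathcal C}(X,d)$ of functors $F:{\uparrow}\pi_1(X,d)\to\mathcal C$ with $\gamma\circ F=\Phi$ is finite, the number of $\mathcal C$-colorings of $\mathcal T$ is finite, and $$\mathcal N_{\mathcal C}(X,d)=\frac{\#\{\mathcal C\text{-colorings of }\mathcal T\}}{(\#\gamma^{-1}(\mathrm{Id}_\beta))^{v_\beta-\sigma_\beta}\,(\#\gamma^{-1}(\mathrm{Id}_\delta))^{v_\delta-\sigma_\delta}},$$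 where $v_\beta$ (resp. $v_\delta$) is the number of vertices of $\mathcal T$ in the bulk (resp. defect) and $\sigma_\beta$ (resp. $\sigma_\delta$) is the number of strata in the bulk (resp. defect). -/

import Mathlib

open CategoryTheory Topology Set
open scoped unitInterval

noncomputable section

universe u v w

/-! ### Directed spaces and their fundamental categories -/

/-- A directed topological space structure on `X`: a set of directed paths containing the constant
paths and closed under weakly monotone reparametrization (not necessarily onto `I`) and
concatenation. -/
structure DSpace (X : Type u) [TopologicalSpace X] where
  dpaths : Set C(I, X)
  const_mem : ∀ x : X, ContinuousMap.const I x ∈ dpaths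
  reparam_mem : ∀ p ∈ dpaths, ∀ f : C(I, I), Monotone f → p.comp f ∈ dpaths
  concat_mem : ∀ {x y z : X} (p : Path x y) (q : Path y z),
    p.toContinuousMap ∈ dpaths → q.toContinuousMap ∈ dpaths →
      (p.trans q).toContinuousMap ∈ dpaths

namespace DSpace

variable {X : Type u} [TopologicalSpace X] (d : DSpace X)

/-- Directed paths from `x` to `y`. -/
abbrev DirPath (x y : X) : Type u := {p : Path x y // p.toContinuousMap ∈ d.dpaths}

/-- `q` is a weakly monotone reparametrization of `p`. -/
def Reparam {x y : X} (p q : d.DirPath x y) : Prop :=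
  ∃ f : C(I, I), Monotone f ∧ f 0 = 0 ∧ f 1 = 1 ∧ ∀ t, q.1 t = p.1 (f t)

/-- The objects of the category of directed paths up to reparametrization: the points of `X`. -/
structure PathCat (d : DSpace X) where
  pt : X

/-- The constant directed path. -/
def DirPath.refl (x : X) : d.DirPath x x := ⟨Path.refl x, d.const_mem x⟩

variable {d} in
/-- Concatenation of directed paths. -/
def DirPath.trans {x y z : X} (p : d.DirPath x y) (q : d.DirPath y z) : d.DirPath x z :=
  ⟨p.1.trans q.1, d.concat_mem _ _ p.2 q.2⟩

/-- Reparametrizing both halves of a concatenation. -/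
def concatReparam (f g : C(I, I)) : C(I, I) where
  toFun t := ⟨((f (projIcc 0 1 zero_le_one (2 * (t : ℝ))) : ℝ) +
    (g (projIcc 0 1 zero_le_one (2 * (t : ℝ) - 1)) : ℝ)) / 2, by
      have h1 := (f (projIcc 0 1 zero_le_one (2 * (t : ℝ)))).2
      have h2 := (g (projIcc 0 1 zero_le_one (2 * (t : ℝ) - 1))).2
      constructor <;> linarith [h1.1, h1.2, h2.1, h2.2]⟩
  continuous_toFun := by
    refine Continuous.subtype_mk ?_ _
    have hp : Continuous (projIcc (0 : ℝ) 1 zero_le_one) := continuous_projIcc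
    fun_prop

theorem concatReparam_mono {f g : C(I, I)} (hf : Monotone f) (hg : Monotone g) :
    Monotone (concatReparam f g) := by
  intro s t h
  have h' : (s : ℝ) ≤ t := h
  have h1 : (f (projIcc 0 1 zero_le_one (2 * (s : ℝ))) : ℝ) ≤
      f (projIcc 0 1 zero_le_one (2 * (t : ℝ))) :=
    hf (monotone_projIcc _ (by linarith))
  have h2 : (g (projIcc 0 1 zero_le_one (2 * (s : ℝ) - 1)) : ℝ) ≤
      g (projIcc 0 1 zero_le_one (2 * (t : ℝ) - 1)) :=
    hg (monotone_projIcc _ (by linarith))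
  change ((_ : ℝ) + _) / 2 ≤ (_ + _) / 2
  linarith

theorem trans_eq {x y z : X} (p : Path x y) (q : Path y z) (t : I) :
    (p.trans q) t = if (t : ℝ) ≤ 1 / 2 then p (projIcc 0 1 zero_le_one (2 * (t : ℝ)))
      else q (projIcc 0 1 zero_le_one (2 * (t : ℝ) - 1)) := rfl

theorem concatReparam_spec {x y z : X} (p : Path x y) (q : Path y z) (f g : C(I, I))
    (hf1 : f 1 = 1) (hg0 : g 0 = 0) (t : I) :
    (p.trans q) (concatReparam f g t) =
      if (t : ℝ) ≤ 1 / 2 then p (f (projIcc 0 1 zero_le_one (2 * (t : ℝ))))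
      else q (g (projIcc 0 1 zero_le_one (2 * (t : ℝ) - 1))) := by
  have key : ((concatReparam f g t : I) : ℝ) = ((f (projIcc 0 1 zero_le_one (2 * (t : ℝ))) : ℝ) +
    (g (projIcc 0 1 zero_le_one (2 * (t : ℝ) - 1)) : ℝ)) / 2 := rfl
  rw [trans_eq, key]
  by_cases h : (t : ℝ) ≤ 1 / 2
  · have e : projIcc (0 : ℝ) 1 zero_le_one (2 * (t : ℝ) - 1) = 0 :=
      projIcc_of_le_left _ (by linarith)
    have hb := (f (projIcc 0 1 zero_le_one (2 * (t : ℝ)))).2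
    rw [if_pos h, e, hg0]
    rw [if_pos (by simp only [Icc.coe_zero]; linarith [hb.2])]
    congr 1
    have : 2 * (((f (projIcc 0 1 zero_le_one (2 * (t : ℝ))) : ℝ) + ((0 : I) : ℝ)) / 2) =
      (f (projIcc 0 1 zero_le_one (2 * (t : ℝ))) : ℝ) := by
        simp only [Icc.coe_zero]; ring
    rw [this, projIcc_val]
  · have e : projIcc (0 : ℝ) 1 zero_le_one (2 * (t : ℝ)) = 1 :=
      projIcc_of_right_le _ (by linarith)
    rw [if_neg h, e, hf1]
    have hb := (g (projIcc 0 1 zero_le_one (2 * (t : ℝ) - 1))).2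
    have e2 : 2 * ((((1 : I) : ℝ) + (g (projIcc 0 1 zero_le_one (2 * (t : ℝ) - 1)) : ℝ)) / 2) - 1
      = (g (projIcc 0 1 zero_le_one (2 * (t : ℝ) - 1)) : ℝ) := by
        simp only [Icc.coe_one]; ring
    split_ifs with h2
    · have h0 : g (projIcc 0 1 zero_le_one (2 * (t : ℝ) - 1)) = 0 := by
        apply Subtype.ext
        simp only [Icc.coe_one] at h2
        simp only [Icc.coe_zero]
        linarith [hb.1]
      rw [h0]
      have : projIcc (0 : ℝ) 1 zero_le_one (2 * ((((1 : I) : ℝ) + ((0 : I) : ℝ)) / 2)) = 1 :=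
        projIcc_of_right_le _ (by simp)
      rw [this, p.target, q.source]
    · rw [e2, projIcc_val]

variable {d} in
theorem reparam_trans {x y z : X} {p p' : d.DirPath x y} {q q' : d.DirPath y z}
    (hp : d.Reparam p p') (hq : d.Reparam q q') : d.Reparam (p.trans q) (p'.trans q') := by
  obtain ⟨f, hf, f0, f1, hpf⟩ := hp
  obtain ⟨g, hg, g0, g1, hqg⟩ := hq
  refine ⟨concatReparam f g, concatReparam_mono hf hg, ?_, ?_, fun t => ?_⟩
  · apply Subtype.ext
    change ((f (projIcc 0 1 zero_le_one (2 * ((0 : I) : ℝ))) : ℝ) +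
      (g (projIcc 0 1 zero_le_one (2 * ((0 : I) : ℝ) - 1)) : ℝ)) / 2 = ((0 : I) : ℝ)
    rw [projIcc_of_le_left _ (by simp), projIcc_of_le_left _ (by simp)]
    change ((f 0 : ℝ) + (g 0 : ℝ)) / 2 = _
    rw [f0, g0]; simp
  · apply Subtype.ext
    change ((f (projIcc 0 1 zero_le_one (2 * ((1 : I) : ℝ))) : ℝ) +
      (g (projIcc 0 1 zero_le_one (2 * ((1 : I) : ℝ) - 1)) : ℝ)) / 2 = ((1 : I) : ℝ)
    rw [projIcc_of_right_le _ (by simp), projIcc_of_right_le _ (by norm_num)]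
    change ((f 1 : ℝ) + (g 1 : ℝ)) / 2 = _
    rw [f1, g1]; simp
  · change (p'.1.trans q'.1) t = (p.1.trans q.1) (concatReparam f g t)
    rw [concatReparam_spec p.1 q.1 f g f1 g0, trans_eq, hpf, hqg]

variable {d} in
theorem reparam_rfl {x y : X} (p : d.DirPath x y) : d.Reparam p p :=
  ⟨ContinuousMap.id I, monotone_id, rfl, rfl, fun _ => rfl⟩

variable {d} in
theorem reparam_refl_trans {x y : X} (p : d.DirPath x y) :
    d.Reparam p ((DirPath.refl d x).trans p) := by
  refine ⟨⟨fun t => projIcc 0 1 zero_le_one (2 * (t : ℝ) - 1),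
    continuous_projIcc.comp (by fun_prop)⟩, ?_, ?_, ?_, fun t => ?_⟩
  · intro s t h
    have h' : (s : ℝ) ≤ t := h
    exact monotone_projIcc zero_le_one (by linarith)
  · exact projIcc_of_le_left zero_le_one (by simp)
  · exact projIcc_of_right_le zero_le_one (by norm_num)
  · change ((Path.refl x).trans p.1) t = p.1 (projIcc 0 1 zero_le_one (2 * (t : ℝ) - 1))
    rw [trans_eq]
    split_ifs with h
    · rw [projIcc_of_le_left zero_le_one (by linarith : 2 * (t : ℝ) - 1 ≤ 0)]
      exact p.1.source.symm
    · rfl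

variable {d} in
theorem reparam_trans_refl {x y : X} (p : d.DirPath x y) :
    d.Reparam p (p.trans (DirPath.refl d y)) := by
  refine ⟨⟨fun t => projIcc 0 1 zero_le_one (2 * (t : ℝ)),
    continuous_projIcc.comp (by fun_prop)⟩, ?_, ?_, ?_, fun t => ?_⟩
  · intro s t h
    have h' : (s : ℝ) ≤ t := h
    exact monotone_projIcc zero_le_one (by linarith)
  · exact projIcc_of_le_left zero_le_one (by simp)
  · exact projIcc_of_right_le zero_le_one (by norm_num)
  · change (p.1.trans (Path.refl y)) t = p.1 (projIcc 0 1 zero_le_one (2 * (t : ℝ)))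
    rw [trans_eq]
    split_ifs with h
    · rfl
    · rw [projIcc_of_right_le zero_le_one (by linarith : 1 ≤ 2 * (t : ℝ))]
      exact p.1.target.symm

variable {d} in
theorem reparam_assoc {x y z a : X} (p : d.DirPath x y) (q : d.DirPath y z) (r : d.DirPath z a) :
    d.Reparam (p.trans (q.trans r)) ((p.trans q).trans r) := by
  refine ⟨⟨fun t => projIcc 0 1 zero_le_one
    (min (2 * (t : ℝ)) (min ((t : ℝ) + 1 / 4) (((t : ℝ) + 1) / 2))),
    continuous_projIcc.comp (by fun_prop)⟩, ?_, ?_, ?_, fun t => ?_⟩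
  · intro s t h
    have h' : (s : ℝ) ≤ t := h
    exact monotone_projIcc zero_le_one (min_le_min (by linarith) (min_le_min (by linarith) (by linarith)))
  · exact projIcc_of_le_left zero_le_one (by simp)
  · exact projIcc_of_right_le zero_le_one (by norm_num)
  · have t0 := t.2.1
    have t1 := t.2.2
    have mem : min (2 * (t : ℝ)) (min ((t : ℝ) + 1 / 4) (((t : ℝ) + 1) / 2)) ∈ Icc (0 : ℝ) 1 :=
      ⟨le_min (by linarith) (le_min (by linarith) (by linarith)),
        (min_le_right _ _).trans ((min_le_right _ _).trans (by linarith))⟩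
    have pr : ∀ {s : ℝ} (hs : s ∈ Icc (0 : ℝ) 1),
        ((projIcc (0 : ℝ) 1 zero_le_one s : I) : ℝ) = s := fun hs => by
      rw [projIcc_of_mem zero_le_one hs]
    change ((p.1.trans q.1).trans r.1) t = (p.1.trans (q.1.trans r.1))
      (projIcc 0 1 zero_le_one (min (2 * (t : ℝ)) (min ((t : ℝ) + 1 / 4) (((t : ℝ) + 1) / 2))))
    rw [trans_eq, trans_eq p.1 (q.1.trans r.1), pr mem]
    by_cases h : (t : ℝ) ≤ 1 / 2
    · rw [if_pos h, trans_eq, pr ⟨by linarith, by linarith⟩]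
      by_cases h2 : (t : ℝ) ≤ 1 / 4
      · have e : min (2 * (t : ℝ)) (min ((t : ℝ) + 1 / 4) (((t : ℝ) + 1) / 2)) = 2 * t :=
          min_eq_left (le_min (by linarith) (by linarith))
        rw [e, if_pos (by linarith), if_pos (by linarith)]
      · have e : min (2 * (t : ℝ)) (min ((t : ℝ) + 1 / 4) (((t : ℝ) + 1) / 2)) = t + 1 / 4 := by
          rw [min_eq_left (by linarith : (t : ℝ) + 1 / 4 ≤ ((t : ℝ) + 1) / 2),
            min_eq_right (by linarith)]
        rw [e, if_neg (by linarith), if_neg (by linarith), trans_eq,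
          pr ⟨by linarith, by linarith⟩, if_pos (by linarith)]
        congr 2
        ring
    · have e : min (2 * (t : ℝ)) (min ((t : ℝ) + 1 / 4) (((t : ℝ) + 1) / 2)) = (t + 1) / 2 := by
        rw [min_eq_right (by linarith : ((t : ℝ) + 1) / 2 ≤ (t : ℝ) + 1 / 4),
          min_eq_right (by linarith)]
      rw [if_neg h, e, if_neg (by linarith), trans_eq, pr ⟨by linarith, by linarith⟩,
        if_neg (by linarith)]
      congr 2
      ring

/-- The category of directed paths modulo the equivalence relation generated by weakly monotone
reparametrization (`Quot` takes the generated equivalence relation). -/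
instance pathCategory : Category.{u} (PathCat d) where
  Hom x y := Quot (d.Reparam (x := x.pt) (y := y.pt))
  id x := Quot.mk _ (DirPath.refl d x.pt)
  comp {x y z} := Quot.map₂ (fun p q => p.trans q)
    (fun p _ _ h => reparam_trans (reparam_rfl p) h)
    (fun _ _ q h => reparam_trans h (reparam_rfl q))
  id_comp := by
    rintro x y ⟨p⟩
    exact (Quot.sound (reparam_refl_trans p)).symm
  comp_id := by
    rintro x y ⟨p⟩
    exact (Quot.sound (reparam_trans_refl p)).symm
  assoc := by
    rintro x y z a ⟨p⟩ ⟨q⟩ ⟨r⟩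
    exact (Quot.sound (reparam_assoc p q r)).symm

/-- The arrow represented by a directed path. -/
def pathClass {x y : X} (p : d.DirPath x y) : (PathCat.mk x : PathCat d) ⟶ PathCat.mk y :=
  Quot.mk _ p

/-- `h` is a map of directed spaces from the directed square to `(X, d)`: it sends the paths in the
square which are monotone in both coordinates to directed paths. -/
def IsDirectedSquare (h : C(I × I, X)) : Prop :=
  ∀ a b : C(I, I), Monotone a → Monotone b → h.comp (a.prodMk b) ∈ d.dpaths

/-- Immediate `d`-homotopy (relative to the endpoints) of parallel arrows. -/
def ImmediateHomotopy : HomRel (PathCat d) := fun x y α β =>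
  ∃ p q : d.DirPath x.pt y.pt, α = d.pathClass p ∧ β = d.pathClass q ∧
    ∃ h : C(I × I, X), d.IsDirectedSquare h ∧
      (∀ t, h (t, 0) = p.1 t) ∧ (∀ t, h (t, 1) = q.1 t) ∧
      (∀ s, h (0, s) = x.pt) ∧ (∀ s, h (1, s) = y.pt)

/-- The fundamental category: the quotient by the congruence generated by immediate
`d`-homotopy. -/
abbrev FundamentalCategory : Type u := CategoryTheory.Quotient d.ImmediateHomotopy

/-- A point of `X` as an object of the fundamental category. -/
def fundObj (x : X) : d.FundamentalCategory := ⟨⟨x⟩⟩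

/-- The arrow of the fundamental category represented by a directed path. -/
def homotopyClass {x y : X} (p : d.DirPath x y) : d.fundObj x ⟶ d.fundObj y :=
  (CategoryTheory.Quotient.functor d.ImmediateHomotopy).map (d.pathClass p)

end DSpace

/-! ### Orientations of topological manifolds -/

/-- A local homeomorphism `f` of `ℝⁿ` at `p` preserves orientation: on a punctured neighbourhood of
`p`, the map `y ↦ f y - f p` into `ℝⁿ ∖ {0}` is homotopic to `y ↦ y - p`, i.e. `f` has local
degree `1` at `p`. For `n = 0` this always holds. -/
def OrientationPreservingAt {n : ℕ} (f : (Fin n → ℝ) → (Fin n → ℝ)) (p : Fin n → ℝ) : Prop :=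
  ∃ U ∈ 𝓝 p, ∃ H : I × (Fin n → ℝ) → (Fin n → ℝ),
    ContinuousOn H (univ ×ˢ (U \ {p})) ∧
    ∀ y ∈ U \ {p}, H (0, y) = f y - f p ∧ H (1, y) = y - p ∧ ∀ t, H (t, y) ≠ 0

/-- An orientation of a topological `n`-manifold: a sign for each chart at each point of its source,
locally constant, such that two charts at a point have the same sign exactly if the transition
map preserves orientation there. (For `n = 0` it is a sign for each point.) -/
structure ManifoldOrientation (n : ℕ) (M : Type u) [TopologicalSpace M] where
  sign : OpenPartialHomeomorph M (Fin n → ℝ) → M → Bool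
  locally_const : ∀ φ, ∀ x ∈ φ.source, ∀ᶠ y in 𝓝 x, sign φ y = sign φ x
  compat : ∀ φ ψ : OpenPartialHomeomorph M (Fin n → ℝ), ∀ x ∈ φ.source, x ∈ ψ.source →
    (sign φ x = sign ψ x ↔ OrientationPreservingAt (fun v => ψ (φ.symm v)) (φ x))

/-! ### Oriented manifolds with defect -/

/-- The open cone on `k` points: `k` half-open intervals `[0, 1)` glued at `0`. -/
def OpenCone (k : ℕ) : Type :=
  {v : Fin k → ℝ // (∀ i, 0 ≤ v i ∧ v i < 1) ∧ ∀ i j, v i ≠ 0 → v j ≠ 0 → i = j}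

instance (k : ℕ) : TopologicalSpace (OpenCone k) := instTopologicalSpaceSubtype

/-- The apex of the cone. -/
def OpenCone.apex (k : ℕ) : OpenCone k :=
  ⟨0, fun _ => ⟨le_rfl, zero_lt_one⟩, fun _ _ h => absurd rfl h⟩

/-- A collared stratification of `X` with the two levels `X_{d-1} = defect` and `X_d = X`, where
`d = n + 1`, with orientations of the strata and a multicollar cover. The strata are the connected
components of the defect and of its complement, the bulk. The collar of a defect stratum `S` is
`S × CF` with `F` a set of `valence S` points; `X` is a manifold near `S` if and only if there are
two points. The members of the cover that belong to bulk strata are the strata themselves. -/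
structure ManifoldWithDefect (n : ℕ) (X : Type u) [TopologicalSpace X] where
  defect : Set X
  isClosed_defect : IsClosed defect
  bulk_manifold : Nonempty (ChartedSpace (Fin (n + 1) → ℝ) ↥(defectᶜ))
  defect_manifold : Nonempty (ChartedSpace (Fin n → ℝ) ↥defect)
  bulkOrientation : ManifoldOrientation (n + 1) ↥(defectᶜ)
  defectOrientation : ManifoldOrientation n ↥defect
  valence : ConnectedComponents ↥defect → ℕ
  collar : ∀ S : ConnectedComponents ↥defect,
    {x : ↥defect // ConnectedComponents.mk x = S} × OpenCone (valence S) → X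
  collar_open : ∀ S, IsOpenEmbedding (collar S)
  collar_apex : ∀ S x, collar S (x, OpenCone.apex _) = x.1.1
  collar_mem : ∀ S z, collar S z ∈ defect → z.2 = OpenCone.apex _

namespace ManifoldWithDefect

variable {n : ℕ} {X : Type u} [TopologicalSpace X] (M : ManifoldWithDefect n X)

/-- The strata: bulk strata (`inl`) and defect strata (`inr`). -/
abbrev Strata : Type u := ConnectedComponents ↥(M.defectᶜ) ⊕ ConnectedComponents ↥M.defect

open Classical in
/-- The stratum containing a point. -/
def stratumOf (x : X) : M.Strata :=
  if h : x ∈ M.defect then Sum.inr (ConnectedComponents.mk ⟨x, h⟩)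
  else Sum.inl (ConnectedComponents.mk ⟨x, h⟩)

/-- The strata of the collar neighbourhood of `S`: `none` is `S` itself and `some i` is the `i`-th
page `S × (0, 1)`. -/
def InLocalStratum (S : ConnectedComponents ↥M.defect) :
    Option (Fin (M.valence S)) → X → Prop
  | none, x => ∃ y, M.collar S (y, OpenCone.apex _) = x
  | some i, x => ∃ z, M.collar S z = x ∧ 0 < z.2.1 i

/-- The boundary orientation (outward normal first) induced on `S` by the bulk orientation of its
`i`-th page agrees with the orientation of `S`: if `ψ` is a chart of the defect and `φ` is the bulk
chart which is `(y, t) ↦ (-t, ψ y)` in the page, then `φ` and `ψ` have the same sign. -/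
def BoundaryOrientationAgrees (S : ConnectedComponents ↥M.defect) (i : Fin (M.valence S)) :
    Prop :=
  ∃ (z : {x : ↥M.defect // ConnectedComponents.mk x = S} × OpenCone (M.valence S))
    (q : ↥(M.defectᶜ)) (ψ : OpenPartialHomeomorph ↥M.defect (Fin n → ℝ))
    (φ : OpenPartialHomeomorph ↥(M.defectᶜ) (Fin (n + 1) → ℝ)),
    0 < z.2.1 i ∧ M.collar S z = q ∧ z.1.1 ∈ ψ.source ∧ q ∈ φ.source ∧
    (∀ᶠ q' in 𝓝 q, ∀ z', M.collar S z' = q'.1 →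
      φ q' = Fin.cons (-(z'.2.1 i)) (ψ z'.1.1)) ∧
    M.bulkOrientation.sign φ q = M.defectOrientation.sign ψ z.1.1

/-- The stratum `S` boundary covers its pages whose boundary orientation agrees with its own. -/
inductive BoundaryCovers (S : ConnectedComponents ↥M.defect) :
    Option (Fin (M.valence S)) → Option (Fin (M.valence S)) → Prop
  | intro (i) : M.BoundaryOrientationAgrees S i → BoundaryCovers S (some i) none

/-- Pages whose boundary orientation is opposite to that of `S` (i.e. does not agree, `S` being
connected) anti-boundary cover `S`. -/
inductive AntiBoundaryCovers (S : ConnectedComponents ↥M.defect) :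
    Option (Fin (M.valence S)) → Option (Fin (M.valence S)) → Prop
  | intro (i) : ¬ M.BoundaryOrientationAgrees S i → AntiBoundaryCovers S none (some i)

/-- The preorder `≼₊` on the collar neighbourhood of `S`. -/
def LePlus (S : ConnectedComponents ↥M.defect) (x y : X) : Prop :=
  ∃ a b, M.InLocalStratum S a x ∧ M.InLocalStratum S b y ∧
    Relation.ReflTransGen (M.BoundaryCovers S) a b

/-- The preorder `≼₋` on the collar neighbourhood of `S`. -/
def LeMinus (S : ConnectedComponents ↥M.defect) (x y : X) : Prop :=
  ∃ a b, M.InLocalStratum S a x ∧ M.InLocalStratum S b y ∧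
    Relation.ReflTransGen (M.AntiBoundaryCovers S) a b

/-- `p` maps `[a, b]` into a member of the multicollar cover and is monotone there for `≼₊` or for
`≼₋`. In the bulk these preorders are chaotic. (A monotone path in a collar visits at most one
page.) -/
def MonotoneOnPiece (p : I → X) (a b : I) : Prop :=
  (∀ t ∈ Icc a b, p t ∈ M.defectᶜ) ∨
  ∃ S, (∀ t ∈ Icc a b, p t ∈ range (M.collar S)) ∧
    ((∀ s ∈ Icc a b, ∀ t ∈ Icc a b, s ≤ t → M.LePlus S (p s) (p t)) ∨
     (∀ s ∈ Icc a b, ∀ t ∈ Icc a b, s ≤ t → M.LeMinus S (p s) (p t)))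

/-- The paths of the restricted oriented `d`-space structure. -/
def IsDirected (p : I → X) : Prop :=
  ∃ (m : ℕ) (a : ℕ → I), Monotone a ∧ a 0 = 0 ∧ a m = 1 ∧
    ∀ k < m, M.MonotoneOnPiece p (a k) (a (k + 1))

variable {M} in
theorem MonotoneOnPiece.pullback {p q : I → X} {a b a' b' : I} (h : M.MonotoneOnPiece p a b)
    (g : I → I) (hg : Monotone g) (hmaps : ∀ t ∈ Icc a' b', g t ∈ Icc a b)
    (hq : ∀ t ∈ Icc a' b', q t = p (g t)) : M.MonotoneOnPiece q a' b' := by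
  rcases h with h | ⟨S, h1, h2 | h2⟩
  · exact Or.inl fun t ht => by rw [hq t ht]; exact h _ (hmaps t ht)
  · refine Or.inr ⟨S, fun t ht => by rw [hq t ht]; exact h1 _ (hmaps t ht), Or.inl ?_⟩
    intro s hs t ht hst
    rw [hq s hs, hq t ht]
    exact h2 _ (hmaps s hs) _ (hmaps t ht) (hg hst)
  · refine Or.inr ⟨S, fun t ht => by rw [hq t ht]; exact h1 _ (hmaps t ht), Or.inr ?_⟩
    intro s hs t ht hst
    rw [hq s hs, hq t ht]
    exact h2 _ (hmaps s hs) _ (hmaps t ht) (hg hst)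

theorem monotoneOnPiece_const {p : I → X} {a b : I} (x : X) (h : ∀ t ∈ Icc a b, p t = x) :
    M.MonotoneOnPiece p a b := by
  by_cases hx : x ∈ M.defect
  · have e : M.collar (ConnectedComponents.mk ⟨x, hx⟩) (⟨⟨x, hx⟩, rfl⟩, OpenCone.apex _) = x :=
      M.collar_apex _ _
    refine Or.inr ⟨ConnectedComponents.mk ⟨x, hx⟩, fun t ht => ⟨_, by rw [h t ht]; exact e⟩,
      Or.inl fun s hs t ht _ => ?_⟩
    rw [h s hs, h t ht]
    exact ⟨none, none, ⟨_, e⟩, ⟨_, e⟩, Relation.ReflTransGen.refl⟩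
  · exact Or.inl fun t ht => by rw [h t ht]; exact hx

theorem isDirected_reparam {p : I → X} (hp : M.IsDirected p) (f : C(I, I)) (hf : Monotone f) :
    M.IsDirected (fun t => p (f t)) := by
  obtain ⟨m, a, ha, a0, am, h⟩ := hp
  have f01 : f 0 ≤ f 1 := hf zero_le_one
  have hsurj : ∀ c : I, ∃ t : I, f 0 ≤ c → c ≤ f 1 → f t = c := by
    intro c
    by_cases hc : f 0 ≤ c ∧ c ≤ f 1
    · obtain ⟨t, ht⟩ := intermediate_value_univ (0 : I) 1 f.continuous hc
      exact ⟨t, fun _ _ => ht⟩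
    · exact ⟨0, fun h1 h2 => absurd ⟨h1, h2⟩ hc⟩
  choose g hg using hsurj
  let c : ℕ → I := fun k => max (f 0) (min (a k) (f 1))
  have hcm : Monotone c := fun k l hkl => max_le_max le_rfl (min_le_min (ha hkl) le_rfl)
  have hgc : ∀ k, f (g (c k)) = c k := fun k =>
    hg _ (le_max_left _ _) (max_le f01 (min_le_right _ _))
  let b : ℕ → I := fun k => if k = 0 then 0 else if m ≤ k then 1 else g (c k)
  have hm : m ≠ 0 := by
    rintro rfl
    rw [a0] at am
    exact zero_ne_one am
  have hb : ∀ k, f (b k) = c k := by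
    intro k
    by_cases hk : k = 0
    · subst hk
      simp [b, c, a0]
    · by_cases hk2 : m ≤ k
      · have : a k = 1 := le_antisymm (unitInterval.le_one _) (am ▸ ha hk2)
        simp only [b, c, if_neg hk, if_pos hk2, this]
        rw [min_eq_right (show f 1 ≤ 1 from unitInterval.le_one (f 1)), max_eq_right f01]
      · simp only [b, if_neg hk, if_neg hk2]
        exact hgc k
  have hbm : Monotone b := by
    refine monotone_nat_of_le_succ fun k => ?_
    by_cases hk : k = 0
    · simp [b, hk]
    · by_cases hk2 : m ≤ k + 1
      · have : b (k + 1) = 1 := by simp [b, hk2]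
        rw [this]; exact unitInterval.le_one _
      · have e1 : b k = g (c k) := by simp [b, hk, show ¬ m ≤ k by omega]
        have e2 : b (k + 1) = g (c (k + 1)) := by simp [b, hk2]
        rw [e1, e2]
        by_contra hlt
        rw [not_le] at hlt
        have h1 := hf hlt.le
        rw [hgc, hgc] at h1
        rw [le_antisymm h1 (hcm (Nat.le_succ k))] at hlt
        exact lt_irrefl _ hlt
  refine ⟨m, b, hbm, by simp [b], by simp [b, hm], fun k hk => ?_⟩
  have hmaps : ∀ t ∈ Icc (b k) (b (k + 1)), f t ∈ Icc (c k) (c (k + 1)) := fun t ht => by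
    rw [← hb, ← hb]; exact ⟨hf ht.1, hf ht.2⟩
  rcases lt_or_ge (a (k + 1)) (f 0) with h1 | h1
  · refine M.monotoneOnPiece_const (p (f 0)) fun t ht => ?_
    have e : c (k + 1) = f 0 := max_eq_left ((min_le_left _ _).trans h1.le)
    have := (hmaps t ht).2
    rw [e] at this
    rw [le_antisymm this (hf (unitInterval.nonneg t))]
  · rcases lt_or_ge (f 1) (a k) with h2 | h2
    · refine M.monotoneOnPiece_const (p (f 1)) fun t ht => ?_
      have e : c k = f 1 := by
        simp only [c]
        rw [min_eq_right h2.le, max_eq_right f01]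
      have := (hmaps t ht).1
      rw [e] at this
      rw [le_antisymm (hf (unitInterval.le_one t)) this]
    · refine (h k hk).pullback f hf (fun t ht => ⟨?_, ?_⟩) fun _ _ => rfl
      · refine le_trans ?_ (hmaps t ht).1
        simp only [c]
        rw [min_eq_left h2]
        exact le_max_right _ _
      · exact (hmaps t ht).2.trans (max_le h1 (min_le_left _ _))

theorem isDirected_concat {x y z : X} (p : Path x y) (q : Path y z) (hp : M.IsDirected p)
    (hq : M.IsDirected q) : M.IsDirected (p.trans q) := by
  obtain ⟨m, a, ha, a0, am, h⟩ := hp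
  obtain ⟨l, b, hb, b0, bl, h'⟩ := hq
  let c : ℕ → I := fun k => if k ≤ m then ⟨(a k : ℝ) / 2, by
      constructor <;> linarith [(a k).2.1, (a k).2.2]⟩
    else ⟨(1 + (b (k - m) : ℝ)) / 2, by
      constructor <;> linarith [(b (k - m)).2.1, (b (k - m)).2.2]⟩
  have c1 : ∀ k, k ≤ m → (c k : ℝ) = (a k : ℝ) / 2 := fun k hk => by simp [c, hk]
  have c2 : ∀ k, m ≤ k → (c k : ℝ) = (1 + (b (k - m) : ℝ)) / 2 := fun k hk => by
    rcases hk.eq_or_lt with rfl | hk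
    · rw [c1 _ le_rfl, am]; simp [b0]
    · simp [c, not_le.2 hk]
  have l0 : l ≠ 0 := by
    rintro rfl
    rw [b0] at bl
    exact zero_ne_one bl
  refine ⟨m + l, c, ?_, ?_, ?_, ?_⟩
  · refine monotone_nat_of_le_succ fun k => ?_
    change (c k : ℝ) ≤ c (k + 1)
    rcases lt_or_ge k m with hk | hk
    · rw [c1 k hk.le, c1 (k + 1) hk]
      have : (a k : ℝ) ≤ a (k + 1) := ha (Nat.le_succ k)
      linarith
    · rw [c2 k hk, c2 (k + 1) (by omega)]
      have : (b (k - m) : ℝ) ≤ b (k + 1 - m) := hb (by omega)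
      linarith
  · apply Subtype.ext
    rw [c1 0 (Nat.zero_le _), a0]; simp
  · apply Subtype.ext
    rw [c2 _ (Nat.le_add_right _ _), Nat.add_sub_cancel_left, bl]; simp
  · intro k hk
    rcases lt_or_ge k m with hkm | hkm
    · have e1 := c1 k hkm.le
      have e2 := c1 (k + 1) hkm
      refine (h k hkm).pullback (fun t : I => projIcc (0 : ℝ) 1 zero_le_one (2 * (t : ℝ)))
        (fun s t hst => monotone_projIcc _ (by
          have : (s : ℝ) ≤ t := hst
          linarith)) (fun t ht => ?_) (fun t ht => ?_)
      · have h1 : (c k : ℝ) ≤ t := ht.1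
        have h2 : (t : ℝ) ≤ c (k + 1) := ht.2
        have h3 := (a k).2.1
        have h4 := (a (k + 1)).2.2
        have e : projIcc (0 : ℝ) 1 zero_le_one (2 * (t : ℝ)) =
          ⟨2 * (t : ℝ), by linarith [t.2.1], by linarith⟩ := projIcc_of_mem _ _
        rw [e]
        constructor
        · change (a k : ℝ) ≤ 2 * t
          linarith
        · change 2 * (t : ℝ) ≤ a (k + 1)
          linarith
      · have h2 : (t : ℝ) ≤ c (k + 1) := ht.2
        have h4 := (a (k + 1)).2.2
        rw [DSpace.trans_eq, if_pos (by linarith)]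
    · have e1 := c2 k hkm
      have e2 := c2 (k + 1) (by omega)
      have e3 : k + 1 - m = k - m + 1 := by omega
      rw [e3] at e2
      refine (h' (k - m) (by omega)).pullback
        (fun t : I => projIcc (0 : ℝ) 1 zero_le_one (2 * (t : ℝ) - 1))
        (fun s t hst => monotone_projIcc _ (by
          have : (s : ℝ) ≤ t := hst
          linarith)) (fun t ht => ?_) (fun t ht => ?_)
      · have h1 : (c k : ℝ) ≤ t := ht.1
        have h2 : (t : ℝ) ≤ c (k + 1) := ht.2
        have h3 := (b (k - m)).2.1
        have h4 := (b (k - m + 1)).2.2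
        have e : projIcc (0 : ℝ) 1 zero_le_one (2 * (t : ℝ) - 1) =
          ⟨2 * (t : ℝ) - 1, by linarith, by linarith [t.2.2]⟩ := projIcc_of_mem _ _
        rw [e]
        constructor
        · change (b (k - m) : ℝ) ≤ 2 * t - 1
          linarith
        · change 2 * (t : ℝ) - 1 ≤ b (k - m + 1)
          linarith
      · have h1 : (c k : ℝ) ≤ t := ht.1
        have h3 := (b (k - m)).2.1
        rw [DSpace.trans_eq]
        split_ifs with hle
        · rw [projIcc_of_right_le zero_le_one (by linarith : (1 : ℝ) ≤ 2 * (t : ℝ)),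
            projIcc_of_le_left zero_le_one (by linarith : 2 * (t : ℝ) - 1 ≤ 0)]
          exact p.target.trans q.source.symm
        · rfl

/-- The restricted oriented `d`-space structure. -/
def dSpace : DSpace X where
  dpaths := {p | M.IsDirected p}
  const_mem x := ⟨1, fun k => if k = 0 then 0 else 1,
    monotone_nat_of_le_succ fun k => by split_ifs <;> simp_all, rfl, rfl,
    fun _ _ => M.monotoneOnPiece_const x fun _ _ => rfl⟩
  reparam_mem _ hp f hf := M.isDirected_reparam hp f hf
  concat_mem p q hp hq := M.isDirected_concat p q hp hq

/-- A choice of a base point in each stratum. -/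
structure BasePoints where
  bulkPt : ConnectedComponents ↥(M.defectᶜ) → ↥(M.defectᶜ)
  defectPt : ConnectedComponents ↥M.defect → ↥M.defect
  mk_bulkPt : ∀ B, ConnectedComponents.mk (bulkPt B) = B
  mk_defectPt : ∀ S, ConnectedComponents.mk (defectPt S) = S

variable {M} in
/-- The base point in a stratum. -/
def BasePoints.pt (b : M.BasePoints) : M.Strata → X
  | Sum.inl B => (b.bulkPt B).1
  | Sum.inr S => (b.defectPt S).1

variable {M} in
/-- The full subcategory of the fundamental category on the base points. -/
abbrev BasePoints.FundamentalParcel (b : M.BasePoints) : Type u :=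
  InducedCategory M.dSpace.FundamentalCategory (fun st => M.dSpace.fundObj (b.pt st))

variable {M} in
/-- The arrow between base points represented by a directed path. -/
def BasePoints.arrow (b : M.BasePoints) {st st' : M.Strata}
    (p : M.dSpace.DirPath (b.pt st) (b.pt st')) :
    (show b.FundamentalParcel from st) ⟶ (show b.FundamentalParcel from st') :=
  InducedCategory.homMk (M.dSpace.homotopyClass p)

end ManifoldWithDefect

/-! ### Parcels over the path category of the graph with two vertices and two opposite edges -/

/-- The vertices bulk and defect. -/
inductive Gamma2 : Type
  | beta
  | delta

/-- The edges: inbound, from bulk to defect, and outbound, from defect to bulk. -/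
inductive Gamma2.Edge : Gamma2 → Gamma2 → Type
  | iota : Gamma2.Edge .beta .delta
  | omega : Gamma2.Edge .delta .beta

instance : Quiver Gamma2 := ⟨Gamma2.Edge⟩

namespace Gamma2

/-- The object `β` of the path category. -/
def objBeta : Paths Gamma2 := (Paths.of Gamma2).obj .beta

/-- The object `δ` of the path category. -/
def objDelta : Paths Gamma2 := (Paths.of Gamma2).obj .delta

/-- The generating arrow `ι`. -/
def arrIota : objBeta ⟶ objDelta := (Paths.of Gamma2).map Edge.iota

/-- The generating arrow `ω`. -/
def arrOmega : objDelta ⟶ objBeta := (Paths.of Gamma2).map Edge.omega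

end Gamma2

open Gamma2

section Parcels

variable {C : Type v} [Category.{w} C] (γ : C ⥤ Paths Gamma2)

/-- The set of arrows of `C` above an arrow of the path category. -/
def ArrowFiber (a : Arrow (Paths Gamma2)) : Type (max v w) :=
  {f : Arrow C // γ.mapArrow.obj f = a}

/-- `(C, γ)` is a parcel: `γ` is conservative and surjective on arrows. -/
structure IsParcel : Prop where
  conservative : γ.ReflectsIsomorphisms
  surjective : Function.Surjective γ.mapArrow.obj

/-- Fiber-finiteness: finitely many arrows above each arrow. -/
def IsFiberFinite : Prop := ∀ a, Finite (ArrowFiber γ a)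

/-- Regularity: injectivity on objects. -/
def IsRegularParcel : Prop := Function.Injective γ.obj

end Parcels

namespace ManifoldWithDefect

variable {n : ℕ} {X : Type u} [TopologicalSpace X] {M : ManifoldWithDefect n X}

/-- `Φ` is the structural functor of the fundamental parcel: base points in the bulk go to `β` and
those in the defect to `δ`, paths inside a stratum go to identities, paths that run first in the bulk
and then in the defect go to `ι`, and paths that run first in the defect and then in the bulk
go to `ω`. -/
structure IsStructuralFunctor (b : M.BasePoints) (Φ : b.FundamentalParcel ⥤ Paths Gamma2) :
    Prop where
  obj_bulk : ∀ B, Φ.obj (Sum.inl B) = objBeta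
  obj_defect : ∀ S, Φ.obj (Sum.inr S) = objDelta
  map_bulk : ∀ {B B'} (p : M.dSpace.DirPath (b.pt (Sum.inl B)) (b.pt (Sum.inl B'))),
    (∀ t, p.1 t ∉ M.defect) → Arrow.mk (Φ.map (b.arrow p)) = Arrow.mk (𝟙 objBeta)
  map_defect : ∀ {S S'} (p : M.dSpace.DirPath (b.pt (Sum.inr S)) (b.pt (Sum.inr S'))),
    (∀ t, p.1 t ∈ M.defect) → Arrow.mk (Φ.map (b.arrow p)) = Arrow.mk (𝟙 objDelta)
  map_inbound : ∀ {B S} (p : M.dSpace.DirPath (b.pt (Sum.inl B)) (b.pt (Sum.inr S))) (r : I),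
    (∀ t, t < r → p.1 t ∉ M.defect) → (∀ t, r ≤ t → p.1 t ∈ M.defect) →
      Arrow.mk (Φ.map (b.arrow p)) = Arrow.mk arrIota
  map_outbound : ∀ {S B} (p : M.dSpace.DirPath (b.pt (Sum.inr S)) (b.pt (Sum.inl B))) (r : I),
    (∀ t, t ≤ r → p.1 t ∈ M.defect) → (∀ t, r < t → p.1 t ∉ M.defect) →
      Arrow.mk (Φ.map (b.arrow p)) = Arrow.mk arrOmega

/-- Parcel maps from the fundamental parcel, with structural functor `Φ`, to `(C, γ)`. The number of
these is the counting invariant. -/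
def ParcelMap {b : M.BasePoints} (Φ : b.FundamentalParcel ⥤ Paths Gamma2)
    {C : Type v} [Category.{w} C] (γ : C ⥤ Paths Gamma2) :=
  {F : b.FundamentalParcel ⥤ C // F ⋙ γ = Φ}

/-! ### Directed triangulations and colorings -/

variable (M) in
/-- A directed triangulation: a finite simplicial complex with a homeomorphism of its space to `X`
such that every simplex meets the defect in the empty set or in a face (so that the defect is
a subcomplex), and a total order of the vertices in each stratum. -/
structure DirectedTriangulation where
  dim : ℕ
  K : Geometry.SimplicialComplex ℝ (EuclideanSpace ℝ (Fin dim))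
  finite_faces : K.faces.Finite
  homeo : ↥K.space ≃ₜ X
  flag_like : ∀ s ∈ K.faces,
    (∀ x : ↥K.space, x.1 ∈ convexHull ℝ (s : Set (EuclideanSpace ℝ (Fin dim))) →
      homeo x ∉ M.defect) ∨
    ∃ t ∈ K.faces, t ⊆ s ∧
      ∀ x : ↥K.space, x.1 ∈ convexHull ℝ (s : Set (EuclideanSpace ℝ (Fin dim))) →
        (homeo x ∈ M.defect ↔ x.1 ∈ convexHull ℝ (t : Set (EuclideanSpace ℝ (Fin dim))))
  lt : ↥K.vertices → ↥K.vertices → Prop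
  lt_total : ∀ st : M.Strata, IsStrictTotalOrder
    {v : ↥K.vertices // M.stratumOf (homeo ⟨v.1, K.vertices_subset_space v.2⟩) = st}
    (fun v w => lt v.1 w.1)

namespace DirectedTriangulation

variable (T : M.DirectedTriangulation)

/-- The point of `X` at a vertex. -/
def pos (v : ↥T.K.vertices) : X := T.homeo ⟨v.1, T.K.vertices_subset_space v.2⟩

/-- `p` traverses the edge from `v` to `w`. -/
def IsEdgePath (v w : ↥T.K.vertices) (p : C(I, X)) : Prop :=
  ∀ t : I, (T.homeo.symm (p t)).1 = AffineMap.lineMap v.1 w.1 (t : ℝ)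

/-- `v` and `w` span an edge and it is oriented from `v` to `w`: by the order of the vertices if
it lies in one stratum, and so that it is a directed path otherwise. -/
def Dir (v w : ↥T.K.vertices) : Prop :=
  v ≠ w ∧ (∃ s ∈ T.K.faces, (s : Set (EuclideanSpace ℝ (Fin T.dim))) = {v.1, w.1}) ∧
  ((M.stratumOf (T.pos v) = M.stratumOf (T.pos w) ∧ T.lt v w) ∨
   (M.stratumOf (T.pos v) ≠ M.stratumOf (T.pos w) ∧
      ∃ p ∈ M.dSpace.dpaths, T.IsEdgePath v w p))

/-- The oriented edges. -/
def OrientedEdge : Type := {e : ↥T.K.vertices × ↥T.K.vertices // T.Dir e.1 e.2}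

/-- The number of vertices in the bulk. -/
def bulkVertexCount : ℕ := Nat.card {v : ↥T.K.vertices // T.pos v ∉ M.defect}

/-- The number of vertices in the defect. -/
def defectVertexCount : ℕ := Nat.card {v : ↥T.K.vertices // T.pos v ∈ M.defect}

/-- Colorings of the edges by arrows of `C`. -/
structure IsColoring {C : Type v} [Category.{w} C] (γ : C ⥤ Paths Gamma2)
    (col : T.OrientedEdge → Arrow C) : Prop where
  bulk : ∀ e, T.pos e.1.1 ∉ M.defect → T.pos e.1.2 ∉ M.defect →
    γ.mapArrow.obj (col e) = Arrow.mk (𝟙 objBeta)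
  defect : ∀ e, T.pos e.1.1 ∈ M.defect → T.pos e.1.2 ∈ M.defect →
    γ.mapArrow.obj (col e) = Arrow.mk (𝟙 objDelta)
  inbound : ∀ e, T.pos e.1.1 ∉ M.defect → T.pos e.1.2 ∈ M.defect →
    γ.mapArrow.obj (col e) = Arrow.mk arrIota
  outbound : ∀ e, T.pos e.1.1 ∈ M.defect → T.pos e.1.2 ∉ M.defect →
    γ.mapArrow.obj (col e) = Arrow.mk arrOmega
  face : ∀ (x y z : ↥T.K.vertices) (hxy : T.Dir x y) (hyz : T.Dir y z) (hxz : T.Dir x z),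
    (∃ s ∈ T.K.faces, (s : Set (EuclideanSpace ℝ (Fin T.dim))) = {x.1, y.1, z.1}) →
    ∃ (a b c : C) (f : a ⟶ b) (g : b ⟶ c), col ⟨(x, y), hxy⟩ = Arrow.mk f ∧
      col ⟨(y, z), hyz⟩ = Arrow.mk g ∧ col ⟨(x, z), hxz⟩ = Arrow.mk (f ≫ g)

/-- The set of colorings. -/
def Coloring {C : Type v} [Category.{w} C] (γ : C ⥤ Paths Gamma2) : Type (max v w) :=
  {col : T.OrientedEdge → Arrow C // T.IsColoring γ col}

end DirectedTriangulation

end ManifoldWithDefect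

end

/-! The fundamental category is generated by the directed straight segments of the triangulation,
subject only to the triangle relations inside each simplex. Once this is known, a functor on the
vertices is the same as a coloring, and the formula is a comparison of two choices of objects in one
category.

Local picture. The defect is a full subcomplex (`mem_defect_iff`). In a simplex that meets both bulk
and defect, the bulk part close to a defect point is connected, hence lies in one page, and the
orientation type of that page is the same at all defect points of the simplex (`PageAt.agrees_iff`).
So a mixed simplex is either inbound or outbound, and never both. Close to a point `w`, a directed
path passes from points that arrive at `w` to points that depart from `w` (`IsSmall.in_out`).

Segments determine functors. A `Cocycle` assigns arrows to directed segments compatibly with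
composition in each simplex. It is transported along a directed path by cutting the path into short
arriving and departing pieces. The transport exists and is unique by a local-to-global argument on
the interval (`unitInterval.rel_of_local`), and is invariant under directed homotopy because small
rectangles commute: both ways around factor through the same nearby point (`commutes_of_small`). A
cocycle thus yields a functor on the fundamental category. Conversely the classes of segments form a
cocycle `univCocycle`, and transport in it returns the class of the path
(`Cocycle.Tr.eq_homotopyClass`); so every arrow is a composition of segments (`hom_induction`).

Structural functor. The shortest arrows between `β` and `δ` form a cocycle, since no simplex is both
inbound and outbound. It gives existence; uniqueness follows because the prescribed values determine
the functor on segments, once their ends are joined to base points within strata.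

Colorings. An edge inside a stratum is colored by an arrow above an identity, which is invertible by
conservativity, so a coloring extends to segments that run against the order of the vertices. Every
point is joined inside its carrier to a vertex of the same kind, which extends the coloring to a
cocycle. Hence colorings are the lifts of the structural functor to the full subcategory on the
vertices (`coloringEquiv`).

Counting. Consider lifts on base points and vertices together. Each vertex is isomorphic to the base
point of its stratum, and each stratum contains a vertex. Adding an object isomorphic to one already
present multiplies the number of lifts by the number of arrows above the corresponding identity
(`Lift.extendEquiv`): any such arrow is invertible and may be chosen freely. Restricting to the base
points and to the vertices expresses the number of joint lifts in two ways (`exists_equiv_prod`),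
and division gives the formula. -/

/-! ### Chains of short intervals -/

/-- A transitive relation on the unit interval which holds between each point and the points close
to it holds between any two points in order. -/
theorem unitInterval.rel_of_local {P : I → I → Prop}
    (trans : ∀ a b c, a ≤ b → b ≤ c → P a b → P b c → P a c)
    (loc : ∀ t, ∀ᶠ s in 𝓝 t, (s ≤ t → P s t) ∧ (t ≤ s → P t s)) {s t : I} (h : s ≤ t) :
    P s t := by
  have hs : P s s := (loc s).self_of_nhds.1 le_rfl
  -- Demanding `P s u'` for all earlier `u'` makes the set an initial segment, so that limits from
  -- above cause no trouble in the closedness argument.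
  have key : Icc s t ⊆ {u | ∀ u' ∈ Icc s u, P s u'} := by
    refine IsClosed.Icc_subset_of_forall_exists_gt ?_ ?_ ?_
    · rw [← isSeqClosed_iff_isClosed]
      refine fun x y hx hy => ?_
      refine ⟨fun u' hu' => ?_, isClosed_Icc.mem_of_tendsto hy (.of_forall fun k => (hx k).2)⟩
      rcases hu'.2.eq_or_lt with rfl | hlt
      · obtain ⟨k, hk⟩ := (hy.eventually (loc u')).exists
        rcases le_total (x k) u' with h1 | h1
        · exact trans _ _ _ (hx k).2.1 h1 ((hx k).1 _ ⟨(hx k).2.1, le_rfl⟩) (hk.1 h1)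
        · exact (hx k).1 _ ⟨hu'.1, h1⟩
      · obtain ⟨k, hk⟩ := (hy.eventually (lt_mem_nhds hlt)).exists
        exact (hx k).1 _ ⟨hu'.1, le_of_lt hk⟩
    · intro u hu
      rw [show u = s from le_antisymm hu.2 hu.1]
      exact hs
    · intro x hx y hy
      have h1 : ∀ᶠ u in 𝓝[>] x, u ∈ Ioc x y := Ioc_mem_nhdsGT hy
      have h2 : ∃ ε > x, ∀ u ∈ Ico x ε, P x u := by
        obtain ⟨ε, hε, h⟩ := (mem_nhdsGE_iff_exists_Ico_subset' (show x < y from hy)).1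
          (nhdsWithin_le_nhds (loc x))
        exact ⟨ε, hε, fun u hu => (h hu).2 hu.1⟩
      obtain ⟨ε, hε, h2⟩ := h2
      obtain ⟨z, hz1, hz2⟩ := exists_between (lt_min hε hy)
      refine ⟨z, fun u' hu' => ?_, hz1, (hz2.trans_le (min_le_right _ _)).le⟩
      rcases le_total u' x with h3 | h3
      · exact hx.1 _ ⟨hu'.1, h3⟩
      · exact trans _ _ _ hx.2.1 h3 (hx.1 _ ⟨hx.2.1, le_rfl⟩)
          (h2 _ ⟨h3, (hu'.2.trans_lt hz2).trans_le (min_le_left _ _)⟩)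
  exact key ⟨h, le_rfl⟩ t ⟨h, le_rfl⟩

/-! ### Faces of simplices and carriers -/

namespace Geometry.SimplicialComplex

variable {E : Type*} [NormedAddCommGroup E] [NormedSpace ℝ E]

/-- The vertices extend to an affine basis of the whole space, whose coordinate functions are
globally defined affine maps. The default value `0` is never met for vertices of `s`. -/
theorem exists_barycentric {s : Finset E} (hs : AffineIndependent ℝ ((↑) : s → E)) :
    ∃ f : E → E →ᵃ[ℝ] ℝ, (∀ v ∈ s, f v v = 1) ∧ ∀ v ∈ s, ∀ u ∈ s, u ≠ v → f v u = 0 := by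
  obtain ⟨t, hst, ht, htop⟩ := exists_subset_affineIndependent_affineSpan_eq_top (s := (s : Set E)) hs
  let B : AffineBasis t ℝ E := ⟨(↑), ht, by simpa using htop⟩
  classical
  refine ⟨fun v => if h : v ∈ t then B.coord ⟨v, h⟩ else 0, fun v hv => ?_, fun v hv u hu huv => ?_⟩
  · simp only [dif_pos (hst hv)]
    exact B.coord_apply_eq ⟨v, hst hv⟩
  · simp only [dif_pos (hst hv)]
    exact B.coord_apply_ne (i := ⟨v, hst hv⟩) (j := ⟨u, hst hu⟩) fun h => huv (congrArg Subtype.val h).symm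

theorem barycentric_nonneg {s : Finset E} {f : E → E →ᵃ[ℝ] ℝ} (h1 : ∀ v ∈ s, f v v = 1)
    (h0 : ∀ v ∈ s, ∀ u ∈ s, u ≠ v → f v u = 0) {v : E} (hv : v ∈ s) {x : E}
    (hx : x ∈ convexHull ℝ (s : Set E)) : 0 ≤ f v x := by
  have : convexHull ℝ (s : Set E) ⊆ f v ⁻¹' Ici 0 := by
    refine convexHull_min (fun u hu => ?_) ((convex_Ici _).affine_preimage _)
    by_cases h : u = v
    · subst h; simp [h1 u hv]
    · simp [h0 v hv u hu h]
  exact this hx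

/-- Evaluating the barycentric functions on a convex combination recovers its weights, so the
weights outside `τ` vanish and can be dropped. -/
theorem mem_convexHull_of_barycentric {s τ : Finset E} (hτ : τ ⊆ s) {f : E → E →ᵃ[ℝ] ℝ}
    (h1 : ∀ v ∈ s, f v v = 1) (h0 : ∀ v ∈ s, ∀ u ∈ s, u ≠ v → f v u = 0) {x : E}
    (hx : x ∈ convexHull ℝ (s : Set E)) (h : ∀ v ∈ s, v ∉ τ → f v x = 0) :
    x ∈ convexHull ℝ (τ : Set E) := by
  rw [Finset.mem_convexHull'] at hx ⊢
  obtain ⟨w, w0, w1, hw⟩ := hx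
  have hf : ∀ v ∈ s, f v x = w v := fun v hv => by
    have e := Finset.affineCombination_eq_linear_combination s id w w1
    simp only [id] at e
    rw [← hw, ← e, Finset.map_affineCombination _ _ _ w1,
      Finset.affineCombination_eq_linear_combination _ _ _ w1, Finset.sum_eq_single v]
    · simp [h1 v hv]
    · intro u hu huv
      simp [h0 v hv u hu huv]
    · exact fun h => absurd hv h
  have hz : ∀ v ∈ s, v ∉ τ → w v = 0 := fun v hv hvt => by rw [← hf v hv, h v hv hvt]
  refine ⟨w, fun y hy => w0 y (hτ hy), ?_, ?_⟩
  · rw [← w1]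
    exact Finset.sum_subset hτ hz
  · rw [← hw]
    exact Finset.sum_subset hτ fun v hv hvt => by rw [hz v hv hvt, zero_smul]

theorem mem_convexHull_of_barycentric_zero {s τ : Finset E} (hτ : τ ⊆ s) {f : E → E →ᵃ[ℝ] ℝ}
    (h0 : ∀ v ∈ s, ∀ u ∈ s, u ≠ v → f v u = 0) {x : E}
    (hx : x ∈ convexHull ℝ (τ : Set E)) {v : E} (hv : v ∈ s) (hvt : v ∉ τ) : f v x = 0 := by
  have : convexHull ℝ (τ : Set E) ⊆ f v ⁻¹' {0} := by
    refine convexHull_min (fun u hu => ?_) ((convex_singleton _).affine_preimage _)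
    exact h0 v hv u (hτ hu) fun h => hvt (h ▸ hu)
  exact this hx

/-- Faces of a simplex are extreme. -/
theorem mem_face_of_lineMap_mem {s τ : Finset E} (hs : AffineIndependent ℝ ((↑) : s → E))
    (hτ : τ ⊆ s) {x z : E} (hx : x ∈ convexHull ℝ (s : Set E)) (hz : z ∈ convexHull ℝ (s : Set E))
    {c : ℝ} (c0 : 0 < c) (c1 : c < 1)
    (h : AffineMap.lineMap x z c ∈ convexHull ℝ (τ : Set E)) :
    x ∈ convexHull ℝ (τ : Set E) ∧ z ∈ convexHull ℝ (τ : Set E) := by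
  obtain ⟨f, h1, h0⟩ := exists_barycentric hs
  have key : ∀ v ∈ s, v ∉ τ → f v x = 0 ∧ f v z = 0 := fun v hv hvt => by
    have e := mem_convexHull_of_barycentric_zero hτ h0 h hv hvt
    rw [AffineMap.apply_lineMap, AffineMap.lineMap_apply_module] at e
    simp only [smul_eq_mul] at e
    have a := barycentric_nonneg h1 h0 hv hx
    have b := barycentric_nonneg h1 h0 hv hz
    constructor <;> nlinarith [mul_nonneg (sub_nonneg.2 c1.le) a, mul_nonneg c0.le b]
  exact ⟨mem_convexHull_of_barycentric hτ h1 h0 hx fun v hv hvt => (key v hv hvt).1,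
    mem_convexHull_of_barycentric hτ h1 h0 hz fun v hv hvt => (key v hv hvt).2⟩

variable (K : SimplicialComplex ℝ E)

/-- Take a face of least cardinality that contains `x`. Its intersection with any other face
containing `x` is again such a face, and by minimality it is everything. -/
theorem exists_carrier {x : E} (hx : x ∈ K.space) : ∃ s ∈ K.faces,
    x ∈ convexHull ℝ (s : Set E) ∧
      ∀ t ∈ K.faces, x ∈ convexHull ℝ (t : Set E) → s ⊆ t := by
  classical
  have hex : ∃ k, ∃ s ∈ K.faces, x ∈ convexHull ℝ (s : Set E) ∧ s.card = k := by
    obtain ⟨s, hs, h⟩ := mem_space_iff.1 hx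
    exact ⟨_, s, hs, h, rfl⟩
  obtain ⟨s, hs, hxs, hc⟩ := Nat.find_spec hex
  refine ⟨s, hs, hxs, fun t ht hxt => ?_⟩
  have h := K.inter_subset_convexHull hs ht ⟨hxs, hxt⟩
  rw [← Finset.coe_inter] at h
  have hne : (s ∩ t).Nonempty := by
    rw [← Finset.coe_nonempty, ← convexHull_nonempty_iff (𝕜 := ℝ)]
    exact ⟨x, h⟩
  have hle := Nat.find_min' hex ⟨s ∩ t, K.down_closed hs Finset.inter_subset_left hne, h, rfl⟩
  have e : s ∩ t = s := Finset.eq_of_subset_of_card_le Finset.inter_subset_left (by rw [hc]; exact hle)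
  exact Finset.inter_eq_left.1 e

open Classical in
/-- The smallest face containing a point. -/
noncomputable def carrier (x : E) : Finset E :=
  if hx : x ∈ K.space then (K.exists_carrier hx).choose else ∅

variable {K} {x z : E}

theorem carrier_mem_faces (hx : x ∈ K.space) : K.carrier x ∈ K.faces := by
  rw [carrier, dif_pos hx]
  exact (K.exists_carrier hx).choose_spec.1

theorem mem_convexHull_carrier (hx : x ∈ K.space) :
    x ∈ convexHull ℝ (K.carrier x : Set E) := by
  rw [carrier, dif_pos hx]
  exact (K.exists_carrier hx).choose_spec.2.1

theorem carrier_subset {t : Finset E} (ht : t ∈ K.faces) (hxt : x ∈ convexHull ℝ (t : Set E)) :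
    K.carrier x ⊆ t := by
  have hx : x ∈ K.space := convexHull_subset_space ht hxt
  rw [carrier, dif_pos hx]
  exact (K.exists_carrier hx).choose_spec.2.2 t ht hxt

theorem carrier_subset_iff {t : Finset E} (ht : t ∈ K.faces) (hx : x ∈ K.space) :
    K.carrier x ⊆ t ↔ x ∈ convexHull ℝ (t : Set E) :=
  ⟨fun h => convexHull_mono (by exact_mod_cast h) (mem_convexHull_carrier hx), carrier_subset ht⟩

theorem carrier_vertex (hx : x ∈ K.vertices) : K.carrier x = {x} := by
  have h1 := carrier_subset (K := K) (x := x) (t := {x}) hx (by simp)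
  refine h1.antisymm (Finset.singleton_subset_iff.2 ?_)
  exact (vertex_mem_convexHull_iff hx (carrier_mem_faces (vertices_subset_space hx))).1
    (mem_convexHull_carrier (vertices_subset_space hx))

/-- One inclusion is convexity of the face spanned by the union; the other is extremality of the
carrier of the dividing point. -/
theorem carrier_lineMap [DecidableEq E] {s : Finset E} (hs : s ∈ K.faces) (hx : x ∈ convexHull ℝ (s : Set E))
    (hz : z ∈ convexHull ℝ (s : Set E)) {c : ℝ} (c0 : 0 < c) (c1 : c < 1) :
    K.carrier (AffineMap.lineMap x z c) = K.carrier x ∪ K.carrier z := by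
  have hy : AffineMap.lineMap x z c ∈ convexHull ℝ (s : Set E) :=
    (convex_convexHull ℝ _).lineMap_mem hx hz ⟨c0.le, c1.le⟩
  have hyK := convexHull_subset_space hs hy
  have hxK := convexHull_subset_space hs hx
  have hzK := convexHull_subset_space hs hz
  refine Finset.Subset.antisymm ?_ ?_
  · have hf : K.carrier x ∪ K.carrier z ∈ K.faces :=
      K.down_closed hs (Finset.union_subset (carrier_subset hs hx) (carrier_subset hs hz))
        ((nonempty_of_mem_faces (carrier_mem_faces hxK)).mono Finset.subset_union_left)
    refine carrier_subset hf ((convex_convexHull ℝ _).lineMap_mem ?_ ?_ ⟨c0.le, c1.le⟩)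
    · exact (carrier_subset_iff hf hxK).1 Finset.subset_union_left
    · exact (carrier_subset_iff hf hzK).1 Finset.subset_union_right
  · have := mem_face_of_lineMap_mem (K.indep hs) (carrier_subset hs hy) hx hz c0 c1
      (mem_convexHull_carrier hyK)
    exact Finset.union_subset (carrier_subset (carrier_mem_faces hyK) this.1)
      (carrier_subset (carrier_mem_faces hyK) this.2)

/-- The finitely many closed simplices that miss `x` are also missed by all points near `x`. In
other words, open stars are neighbourhoods. -/
theorem eventually_carrier_subset (hK : K.faces.Finite) (x : E) :
    ∀ᶠ y in 𝓝 x, y ∈ K.space → K.carrier x ⊆ K.carrier y := by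
  have h : ∀ᶠ y in 𝓝 x, ∀ t ∈ {t ∈ K.faces | x ∉ convexHull ℝ (t : Set E)},
      y ∉ convexHull ℝ (t : Set E) := by
    rw [Filter.eventually_all_finite (hK.subset fun t ht => ht.1)]
    intro t ht
    exact ((t.finite_toSet.isClosed_convexHull (𝕜 := ℝ)).isOpen_compl.mem_nhds ht.2)
  filter_upwards [h] with y hy hyK
  have hf := carrier_mem_faces hyK
  by_contra hc
  exact hy _ ⟨hf, fun hxt => hc (carrier_subset hf hxt)⟩ (mem_convexHull_carrier hyK)

end Geometry.SimplicialComplex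

/-! ### Pages of collars -/

namespace ManifoldWithDefect

variable {n : ℕ} {X : Type*} [TopologicalSpace X] (M : ManifoldWithDefect n X)

/-- The `i`-th page over the defect stratum `S`. -/
def Page (S : ConnectedComponents ↥M.defect) (i : Fin (M.valence S)) : Set X :=
  {x | M.InLocalStratum S (some i) x}

variable {M} {S S' : ConnectedComponents ↥M.defect}

theorem inLocalStratum_none_iff {x : X} :
    M.InLocalStratum S none x ↔ ∃ h : x ∈ M.defect, ConnectedComponents.mk ⟨x, h⟩ = S := by
  constructor
  · rintro ⟨y, rfl⟩
    rw [M.collar_apex]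
    exact ⟨y.1.2, y.2⟩
  · rintro ⟨h, hS⟩
    exact ⟨⟨⟨x, h⟩, hS⟩, M.collar_apex _ _⟩

theorem InLocalStratum.mem_defect {x : X} (h : M.InLocalStratum S none x) : x ∈ M.defect :=
  (inLocalStratum_none_iff.1 h).1

theorem InLocalStratum.unique {x : X} (h : M.InLocalStratum S none x)
    (h' : M.InLocalStratum S' none x) : S = S' := by
  obtain ⟨_, rfl⟩ := inLocalStratum_none_iff.1 h
  obtain ⟨_, rfl⟩ := inLocalStratum_none_iff.1 h'
  rfl

theorem exists_inLocalStratum {x : X} (h : x ∈ M.defect) : ∃ S, M.InLocalStratum S none x :=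
  ⟨_, inLocalStratum_none_iff.2 ⟨h, rfl⟩⟩

theorem isOpen_page (i : Fin (M.valence S)) : IsOpen (M.Page S i) := by
  have : M.Page S i = M.collar S '' {z | 0 < z.2.1 i} := by
    ext x
    constructor
    · rintro ⟨z, h1, h2⟩
      exact ⟨z, h2, h1⟩
    · rintro ⟨z, h2, h1⟩
      exact ⟨z, h1, h2⟩
  rw [this]
  refine (M.collar_open S).isOpenMap _ (isOpen_lt continuous_const ?_)
  exact (continuous_apply i).comp (continuous_subtype_val.comp continuous_snd)

theorem page_unique {i j : Fin (M.valence S)} {x : X} (hi : x ∈ M.Page S i)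
    (hj : x ∈ M.Page S j) : i = j := by
  obtain ⟨z, rfl, h⟩ := hi
  obtain ⟨z', e, h'⟩ := hj
  obtain rfl := (M.collar_open S).injective e
  exact z'.2.2.2 i j h.ne' h'.ne'

theorem notMem_defect_of_page {i : Fin (M.valence S)} {x : X} (hi : x ∈ M.Page S i) :
    x ∉ M.defect := by
  obtain ⟨z, rfl, h⟩ := hi
  intro hd
  rw [M.collar_mem S z hd] at h
  exact lt_irrefl _ h

theorem inLocalStratum_none_of_mem_range {x : X} (hx : x ∈ range (M.collar S))
    (hd : x ∈ M.defect) : M.InLocalStratum S none x := by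
  obtain ⟨z, rfl⟩ := hx
  exact ⟨z.1, by rw [← M.collar_mem S z hd]⟩

/-- A cone point without positive coordinate is the apex, and apices are mapped to the defect. -/
theorem exists_page_of_mem_range {x : X} (hx : x ∈ range (M.collar S)) (hd : x ∉ M.defect) :
    ∃ i, x ∈ M.Page S i := by
  obtain ⟨z, rfl⟩ := hx
  by_contra! h
  refine hd ?_
  have : z.2 = OpenCone.apex _ := by
    refine Subtype.ext (funext fun i => ?_)
    exact le_antisymm (not_lt.1 fun hi => h i ⟨z, rfl, hi⟩) (z.2.2.1 i).1
  have e := M.collar_apex S z.1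
  rw [← this] at e
  change M.collar S z = _ at e
  rw [e]
  exact z.1.1.2

theorem range_collar_mem_nhds {x : X} (hx : M.InLocalStratum S none x) :
    range (M.collar S) ∈ 𝓝 x := by
  obtain ⟨y, rfl⟩ := hx
  exact (M.collar_open S).isOpen_range.mem_nhds ⟨_, rfl⟩

/-- A connected set in a collar that avoids the defect lies in one page. -/
theorem subset_page_of_isPreconnected {A : Set X} (hA : IsPreconnected A)
    (h : A ⊆ range (M.collar S)) (hd : ∀ x ∈ A, x ∉ M.defect) {i : Fin (M.valence S)} {x : X}
    (hx : x ∈ A) (hi : x ∈ M.Page S i) : A ⊆ M.Page S i := by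
  refine hA.subset_left_of_subset_union (isOpen_page i)
    (v := ⋃ j ∈ {j | j ≠ i}, M.Page S j) (isOpen_biUnion fun j _ => isOpen_page j) ?_ ?_ ⟨x, hx, hi⟩
  · rw [Set.disjoint_left]
    intro y hy hy'
    obtain ⟨j, hj, hy'⟩ := mem_iUnion₂.1 hy'
    exact hj (page_unique hy' hy)
  · intro y hy
    obtain ⟨j, hj⟩ := exists_page_of_mem_range (h hy) (hd y hy)
    by_cases e : j = i
    · exact Or.inl (e ▸ hj)
    · exact Or.inr (mem_iUnion₂.2 ⟨j, e, hj⟩)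

end ManifoldWithDefect

/-! ### Points, carriers and segments in a triangulated space -/

namespace ManifoldWithDefect.DirectedTriangulation

variable {n : ℕ} {X : Type*} [TopologicalSpace X] {M : ManifoldWithDefect n X}
  (T : M.DirectedTriangulation)

open Geometry.SimplicialComplex

/-- The point of the geometric complex that corresponds to a point of `X`. -/
def coord (x : X) : EuclideanSpace ℝ (Fin T.dim) := (T.homeo.symm x).1

theorem coord_mem (x : X) : T.coord x ∈ T.K.space := (T.homeo.symm x).2

theorem isEmbedding_coord : IsEmbedding T.coord :=
  IsEmbedding.subtypeVal.comp T.homeo.symm.isEmbedding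

theorem coord_homeo (y : ↥T.K.space) : T.coord (T.homeo y) = y.1 := by
  simp [coord]

/-- The vertices of the smallest simplex that contains a point. -/
noncomputable def car (x : X) : Finset (EuclideanSpace ℝ (Fin T.dim)) := T.K.carrier (T.coord x)

theorem car_mem (x : X) : T.car x ∈ T.K.faces := carrier_mem_faces (T.coord_mem x)

theorem coord_mem_car (x : X) : T.coord x ∈ convexHull ℝ (T.car x : Set _) :=
  mem_convexHull_carrier (T.coord_mem x)

variable {T} in
theorem car_subset_iff {s : Finset (EuclideanSpace ℝ (Fin T.dim))} (hs : s ∈ T.K.faces) {x : X} :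
    T.car x ⊆ s ↔ T.coord x ∈ convexHull ℝ (s : Set _) :=
  carrier_subset_iff hs (T.coord_mem x)

theorem eventually_car_subset (x : X) : ∀ᶠ y in 𝓝 x, T.car x ⊆ T.car y := by
  have := T.isEmbedding_coord.continuous.continuousAt.eventually
    (eventually_carrier_subset (K := T.K) T.finite_faces (T.coord x))
  filter_upwards [this] with y hy using hy (T.coord_mem y)

theorem coord_pos (v : ↥T.K.vertices) : T.coord (T.pos v) = v.1 := T.coord_homeo _

theorem car_pos (v : ↥T.K.vertices) : T.car (T.pos v) = {v.1} := by
  rw [car, coord_pos, carrier_vertex v.2]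

variable {T} in
theorem mem_vertices_of_mem_face {s : Finset (EuclideanSpace ℝ (Fin T.dim))} (hs : s ∈ T.K.faces)
    {v : EuclideanSpace ℝ (Fin T.dim)} (hv : v ∈ s) : v ∈ T.K.vertices :=
  T.K.down_closed hs (Finset.singleton_subset_iff.2 hv) (Finset.singleton_nonempty _)

/-- The vertices in the defect. -/
def defectVertices : Set (EuclideanSpace ℝ (Fin T.dim)) :=
  {v | ∃ h : v ∈ T.K.vertices, T.pos ⟨v, h⟩ ∈ M.defect}

/-- The carrier of `x` meets the defect in nothing or in one face `t`, and `x` lies in `t` exactly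
if the whole carrier does. So the defect is the full subcomplex on its vertices, and all later
questions about it become questions about carriers. -/
theorem mem_defect_iff (x : X) : x ∈ M.defect ↔ (T.car x : Set _) ⊆ T.defectVertices := by
  have hf := T.car_mem x
  have hx : T.homeo (T.homeo.symm x) = x := T.homeo.apply_symm_apply x
  have vert : ∀ v ∈ T.car x, ∀ hv : v ∈ T.K.vertices,
      v ∈ convexHull ℝ (T.car x : Set (EuclideanSpace ℝ (Fin T.dim))) := fun v hv _ =>
    subset_convexHull ℝ _ hv
  rcases T.flag_like _ hf with h | ⟨t, ht, hts, h⟩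
  · constructor
    · intro hd
      exact absurd (hx.symm ▸ hd) (h _ (T.coord_mem_car x))
    · intro hsub
      obtain ⟨v, hv⟩ := nonempty_of_mem_faces hf
      obtain ⟨hv', hd⟩ := hsub hv
      exact absurd hd (h _ (vert v hv hv'))
  · have h0 := h (T.homeo.symm x) (T.coord_mem_car x)
    rw [hx] at h0
    rw [h0]
    constructor
    · intro hxt v hv
      have hvt : v ∈ t := (car_subset_iff ht).2 hxt hv
      have hv' := mem_vertices_of_mem_face hf hv
      exact ⟨hv', (h _ (vert v hv hv')).2 (subset_convexHull ℝ _ hvt)⟩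
    · intro hsub
      refine (car_subset_iff ht).1 fun v hv => ?_
      obtain ⟨hv', hd⟩ := hsub hv
      exact (vertex_mem_convexHull_iff hv' ht).1 ((h _ (vert v hv hv')).1 hd)

theorem pos_mem_defect_iff (v : ↥T.K.vertices) : T.pos v ∈ M.defect ↔ v.1 ∈ T.defectVertices :=
  ⟨fun h => ⟨v.2, h⟩, fun ⟨_, h⟩ => h⟩

open Classical in
/-- The point dividing the segment from `x` to `y` in the ratio `t : 1 - t`, if `x` and `y` lie in
a common simplex. -/
noncomputable def comb (x y : X) (t : ℝ) : X :=
  if h : AffineMap.lineMap (T.coord x) (T.coord y) t ∈ T.K.space then T.homeo ⟨_, h⟩ else x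

variable {T} {s : Finset (EuclideanSpace ℝ (Fin T.dim))} {x y z : X}

theorem coord_comb (hs : s ∈ T.K.faces) (hx : T.car x ⊆ s) (hy : T.car y ⊆ s) {t : ℝ}
    (ht : t ∈ Icc (0 : ℝ) 1) :
    T.coord (T.comb x y t) = AffineMap.lineMap (T.coord x) (T.coord y) t := by
  rw [car_subset_iff hs] at hx hy
  have : AffineMap.lineMap (T.coord x) (T.coord y) t ∈ T.K.space :=
    convexHull_subset_space hs ((convex_convexHull ℝ _).lineMap_mem hx hy ht)
  rw [comb, dif_pos this, coord_homeo]

theorem comb_subset (hs : s ∈ T.K.faces) (hx : T.car x ⊆ s) (hy : T.car y ⊆ s) {t : ℝ}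
    (ht : t ∈ Icc (0 : ℝ) 1) : T.car (T.comb x y t) ⊆ s := by
  rw [car_subset_iff hs, coord_comb hs hx hy ht]
  rw [car_subset_iff hs] at hx hy
  exact (convex_convexHull ℝ _).lineMap_mem hx hy ht

theorem comb_zero : T.comb x y 0 = x := by
  have h : AffineMap.lineMap (T.coord x) (T.coord y) (0 : ℝ) = T.coord x :=
    AffineMap.lineMap_apply_zero _ _
  apply T.isEmbedding_coord.injective
  rw [comb]
  split_ifs
  · exact (T.coord_homeo _).trans h
  · rfl

theorem comb_one : T.comb x y 1 = y := by
  have h : AffineMap.lineMap (T.coord x) (T.coord y) (1 : ℝ) = T.coord y :=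
    AffineMap.lineMap_apply_one _ _
  apply T.isEmbedding_coord.injective
  rw [comb, dif_pos (by rw [h]; exact T.coord_mem y)]
  exact (T.coord_homeo _).trans h

theorem comb_self {t : ℝ} : T.comb x x t = x := by
  have h : AffineMap.lineMap (T.coord x) (T.coord x) t = T.coord x := AffineMap.lineMap_same_apply _ _
  apply T.isEmbedding_coord.injective
  rw [comb, dif_pos (by rw [h]; exact T.coord_mem x)]
  exact (T.coord_homeo _).trans h

theorem car_comb (hs : s ∈ T.K.faces) (hx : T.car x ⊆ s) (hy : T.car y ⊆ s) {t : ℝ}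
    (t0 : 0 < t) (t1 : t < 1) : T.car (T.comb x y t) = T.car x ∪ T.car y := by
  rw [car, coord_comb hs hx hy ⟨t0.le, t1.le⟩]
  rw [car_subset_iff hs] at hx hy
  exact carrier_lineMap hs hx hy t0 t1

/-- Interior points of a segment have the union of the two end carriers as carrier. Consequently a
segment in a simplex with one end in the bulk has its whole interior in the bulk. -/
theorem comb_mem_defect (hs : s ∈ T.K.faces) (hx : T.car x ⊆ s) (hy : T.car y ⊆ s) {t : ℝ}
    (t0 : 0 < t) (t1 : t < 1) : T.comb x y t ∈ M.defect ↔ x ∈ M.defect ∧ y ∈ M.defect := by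
  classical
  rw [T.mem_defect_iff, car_comb hs hx hy t0 t1, T.mem_defect_iff, T.mem_defect_iff,
    Finset.coe_union, union_subset_iff]

theorem continuous_comb {Z : Type*} [TopologicalSpace Z] {f g : Z → X} {r : Z → ℝ}
    (hf : Continuous f) (hg : Continuous g) (hr : Continuous r) (h : ∀ z, r z ∈ Icc (0 : ℝ) 1)
    (hs : ∀ z, ∃ s ∈ T.K.faces, T.car (f z) ⊆ s ∧ T.car (g z) ⊆ s) :
    Continuous fun z => T.comb (f z) (g z) (r z) := by
  rw [T.isEmbedding_coord.continuous_iff]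
  have : T.coord ∘ (fun z => T.comb (f z) (g z) (r z)) =
      fun z => AffineMap.lineMap (T.coord (f z)) (T.coord (g z)) (r z) := by
    funext z
    obtain ⟨s, hs, h1, h2⟩ := hs z
    exact coord_comb hs h1 h2 (h z)
  rw [this]
  exact ((T.isEmbedding_coord.continuous.comp hf).lineMap
    (T.isEmbedding_coord.continuous.comp hg)) hr

end ManifoldWithDefect.DirectedTriangulation

/-! ### Inbound and outbound simplices -/

theorem unitInterval.eventually_uIcc {Q : I → Prop} {t : I} (h : ∀ᶠ u in 𝓝 t, Q u) :
    ∀ᶠ s in 𝓝 t, ∀ u ∈ uIcc s t, Q u := by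
  have h1 : Filter.Tendsto (fun s : I => uIcc s t) (𝓝 t) (𝓝 t).smallSets :=
    Filter.tendsto_id.uIcc tendsto_const_nhds
  exact h1.eventually (Filter.eventually_smallSets_forall.2 h)

namespace ManifoldWithDefect.DirectedTriangulation

variable {n : ℕ} {X : Type*} [TopologicalSpace X] {M : ManifoldWithDefect n X}
  (T : M.DirectedTriangulation)

open Geometry.SimplicialComplex

/-- Near `w`, the bulk points of the simplex `s` lie in the page `i` over `S`. -/
def PageAt (s : Finset (EuclideanSpace ℝ (Fin T.dim))) (S : ConnectedComponents ↥M.defect)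
    (i : Fin (M.valence S)) (w : X) : Prop :=
  ∀ᶠ y in 𝓝 w, y ∉ M.defect → T.car y ⊆ s → y ∈ M.Page S i

/-- The simplex `s` meets the bulk and lies in inbound pages near the defect. -/
def Inb (s : Finset (EuclideanSpace ℝ (Fin T.dim))) : Prop :=
  ¬ (s : Set _) ⊆ T.defectVertices ∧ ∃ w S i, M.InLocalStratum S none w ∧ T.car w ⊆ s ∧
    T.PageAt s S i w ∧ M.BoundaryOrientationAgrees S i

/-- The simplex `s` meets the bulk and lies in outbound pages near the defect. -/
def Outb (s : Finset (EuclideanSpace ℝ (Fin T.dim))) : Prop :=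
  ¬ (s : Set _) ⊆ T.defectVertices ∧ ∃ w S i, M.InLocalStratum S none w ∧ T.car w ⊆ s ∧
    T.PageAt s S i w ∧ ¬ M.BoundaryOrientationAgrees S i

variable {T} {s s' : Finset (EuclideanSpace ℝ (Fin T.dim))} {S S' : ConnectedComponents ↥M.defect}
  {w w' x y z : X}

theorem continuous_comb_unit (hs : s ∈ T.K.faces) (hx : T.car x ⊆ s) (hy : T.car y ⊆ s) :
    Continuous fun t : I => T.comb x y t :=
  continuous_comb continuous_const continuous_const continuous_subtype_val (fun t => t.2)
    fun _ => ⟨s, hs, hx, hy⟩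

/-- The segment from `w` towards a bulk vertex of `s` enters the bulk at once. -/
theorem frequently_bulk (hs : s ∈ T.K.faces) (hw : T.car w ⊆ s)
    (hb : ¬ (s : Set _) ⊆ T.defectVertices) : ∃ᶠ y in 𝓝 w, y ∉ M.defect ∧ T.car y ⊆ s := by
  obtain ⟨v, hv, hvd⟩ := not_subset.1 hb
  have hv' := mem_vertices_of_mem_face hs hv
  have hc : T.car (T.pos ⟨v, hv'⟩) ⊆ s := by
    rw [car_pos]
    exact Finset.singleton_subset_iff.2 hv
  have hcont := continuous_comb_unit hs hw hc
  have ht := hcont.tendsto 0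
  simp only [Icc.coe_zero, comb_zero] at ht
  have : (𝓝[>] (0 : I)).NeBot := nhdsGT_neBot_of_exists_gt ⟨1, zero_lt_one⟩
  refine (ht.mono_left (nhdsWithin_le_nhds (s := Ioi 0))).frequently (Filter.Eventually.frequently ?_)
  filter_upwards [Ioo_mem_nhdsGT (show (0 : I) < 1 from zero_lt_one)] with t ht
  refine ⟨?_, comb_subset hs hw hc t.2⟩
  rw [comb_mem_defect hs hw hc ht.1 ht.2]
  exact fun h => hvd ((T.pos_mem_defect_iff _).1 h.2)

/-- The bulk points of `s` in a small coordinate ball are pairwise joined by segments that stay in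
the bulk and in the ball. They form a connected subset of the collar that avoids the defect, which
fits into one page only. -/
theorem exists_pageAt (hs : s ∈ T.K.faces) (hw : T.car w ⊆ s)
    (hb : ¬ (s : Set _) ⊆ T.defectVertices) (hS : M.InLocalStratum S none w) :
    ∃ i, T.PageAt s S i w := by
  have hr := M.range_collar_mem_nhds hS
  rw [T.isEmbedding_coord.nhds_eq_comap, Metric.nhds_basis_ball.comap _ |>.mem_iff] at hr
  obtain ⟨ε, hε, hr⟩ := hr
  let A : Set X := {y | y ∉ M.defect ∧ T.car y ⊆ s ∧ T.coord y ∈ Metric.ball (T.coord w) ε}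
  have hball : ∀ᶠ y in 𝓝 w, T.coord y ∈ Metric.ball (T.coord w) ε :=
    T.isEmbedding_coord.continuous.continuousAt (Metric.ball_mem_nhds _ hε)
  have hA : IsPreconnected A := by
    refine isPreconnected_of_forall_pair fun y hy z hz => ?_
    refine ⟨range fun t : I => T.comb y z t, ?_, ⟨0, by simp [comb_zero]⟩, ⟨1, by simp [comb_one]⟩,
      isPreconnected_range (continuous_comb_unit hs hy.2.1 hz.2.1)⟩
    rintro _ ⟨t, rfl⟩
    rcases t.2.1.eq_or_lt with h0 | h0
    · simp only [← h0, comb_zero]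
      exact hy
    · rcases t.2.2.eq_or_lt with h1 | h1
      · simp only [h1, comb_one]
        exact hz
      · refine ⟨?_, comb_subset hs hy.2.1 hz.2.1 t.2, ?_⟩
        · rw [comb_mem_defect hs hy.2.1 hz.2.1 h0 h1]
          exact fun h => hy.1 h.1
        · rw [coord_comb hs hy.2.1 hz.2.1 t.2]
          exact (convex_ball _ _).lineMap_mem hy.2.2 hz.2.2 t.2
  obtain ⟨y, hy, hyb⟩ := ((frequently_bulk hs hw hb).and_eventually hball).exists
  obtain ⟨i, hi⟩ := M.exists_page_of_mem_range (hr hyb) hy.1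
  have hsub := subset_page_of_isPreconnected hA (fun z hz => hr hz.2.2) (fun z hz => hz.1)
    (show y ∈ A from ⟨hy.1, hy.2, hyb⟩) hi
  refine ⟨i, ?_⟩
  filter_upwards [hball] with z hz h1 h2 using hsub ⟨h1, h2, hz⟩

theorem PageAt.unique (hs : s ∈ T.K.faces) (hw : T.car w ⊆ s)
    (hb : ¬ (s : Set _) ⊆ T.defectVertices) {i j : Fin (M.valence S)} (hi : T.PageAt s S i w)
    (hj : T.PageAt s S j w) : i = j := by
  obtain ⟨y, ⟨h1, h2⟩, hy⟩ := ((frequently_bulk hs hw hb).and_eventually (hi.and hj)).exists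
  exact page_unique (hy.1 h1 h2) (hy.2 h1 h2)

theorem PageAt.mono (h : s ⊆ s') {i : Fin (M.valence S)} (hi : T.PageAt s' S i w) :
    T.PageAt s S i w := by
  filter_upwards [hi] with y hy h1 h2 using hy h1 (h2.trans h)

/-- The segment from `w` to `w'` runs in the defect. Along it the defect stratum and the page
occupied by `s` are locally constant, so the orientation type does not change. This makes inbound
and outbound properties of the simplex instead of a chosen point. -/
theorem PageAt.agrees_iff (hs : s ∈ T.K.faces) (hb : ¬ (s : Set _) ⊆ T.defectVertices)
    (hw : T.car w ⊆ s) (hw' : T.car w' ⊆ s) (hS : M.InLocalStratum S none w)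
    (hS' : M.InLocalStratum S' none w') {i : Fin (M.valence S)} {i' : Fin (M.valence S')}
    (hi : T.PageAt s S i w) (hi' : T.PageAt s S' i' w') :
    M.BoundaryOrientationAgrees S i ↔ M.BoundaryOrientationAgrees S' i' := by
  -- Stratum and page are quantified inside the relation, since the type of the page index depends
  -- on the stratum; transitivity then needs only that the middle point has some page.
  let Q : X → X → Prop := fun a b => ∀ R i, M.InLocalStratum R none a → T.PageAt s R i a →
    ∀ R' i', M.InLocalStratum R' none b → T.PageAt s R' i' b →
    (M.BoundaryOrientationAgrees R i ↔ M.BoundaryOrientationAgrees R' i')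
  have hcar : ∀ t : I, T.car (T.comb w w' t) ⊆ s := fun t => comb_subset hs hw hw' t.2
  have hdef : ∀ t : I, T.comb w w' t ∈ M.defect := fun t => by
    rcases t.2.1.eq_or_lt with h0 | h0
    · simp only [← h0, comb_zero]
      exact hS.mem_defect
    · rcases t.2.2.eq_or_lt with h1 | h1
      · simp only [h1, comb_one]
        exact hS'.mem_defect
      · rw [comb_mem_defect hs hw hw' h0 h1]
        exact ⟨hS.mem_defect, hS'.mem_defect⟩
  have key : Q (T.comb w w' (0 : I)) (T.comb w w' (1 : I)) := by
    refine unitInterval.rel_of_local (P := fun a b : I => Q (T.comb w w' a) (T.comb w w' b))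
      ?_ ?_ zero_le_one
    · intro a b c _ _ h1 h2 R i hR hi R' i' hR' hi'
      obtain ⟨R₀, hR₀⟩ := exists_inLocalStratum (hdef b)
      obtain ⟨j, hj⟩ := exists_pageAt hs (hcar b) hb hR₀
      exact (h1 R i hR hi R₀ j hR₀ hj).trans (h2 R₀ j hR₀ hj R' i' hR' hi')
    · intro t
      obtain ⟨R₀, hR₀⟩ := exists_inLocalStratum (hdef t)
      obtain ⟨j, hj⟩ := exists_pageAt hs (hcar t) hb hR₀
      have hcont := (continuous_comb_unit hs hw hw').continuousAt (x := t)
      have e0 : ∀ R i, M.InLocalStratum R none (T.comb w w' t) → T.PageAt s R i (T.comb w w' t) →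
          (M.BoundaryOrientationAgrees R i ↔ M.BoundaryOrientationAgrees R₀ j) := by
        intro R i hR hi
        obtain rfl := hR.unique hR₀
        rw [hi.unique hs (hcar t) hb hj]
      filter_upwards [hcont.eventually (eventually_eventually_nhds.2 hj),
        hcont.eventually (M.range_collar_mem_nhds hR₀)] with r h1 h2
      have e1 : ∀ R i, M.InLocalStratum R none (T.comb w w' r) → T.PageAt s R i (T.comb w w' r) →
          (M.BoundaryOrientationAgrees R i ↔ M.BoundaryOrientationAgrees R₀ j) := by
        intro R i hR hi
        obtain rfl := hR.unique (M.inLocalStratum_none_of_mem_range h2 (hdef r))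
        rw [hi.unique hs (hcar r) hb h1]
      exact ⟨fun _ R i hR hi R' i' hR' hi' => (e1 R i hR hi).trans (e0 R' i' hR' hi').symm,
        fun _ R i hR hi R' i' hR' hi' => (e0 R i hR hi).trans (e1 R' i' hR' hi').symm⟩
  simp only [Icc.coe_zero, Icc.coe_one, comb_zero, comb_one] at key
  exact key S i hS hi S' i' hS' hi'

theorem inb_iff (hs : s ∈ T.K.faces) (hb : ¬ (s : Set _) ⊆ T.defectVertices)
    (hw : T.car w ⊆ s) (hS : M.InLocalStratum S none w) {i : Fin (M.valence S)}
    (hi : T.PageAt s S i w) : T.Inb s ↔ M.BoundaryOrientationAgrees S i :=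
  ⟨fun ⟨_, _, _, _, hS', hw', hi', h⟩ => (PageAt.agrees_iff hs hb hw hw' hS hS' hi hi').2 h,
    fun h => ⟨hb, w, S, i, hS, hw, hi, h⟩⟩

theorem outb_iff (hs : s ∈ T.K.faces) (hb : ¬ (s : Set _) ⊆ T.defectVertices)
    (hw : T.car w ⊆ s) (hS : M.InLocalStratum S none w) {i : Fin (M.valence S)}
    (hi : T.PageAt s S i w) : T.Outb s ↔ ¬ M.BoundaryOrientationAgrees S i :=
  ⟨fun ⟨_, _, _, _, hS', hw', hi', h⟩ =>
    fun h' => h ((PageAt.agrees_iff hs hb hw hw' hS hS' hi hi').1 h'),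
    fun h => ⟨hb, w, S, i, hS, hw, hi, h⟩⟩

theorem Inb.not_outb (hs : s ∈ T.K.faces) (h : T.Inb s) : ¬ T.Outb s := by
  obtain ⟨hb, w, S, i, hS, hw, hi, h⟩ := h
  rw [outb_iff hs hb hw hS hi]
  exact not_not.2 h

/-- Being inbound can be tested on a face that meets both bulk and defect. -/
theorem inb_face_iff (hs : s ∈ T.K.faces) (hs' : s' ∈ T.K.faces) (hss : s' ⊆ s)
    (hb : ¬ (s' : Set _) ⊆ T.defectVertices) (hw : T.car w ⊆ s') (hd : w ∈ M.defect) :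
    T.Inb s' ↔ T.Inb s := by
  obtain ⟨S, hS⟩ := exists_inLocalStratum hd
  have hb' : ¬ (s : Set _) ⊆ T.defectVertices := fun h =>
    hb (subset_trans (by exact_mod_cast hss) h)
  obtain ⟨i, hi⟩ := exists_pageAt hs (hw.trans hss) hb' hS
  rw [inb_iff hs hb' (hw.trans hss) hS hi, inb_iff hs' hb hw hS (hi.mono hss)]

theorem outb_face_iff (hs : s ∈ T.K.faces) (hs' : s' ∈ T.K.faces) (hss : s' ⊆ s)
    (hb : ¬ (s' : Set _) ⊆ T.defectVertices) (hw : T.car w ⊆ s') (hd : w ∈ M.defect) :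
    T.Outb s' ↔ T.Outb s := by
  obtain ⟨S, hS⟩ := exists_inLocalStratum hd
  have hb' : ¬ (s : Set _) ⊆ T.defectVertices := fun h =>
    hb (subset_trans (by exact_mod_cast hss) h)
  obtain ⟨i, hi⟩ := exists_pageAt hs (hw.trans hss) hb' hS
  rw [outb_iff hs hb' (hw.trans hss) hS hi, outb_iff hs' hb hw hS (hi.mono hss)]

/-- A face of an inbound simplex may miss the bulk or the defect and then is neither inbound nor
outbound. Not being outbound is the form of the property that passes to every face. -/
theorem Inb.not_outb_face (hs : s ∈ T.K.faces) (h : T.Inb s) (hs' : s' ∈ T.K.faces) (hss : s' ⊆ s) :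
    ¬ T.Outb s' := fun h' => by
  obtain ⟨hb, w, S, i, hS, hw, -⟩ := id h'
  exact h.not_outb hs ((outb_face_iff hs hs' hss hb hw hS.mem_defect).1 h')

theorem Outb.not_inb_face (hs : s ∈ T.K.faces) (h : T.Outb s) (hs' : s' ∈ T.K.faces)
    (hss : s' ⊆ s) : ¬ T.Inb s' := fun h' => by
  obtain ⟨hb, w, S, i, hS, hw, -⟩ := id h'
  exact ((inb_face_iff hs hs' hss hb hw hS.mem_defect).1 h').not_outb hs h

/-! ### Points close to a given point, and directed paths among them -/

variable (T) in
/-- `x` lies in the open star of `w`, on the side from which directed paths arrive. -/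
def In (x w : X) : Prop := T.car w ⊆ T.car x ∧ (w ∈ M.defect → x ∉ M.defect → T.Inb (T.car x))

variable (T) in
/-- `x` lies in the open star of `w`, on the side to which directed paths depart. -/
def Out (x w : X) : Prop := T.car w ⊆ T.car x ∧ (w ∈ M.defect → x ∉ M.defect → T.Outb (T.car x))

theorem In.refl (x : X) : T.In x x := ⟨subset_rfl, fun h h' => absurd h h'⟩

theorem Out.refl (x : X) : T.Out x x := ⟨subset_rfl, fun h h' => absurd h h'⟩

theorem mem_defect_of_car_subset (h : T.car w ⊆ T.car x) (hx : x ∈ M.defect) : w ∈ M.defect := by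
  rw [T.mem_defect_iff] at hx ⊢
  exact subset_trans (by exact_mod_cast h) hx

variable (T) in
/-- Sets of points so close to `w` that they lie in the open star and the collar of `w`, and in the
pages of their carriers. -/
def IsSmall (w : X) (N : Set X) : Prop :=
  (∀ y ∈ N, T.car w ⊆ T.car y) ∧ ∀ S, M.InLocalStratum S none w → N ⊆ range (M.collar S) ∧
    ∀ y ∈ N, y ∉ M.defect → ∀ i, y ∈ M.Page S i →
      (T.Inb (T.car y) ↔ M.BoundaryOrientationAgrees S i) ∧
      (T.Outb (T.car y) ↔ ¬ M.BoundaryOrientationAgrees S i)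

-- Only finitely many simplices that contain `w` reach into the bulk. Near `w` each of them occupies
-- a single page, so one neighbourhood serves all of them.
variable (T) in
theorem exists_isSmall (w : X) : ∃ N ∈ 𝓝 w, T.IsSmall w N := by
  by_cases hd : w ∈ M.defect
  · obtain ⟨S, hS⟩ := exists_inLocalStratum hd
    have h : ∀ᶠ y in 𝓝 w, ∀ s ∈ {s ∈ T.K.faces | T.car w ⊆ s ∧ ¬ (s : Set _) ⊆ T.defectVertices},
        y ∉ M.defect → T.car y ⊆ s → ∃ i, T.PageAt s S i w ∧ y ∈ M.Page S i := by
      rw [Filter.eventually_all_finite (T.finite_faces.subset fun t ht => ht.1)]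
      rintro s ⟨hs, h1, h2⟩
      obtain ⟨i, hi⟩ := exists_pageAt hs h1 h2 hS
      filter_upwards [hi] with y hy h3 h4 using ⟨i, hi, hy h3 h4⟩
    refine ⟨_, (T.eventually_car_subset w).and (h.and (M.range_collar_mem_nhds hS)),
      fun y hy => hy.1, fun S' hS' => ?_⟩
    obtain rfl := hS'.unique hS
    refine ⟨fun y hy => hy.2.2, fun y hy hyd i hi => ?_⟩
    have hb : ¬ (T.car y : Set _) ⊆ T.defectVertices := by rwa [← T.mem_defect_iff]
    obtain ⟨j, hj, hj'⟩ := hy.2.1 _ ⟨T.car_mem y, hy.1, hb⟩ hyd subset_rfl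
    obtain rfl := page_unique hi hj'
    exact ⟨inb_iff (T.car_mem y) hb hy.1 hS hj, outb_iff (T.car_mem y) hb hy.1 hS hj⟩
  · exact ⟨_, T.eventually_car_subset w, fun y hy => hy, fun S hS => absurd hS.mem_defect hd⟩

theorem IsSmall.in_of_notMem {N : Set X} (hN : T.IsSmall w N) (hw : w ∉ M.defect) (hx : x ∈ N) :
    T.In x w := ⟨hN.1 x hx, fun h => absurd h hw⟩

theorem IsSmall.out_of_notMem {N : Set X} (hN : T.IsSmall w N) (hw : w ∉ M.defect) (hx : x ∈ N) :
    T.Out x w := ⟨hN.1 x hx, fun h => absurd h hw⟩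

theorem IsSmall.in_of_mem {N : Set X} (hN : T.IsSmall w N) (hx : x ∈ N) (h : x ∈ M.defect) :
    T.In x w := ⟨hN.1 x hx, fun _ h' => absurd h h'⟩

theorem IsSmall.out_of_mem {N : Set X} (hN : T.IsSmall w N) (hx : x ∈ N) (h : x ∈ M.defect) :
    T.Out x w := ⟨hN.1 x hx, fun _ h' => absurd h h'⟩

theorem IsSmall.in_iff {N : Set X} (hN : T.IsSmall w N) (hS : M.InLocalStratum S none w)
    (hx : x ∈ N) {i : Fin (M.valence S)} (hi : x ∈ M.Page S i) :
    T.In x w ↔ M.BoundaryOrientationAgrees S i := by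
  have h := ((hN.2 S hS).2 x hx (notMem_defect_of_page hi) i hi).1
  exact ⟨fun h' => h.1 (h'.2 hS.mem_defect (notMem_defect_of_page hi)),
    fun h' => ⟨hN.1 x hx, fun _ _ => h.2 h'⟩⟩

theorem IsSmall.out_iff {N : Set X} (hN : T.IsSmall w N) (hS : M.InLocalStratum S none w)
    (hx : x ∈ N) {i : Fin (M.valence S)} (hi : x ∈ M.Page S i) :
    T.Out x w ↔ ¬ M.BoundaryOrientationAgrees S i := by
  have h := ((hN.2 S hS).2 x hx (notMem_defect_of_page hi) i hi).2
  exact ⟨fun h' => h.1 (h'.2 hS.mem_defect (notMem_defect_of_page hi)),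
    fun h' => ⟨hN.1 x hx, fun _ _ => h.2 h'⟩⟩

theorem not_reflTransGen_antiBoundaryCovers {i : Fin (M.valence S)} :
    ¬ Relation.ReflTransGen (M.AntiBoundaryCovers S) (some i) none := fun h => by
  rcases Relation.ReflTransGen.cases_head h with h | ⟨c, h, _⟩ <;> cases h

theorem not_reflTransGen_boundaryCovers {i : Fin (M.valence S)} :
    ¬ Relation.ReflTransGen (M.BoundaryCovers S) none (some i) := fun h => by
  rcases Relation.ReflTransGen.cases_head h with h | ⟨c, h, _⟩ <;> cases h

theorem agrees_of_lePlus (h : M.LePlus S x y) (hx : x ∉ M.defect) (hy : y ∈ M.defect) :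
    ∃ i, x ∈ M.Page S i ∧ M.BoundaryOrientationAgrees S i := by
  obtain ⟨a, b, ha, hb, hab⟩ := h
  rcases a with _ | i
  · exact absurd ha.mem_defect hx
  rcases b with _ | j
  · rcases Relation.ReflTransGen.cases_head hab with h | ⟨c, h, _⟩
    · cases h
    · cases h
      exact ⟨i, ha, by assumption⟩
  · exact absurd hy (notMem_defect_of_page hb)

theorem not_agrees_of_leMinus (h : M.LeMinus S x y) (hx : x ∈ M.defect) (hy : y ∉ M.defect) :
    ∃ i, y ∈ M.Page S i ∧ ¬ M.BoundaryOrientationAgrees S i := by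
  obtain ⟨a, b, ha, hb, hab⟩ := h
  rcases b with _ | i
  · exact absurd hb.mem_defect hy
  rcases a with _ | j
  · rcases Relation.ReflTransGen.cases_tail hab with h | ⟨c, _, h⟩
    · cases h
    · cases h
      exact ⟨i, hb, by assumption⟩
  · exact absurd hx (notMem_defect_of_page ha)

theorem not_lePlus (h : M.LePlus S x y) (hx : x ∈ M.defect) (hy : y ∉ M.defect) : False := by
  obtain ⟨a, b, ha, hb, hab⟩ := h
  rcases b with _ | i
  · exact absurd hb.mem_defect hy
  rcases a with _ | j
  · exact not_reflTransGen_boundaryCovers hab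
  · exact absurd hx (notMem_defect_of_page ha)

theorem not_leMinus (h : M.LeMinus S x y) (hx : x ∉ M.defect) (hy : y ∈ M.defect) : False := by
  obtain ⟨a, b, ha, hb, hab⟩ := h
  rcases a with _ | i
  · exact absurd ha.mem_defect hx
  rcases b with _ | j
  · exact not_reflTransGen_antiBoundaryCovers hab
  · exact absurd hy (notMem_defect_of_page hb)

/-! ### Directed paths close to a point -/

section Paths

variable {p : I → X} {N : Set X} {a b : I}

theorem isPreconnected_image_Icc (hp : Continuous p) (a b : I) : IsPreconnected (p '' Icc a b) :=
  isPreconnected_Icc.image p hp.continuousOn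

theorem IsSmall.page_eq (hp : Continuous p) (hN : T.IsSmall w N)
    (hS : M.InLocalStratum S none w) (hpN : ∀ u ∈ Icc a b, p u ∈ N) (hab : a ≤ b)
    (hd : ∀ u ∈ Icc a b, p u ∉ M.defect) :
    ∃ i, p a ∈ M.Page S i ∧ p b ∈ M.Page S i := by
  obtain ⟨i, hi⟩ := M.exists_page_of_mem_range ((hN.2 S hS).1 (hpN a ⟨le_rfl, hab⟩))
    (hd a ⟨le_rfl, hab⟩)
  refine ⟨i, hi, ?_⟩
  refine subset_page_of_isPreconnected (isPreconnected_image_Icc hp a b) ?_ ?_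
    ⟨a, ⟨le_rfl, hab⟩, rfl⟩ hi ⟨b, ⟨hab, le_rfl⟩, rfl⟩
  · rintro _ ⟨u, hu, rfl⟩
    exact (hN.2 S hS).1 (hpN u hu)
  · rintro _ ⟨u, hu, rfl⟩
    exact hd u hu

/-- Over a bulk point `w` the conditions are void. Otherwise a piece that avoids the defect stays in
one page, and nothing changes. A piece that touches the defect can only come from an inbound page
under `≼₊`, and can only go on to an outbound page under `≼₋`. -/
theorem IsSmall.in_out_of_piece (hp : Continuous p) (hN : T.IsSmall w N)
    (hpN : ∀ u ∈ Icc a b, p u ∈ N) (hab : a ≤ b) (h : M.MonotoneOnPiece p a b) :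
    (T.In (p b) w → T.In (p a) w) ∧ (T.Out (p a) w → T.Out (p b) w) := by
  have ha := hpN a ⟨le_rfl, hab⟩
  have hb := hpN b ⟨hab, le_rfl⟩
  by_cases hw : w ∈ M.defect
  swap
  · exact ⟨fun _ => hN.in_of_notMem hw ha, fun _ => hN.out_of_notMem hw hb⟩
  obtain ⟨S, hS⟩ := exists_inLocalStratum hw
  by_cases hd : ∀ u ∈ Icc a b, p u ∉ M.defect
  · obtain ⟨i, h1, h2⟩ := hN.page_eq hp hS hpN hab hd
    rw [hN.in_iff hS ha h1, hN.in_iff hS hb h2, hN.out_iff hS ha h1, hN.out_iff hS hb h2]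
    exact ⟨id, id⟩
  · push Not at hd
    obtain ⟨u, hu, hud⟩ := hd
    rcases h with h | ⟨S', h1, h2⟩
    · exact absurd hud (h u hu)
    -- The collar named by the monotone piece is that of `w`, because both contain the defect point
    -- `p u` and a collar meets the defect in its own stratum only.
    obtain rfl : S' = S := (M.inLocalStratum_none_of_mem_range (h1 u hu) hud).unique
      (M.inLocalStratum_none_of_mem_range ((hN.2 S hS).1 (hpN u hu)) hud)
    constructor
    · intro _
      by_cases had : p a ∈ M.defect
      · exact hN.in_of_mem ha had
      · rcases h2 with h2 | h2
        · obtain ⟨i, hi, h⟩ := agrees_of_lePlus (h2 a ⟨le_rfl, hab⟩ u hu hu.1) had hud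
          exact (hN.in_iff hS ha hi).2 h
        · exact (not_leMinus (h2 a ⟨le_rfl, hab⟩ u hu hu.1) had hud).elim
    · intro _
      by_cases hbd : p b ∈ M.defect
      · exact hN.out_of_mem hb hbd
      · rcases h2 with h2 | h2
        · exact (not_lePlus (h2 u hu b ⟨hab, le_rfl⟩ hu.2) hud hbd).elim
        · obtain ⟨i, hi, h⟩ := not_agrees_of_leMinus (h2 u hu b ⟨hab, le_rfl⟩ hu.2) hud hbd
          exact (hN.out_iff hS hb hi).2 h

/-- Along a directed path close to `w`, arriving points precede departing points. -/
theorem IsSmall.in_out (hp : Continuous p) (hd : M.IsDirected p) (hN : T.IsSmall w N)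
    (hpN : ∀ u ∈ Icc a b, p u ∈ N) (hab : a ≤ b) :
    (T.In (p b) w → T.In (p a) w) ∧ (T.Out (p a) w → T.Out (p b) w) := by
  -- Clamping the time to `[a, b]` turns the restriction into a reparametrization, so that it is
  -- directed and has its own subdivision.
  let f : C(I, I) := ⟨fun u => max a (min b u), by fun_prop⟩
  have hf : Monotone f := fun u v huv => max_le_max le_rfl (min_le_min le_rfl huv)
  have hfm : ∀ u, f u ∈ Icc a b := fun u => ⟨le_max_left _ _, max_le hab (min_le_left _ _)⟩
  have f0 : f 0 = a := max_eq_left ((min_le_right _ _).trans (unitInterval.nonneg _))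
  have f1 : f 1 = b := by
    change max a (min b 1) = b
    rw [min_eq_left (show b ≤ 1 from unitInterval.le_one b), max_eq_right hab]
  obtain ⟨m, c, hc, c0, cm, h⟩ := M.isDirected_reparam hd f hf
  have key : ∀ k ≤ m, (T.In (p (f (c k))) w → T.In (p (f (c 0))) w) ∧
      (T.Out (p (f (c 0))) w → T.Out (p (f (c k))) w) := by
    intro k
    induction k with
    | zero => exact fun _ => ⟨id, id⟩
    | succ k ih =>
      intro hk
      have h1 := ih (by omega)
      have h2 := hN.in_out_of_piece (p := fun t => p (f t)) (hp.comp f.continuous)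
        (fun u _ => hpN _ (hfm u)) (hc (Nat.le_succ k)) (h k hk)
      exact ⟨fun h => h1.1 (h2.1 h), fun h => h2.2 (h1.2 h)⟩
  have := key m le_rfl
  rwa [c0, cm, f0, f1] at this

/-- For `w` in the defect, any defect point on the path is both arriving and departing. If there is
none, the path keeps to one page, which would have to be inbound and outbound at once. -/
theorem IsSmall.exists_in_out (hp : Continuous p) (hN : T.IsSmall w N)
    (hpN : ∀ u ∈ Icc a b, p u ∈ N) (hab : a ≤ b) (ha : T.In (p a) w) (hb : T.Out (p b) w) :
    ∃ r ∈ Icc a b, T.In (p r) w ∧ T.Out (p r) w := by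
  have haI : a ∈ Icc a b := ⟨le_rfl, hab⟩
  have hbI : b ∈ Icc a b := ⟨hab, le_rfl⟩
  by_cases hw : w ∈ M.defect
  swap
  · exact ⟨a, haI, ha, hN.out_of_notMem hw (hpN a haI)⟩
  by_contra! h
  obtain ⟨S, hS⟩ := exists_inLocalStratum hw
  obtain ⟨i, h1, h2⟩ := hN.page_eq hp hS hpN hab fun u hu hud =>
    h u hu (hN.in_of_mem (hpN u hu) hud) (hN.out_of_mem (hpN u hu) hud)
  exact (hN.out_iff hS (hpN b hbI) h2).1 hb ((hN.in_iff hS (hpN a haI) h1).1 ha)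

/-! ### Criteria for paths to be directed -/

/-- Finite subdivisions can be concatenated, so existence of a subdivision between two times is a
transitive relation to which `unitInterval.rel_of_local` applies. -/
theorem isDirected_of_local
    (h : ∀ t, ∀ᶠ s in 𝓝 t, (s ≤ t → M.MonotoneOnPiece p s t) ∧
      (t ≤ s → M.MonotoneOnPiece p t s)) : M.IsDirected p := by
  refine unitInterval.rel_of_local (P := fun a b => ∃ (m : ℕ) (c : ℕ → I), Monotone c ∧ c 0 = a ∧
    c m = b ∧ ∀ k < m, M.MonotoneOnPiece p (c k) (c (k + 1))) ?_ ?_ zero_le_one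
  · rintro x y z hxy hyz ⟨m, c, hc, c0, cm, h⟩ ⟨l, d, hd, d0, dl, h'⟩
    have e1 : ∀ k, k ≤ m → (if k ≤ m then c k else d (k - m)) = c k := fun k hk => if_pos hk
    have e2 : ∀ k, m ≤ k → (if k ≤ m then c k else d (k - m)) = d (k - m) := fun k hk => by
      split_ifs with h
      · obtain rfl := le_antisymm h hk
        rw [cm, Nat.sub_self, d0]
      · rfl
    refine ⟨m + l, fun k => if k ≤ m then c k else d (k - m), monotone_nat_of_le_succ fun k => ?_,
      ?_, ?_, fun k hk => ?_⟩
    · rcases lt_or_ge k m with hk | hk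
      · simp only [e1 k hk.le, e1 (k + 1) hk]
        exact hc (Nat.le_succ k)
      · simp only [e2 k hk, e2 (k + 1) (by omega)]
        exact hd (by omega)
    · exact (e1 0 (Nat.zero_le _)).trans c0
    · exact (e2 (m + l) (by omega)).trans (by rw [Nat.add_sub_cancel_left, dl])
    · rcases lt_or_ge k m with hkm | hkm
      · simp only [e1 k hkm.le, e1 (k + 1) hkm]
        exact h k hkm
      · simp only [e2 k hkm, e2 (k + 1) (by omega)]
        rw [show k + 1 - m = k - m + 1 by omega]
        exact h' _ (by omega)
  · have one : ∀ x y, x ≤ y → M.MonotoneOnPiece p x y → ∃ (m : ℕ) (c : ℕ → I), Monotone c ∧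
        c 0 = x ∧ c m = y ∧ ∀ k < m, M.MonotoneOnPiece p (c k) (c (k + 1)) := fun x y hxy h =>
      ⟨1, fun k => if k = 0 then x else y, monotone_nat_of_le_succ fun k => by
        split_ifs <;> simp_all, rfl, rfl, fun k hk => by
        obtain rfl : k = 0 := by omega
        exact h⟩
    intro t
    filter_upwards [h t] with r hr
    exact ⟨fun h => one _ _ h (hr.1 h), fun h => one _ _ h (hr.2 h)⟩

theorem isDirected_of_bulk (h : ∀ t, p t ∉ M.defect) : M.IsDirected p :=
  isDirected_of_local fun _ => .of_forall fun _ =>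
    ⟨fun _ => Or.inl fun u _ => h u, fun _ => Or.inl fun u _ => h u⟩

theorem isDirected_of_small (hp : Continuous p)
    (h : ∀ t, p t ∈ M.defect → ∀ N, T.IsSmall (p t) N → ∀ a b, a ≤ b →
      (∀ u ∈ Icc a b, p u ∈ N) → M.MonotoneOnPiece p a b) : M.IsDirected p := by
  refine isDirected_of_local fun t => ?_
  by_cases ht : p t ∈ M.defect
  · obtain ⟨N, hN, hs⟩ := T.exists_isSmall (p t)
    filter_upwards [unitInterval.eventually_uIcc (hp.continuousAt.eventually hN)] with r hr
    refine ⟨fun hrt => h t ht N hs r t hrt fun u hu => hr u ?_,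
      fun hrt => h t ht N hs t r hrt fun u hu => hr u ?_⟩
    · rwa [uIcc_of_le hrt]
    · rwa [uIcc_of_ge hrt]
  · have := hp.continuousAt.eventually (M.isClosed_defect.isOpen_compl.mem_nhds ht)
    filter_upwards [unitInterval.eventually_uIcc this] with r hr
    refine ⟨fun hrt => Or.inl fun u hu => hr u ?_, fun hrt => Or.inl fun u hu => hr u ?_⟩
    · rwa [uIcc_of_le hrt]
    · rwa [uIcc_of_ge hrt]

/-- Such a path is monotone for `≼₊` near each of its defect points. The hypothesis excludes
outbound carriers and does not ask for inbound ones, because carriers of bulk points may miss the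
defect. -/
theorem isDirected_of_upper (hp : Continuous p)
    (hu : ∀ s t, s ≤ t → p s ∈ M.defect → p t ∈ M.defect)
    (hin : ∀ t, p t ∉ M.defect → ¬ T.Outb (T.car (p t))) : M.IsDirected p := by
  refine isDirected_of_small (T := T) hp fun r hr N hN a b hab hpN => ?_
  obtain ⟨S, hS⟩ := exists_inLocalStratum hr
  have hran : ∀ u ∈ Icc a b, p u ∈ range (M.collar S) := fun u hu => (hN.2 S hS).1 (hpN u hu)
  refine Or.inr ⟨S, hran, Or.inl fun u hu' v hv huv => ?_⟩
  by_cases hud : p u ∈ M.defect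
  · exact ⟨none, none, M.inLocalStratum_none_of_mem_range (hran u hu') hud,
      M.inLocalStratum_none_of_mem_range (hran v hv) (hu u v huv hud), .refl⟩
  · by_cases hvd : p v ∈ M.defect
    · obtain ⟨i, hi⟩ := M.exists_page_of_mem_range (hran u hu') hud
      exact ⟨some i, none, hi, M.inLocalStratum_none_of_mem_range (hran v hv) hvd,
        .single (.intro i (not_not.1 fun h => hin u hud
          (((hN.2 S hS).2 _ (hpN u hu') hud i hi).2.2 h)))⟩
    · obtain ⟨i, h1, h2⟩ := hN.page_eq hp hS
        (fun t ht => hpN t ⟨hu'.1.trans ht.1, ht.2.trans hv.2⟩) huv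
        fun t ht htd => hvd (hu t v ht.2 htd)
      exact ⟨some i, some i, h1, h2, .refl⟩

theorem isDirected_of_lower (hp : Continuous p)
    (hu : ∀ s t, s ≤ t → p t ∈ M.defect → p s ∈ M.defect)
    (hout : ∀ t, p t ∉ M.defect → ¬ T.Inb (T.car (p t))) : M.IsDirected p := by
  refine isDirected_of_small (T := T) hp fun r hr N hN a b hab hpN => ?_
  obtain ⟨S, hS⟩ := exists_inLocalStratum hr
  have hran : ∀ u ∈ Icc a b, p u ∈ range (M.collar S) := fun u hu => (hN.2 S hS).1 (hpN u hu)
  refine Or.inr ⟨S, hran, Or.inr fun u hu' v hv huv => ?_⟩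
  by_cases hvd : p v ∈ M.defect
  · exact ⟨none, none, M.inLocalStratum_none_of_mem_range (hran u hu') (hu u v huv hvd),
      M.inLocalStratum_none_of_mem_range (hran v hv) hvd, .refl⟩
  · by_cases hud : p u ∈ M.defect
    · obtain ⟨i, hi⟩ := M.exists_page_of_mem_range (hran v hv) hvd
      exact ⟨none, some i, M.inLocalStratum_none_of_mem_range (hran u hu') hud, hi,
        .single (.intro i fun h => hout v hvd (((hN.2 S hS).2 _ (hpN v hv) hvd i hi).1.2 h))⟩
    · obtain ⟨i, h1, h2⟩ := hN.page_eq hp hS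
        (fun t ht => hpN t ⟨hu'.1.trans ht.1, ht.2.trans hv.2⟩) huv
        fun t ht htd => hud (hu u t ht.1 htd)
      exact ⟨some i, some i, h1, h2, .refl⟩

end Paths

end ManifoldWithDefect.DirectedTriangulation

/-! ### Transport along directed paths -/

namespace ManifoldWithDefect.DirectedTriangulation

variable {n : ℕ} {X : Type*} [TopologicalSpace X] {M : ManifoldWithDefect n X}
  (T : M.DirectedTriangulation)

/-- `x` and `y` lie in a common simplex, and the segment from `x` to `y` is directed. -/
def Lin (x y : X) : Prop := ∃ s ∈ T.K.faces, T.car x ⊆ s ∧ T.car y ⊆ s ∧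
  (x ∉ M.defect → y ∈ M.defect → T.Inb s) ∧ (x ∈ M.defect → y ∉ M.defect → T.Outb s)

variable {T} {x y z w : X}

theorem In.lin (h : T.In x w) : T.Lin x w :=
  ⟨_, T.car_mem x, subset_rfl, h.1, fun h1 h2 => h.2 h2 h1,
    fun h1 h2 => absurd (mem_defect_of_car_subset h.1 h1) h2⟩

theorem Out.lin (h : T.Out x w) : T.Lin w x :=
  ⟨_, T.car_mem x, h.1, subset_rfl, fun h1 h2 => absurd (mem_defect_of_car_subset h.1 h2) h1,
    fun h1 h2 => h.2 h1 h2⟩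

theorem Lin.refl (x : X) : T.Lin x x := (In.refl x).lin

/-- The simplex that witnesses `Lin` and the given `s` share the face spanned by the two carriers,
and the orientation type can be tested there. -/
theorem Lin.inb {s : Finset (EuclideanSpace ℝ (Fin T.dim))} (h : T.Lin x y) (hs : s ∈ T.K.faces)
    (hx : T.car x ⊆ s) (hy : T.car y ⊆ s) (hxd : x ∉ M.defect) (hyd : y ∈ M.defect) :
    T.Inb s := by
  classical
  obtain ⟨s', hs', hx', hy', h, _⟩ := h
  have hf : T.car x ∪ T.car y ∈ T.K.faces := T.K.down_closed hs (Finset.union_subset hx hy)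
    ((Geometry.SimplicialComplex.nonempty_of_mem_faces (T.car_mem x)).mono Finset.subset_union_left)
  have hb : ¬ ((T.car x ∪ T.car y : Finset _) : Set _) ⊆ T.defectVertices := fun h =>
    hxd ((T.mem_defect_iff x).2 (subset_trans (by simp) h))
  rw [← inb_face_iff hs hf (Finset.union_subset hx hy) hb Finset.subset_union_right hyd,
    inb_face_iff hs' hf (Finset.union_subset hx' hy') hb Finset.subset_union_right hyd]
  exact h hxd hyd

theorem Lin.outb {s : Finset (EuclideanSpace ℝ (Fin T.dim))} (h : T.Lin x y) (hs : s ∈ T.K.faces)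
    (hx : T.car x ⊆ s) (hy : T.car y ⊆ s) (hxd : x ∈ M.defect) (hyd : y ∉ M.defect) :
    T.Outb s := by
  classical
  obtain ⟨s', hs', hx', hy', _, h⟩ := h
  have hf : T.car x ∪ T.car y ∈ T.K.faces := T.K.down_closed hs (Finset.union_subset hx hy)
    ((Geometry.SimplicialComplex.nonempty_of_mem_faces (T.car_mem x)).mono Finset.subset_union_left)
  have hb : ¬ ((T.car x ∪ T.car y : Finset _) : Set _) ⊆ T.defectVertices := fun h =>
    hyd ((T.mem_defect_iff y).2 (subset_trans (by simp) h))
  rw [← outb_face_iff hs hf (Finset.union_subset hx hy) hb Finset.subset_union_left hxd,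
    outb_face_iff hs' hf (Finset.union_subset hx' hy') hb Finset.subset_union_left hxd]
  exact h hxd hyd

theorem Lin.trans {s : Finset (EuclideanSpace ℝ (Fin T.dim))} (hs : s ∈ T.K.faces)
    (hx : T.car x ⊆ s) (hy : T.car y ⊆ s) (hz : T.car z ⊆ s) (h : T.Lin x y) (h' : T.Lin y z) :
    T.Lin x z := by
  refine ⟨s, hs, hx, hz, fun h1 h2 => ?_, fun h1 h2 => ?_⟩
  · by_cases h3 : y ∈ M.defect
    · exact h.inb hs hx hy h1 h3
    · exact h'.inb hs hy hz h3 h2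
  · by_cases h3 : y ∈ M.defect
    · exact h'.outb hs hy hz h3 h2
    · exact h.outb hs hx hy h1 h3

variable (T) in
/-- Arrows for directed segments, compatible with composition in each simplex. -/
structure Cocycle (C : Type*) [Category C] where
  obj : X → C
  map : ∀ {x y : X}, T.Lin x y → (obj x ⟶ obj y)
  map_self : ∀ {x : X} (h : T.Lin x x), map h = 𝟙 (obj x)
  map_comp : ∀ {x y z : X} {s : Finset (EuclideanSpace ℝ (Fin T.dim))}, s ∈ T.K.faces →
    T.car x ⊆ s → T.car y ⊆ s → T.car z ⊆ s →
    ∀ (hxy : T.Lin x y) (hyz : T.Lin y z) (hxz : T.Lin x z), map hxy ≫ map hyz = map hxz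

namespace Cocycle

variable {C : Type*} [Category C] (c : T.Cocycle C)

/-- `g` is a composition of arrows of the cocycle `c` along a chain of short steps of the path `p`
from time `s` to time `t`. -/
inductive Tr (p : I → X) : I → I → ∀ x y : X, (c.obj x ⟶ c.obj y) → Prop
  | arrive {s t : I} {x y : X} (hst : s ≤ t) (hx : p s = x) (hy : p t = y)
      (h : ∀ u ∈ Icc s t, T.In (p u) y) (l : T.Lin x y) : Tr p s t x y (c.map l)
  | depart {s t : I} {x y : X} (hst : s ≤ t) (hx : p s = x) (hy : p t = y)
      (h : ∀ u ∈ Icc s t, T.Out (p u) x) (l : T.Lin x y) : Tr p s t x y (c.map l)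
  | comp {s u t : I} {x y z : X} {g : c.obj x ⟶ c.obj y} {g' : c.obj y ⟶ c.obj z} :
      Tr p s u x y g → Tr p u t y z g' → Tr p s t x z (g ≫ g')

variable {c} {p : I → X} {s t : I} {g : c.obj x ⟶ c.obj y}

/-! ### Existence, splitting and uniqueness of transport -/

namespace Tr

theorem le (h : c.Tr p s t x y g) : s ≤ t := by
  induction h with
  | arrive hst | depart hst => exact hst
  | comp _ _ h1 h2 => exact h1.trans h2

theorem source (h : c.Tr p s t x y g) : p s = x := by
  induction h with
  | arrive _ h | depart _ h => exact h
  | comp _ _ h1 _ => exact h1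

theorem target (h : c.Tr p s t x y g) : p t = y := by
  induction h with
  | arrive _ _ h | depart _ _ h => exact h
  | comp _ _ _ h2 => exact h2

/-- Close to time `r`, earlier points of the path arrive at `p r` and later points depart from it,
so one segment is enough. -/
theorem exists_of_isDirected (hp : Continuous p) (hd : M.IsDirected p) (hst : s ≤ t)
    (hx : p s = x) (hy : p t = y) : ∃ g : c.obj x ⟶ c.obj y, c.Tr p s t x y g := by
  subst hx hy
  refine unitInterval.rel_of_local (P := fun s t => ∃ g : c.obj (p s) ⟶ c.obj (p t),
    c.Tr p s t (p s) (p t) g) ?_ ?_ hst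
  · rintro a b d _ _ ⟨g, h⟩ ⟨g', h'⟩
    exact ⟨_, h.comp h'⟩
  · intro r
    obtain ⟨N, hN, hs⟩ := T.exists_isSmall (p r)
    filter_upwards [unitInterval.eventually_uIcc (hp.continuousAt.eventually hN)] with a ha
    constructor
    · intro har
      rw [uIcc_of_le har] at ha
      have h : ∀ u ∈ Icc a r, T.In (p u) (p r) := fun u hu =>
        (hs.in_out hp hd (fun v hv => ha v ⟨hu.1.trans hv.1, hv.2⟩) hu.2).1 (In.refl _)
      exact ⟨_, .arrive har rfl rfl h (h a ⟨le_rfl, har⟩).lin⟩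
    · intro har
      rw [uIcc_of_ge har] at ha
      have h : ∀ u ∈ Icc r a, T.Out (p u) (p r) := fun u hu =>
        (hs.in_out hp hd (fun v hv => ha v ⟨hv.1, hv.2.trans hu.2⟩) hu.1).2 (Out.refl _)
      exact ⟨_, .depart har rfl rfl h (h a ⟨har, le_rfl⟩).lin⟩

/-- Each elementary step lies in a simplex that also contains `w`: the carrier of its starting point
if it arrives, of its end point if it departs. The triangle relation absorbs the steps one after
another. -/
theorem comp_arrive (h : c.Tr p s t x y g) (hin : ∀ u ∈ Icc s t, T.In (p u) w)
    (lx : T.Lin x w) (ly : T.Lin y w) : g ≫ c.map ly = c.map lx := by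
  induction h with
  | @arrive s t x y hst hx hy h l =>
    have h1 := h s ⟨le_rfl, hst⟩
    have h2 := hin t ⟨hst, le_rfl⟩
    rw [hx] at h1
    rw [hy] at h2
    exact c.map_comp (T.car_mem x) subset_rfl h1.1 (h2.1.trans h1.1) _ _ _
  | @depart s t x y hst hx hy h l =>
    have h1 := h t ⟨hst, le_rfl⟩
    have h2 := hin t ⟨hst, le_rfl⟩
    rw [hy] at h1 h2
    exact c.map_comp (T.car_mem y) h1.1 subset_rfl h2.1 _ _ _
  | @comp s u t x y z g g' h h' ih ih' =>
    have hu := hin u ⟨h.le, h'.le⟩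
    rw [h.target] at hu
    rw [Category.assoc, ih' (fun v hv => hin v ⟨h.le.trans hv.1, hv.2⟩) hu.lin ly,
      ih (fun v hv => hin v ⟨hv.1, hv.2.trans h'.le⟩) lx hu.lin]

theorem depart_comp (h : c.Tr p s t x y g) (hout : ∀ u ∈ Icc s t, T.Out (p u) w)
    (lx : T.Lin w x) (ly : T.Lin w y) : c.map lx ≫ g = c.map ly := by
  induction h with
  | @arrive s t x y hst hx hy h l =>
    have h1 := h s ⟨le_rfl, hst⟩
    have h2 := hout s ⟨le_rfl, hst⟩
    rw [hx] at h1 h2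
    exact c.map_comp (T.car_mem x) h2.1 subset_rfl h1.1 _ _ _
  | @depart s t x y hst hx hy h l =>
    have h1 := h t ⟨hst, le_rfl⟩
    have h2 := hout s ⟨le_rfl, hst⟩
    rw [hx] at h2
    rw [hy] at h1
    exact c.map_comp (T.car_mem y) (h2.1.trans h1.1) h1.1 subset_rfl _ _ _
  | @comp s u t x y z g g' h h' ih ih' =>
    have hu := hout u ⟨h.le, h'.le⟩
    rw [h.target] at hu
    rw [← Category.assoc, ih (fun v hv => hout v ⟨hv.1, hv.2.trans h'.le⟩) lx hu.lin,
      ih' (fun v hv => hout v ⟨h.le.trans hv.1, hv.2⟩) hu.lin ly]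

/-- Only a single step has to be cut. Cutting an arriving step, the first part has some transport by
existence, the second is again an arriving segment, and `comp_arrive` identifies the composition;
departing steps are dual. -/
theorem split (hp : Continuous p) (hd : M.IsDirected p) (h : c.Tr p s t x y g) {u : I}
    (hsu : s ≤ u) (hut : u ≤ t) (hz : p u = z) : ∃ (g₁ : c.obj x ⟶ c.obj z)
      (g₂ : c.obj z ⟶ c.obj y), c.Tr p s u x z g₁ ∧ c.Tr p u t z y g₂ ∧ g = g₁ ≫ g₂ := by
  subst hz
  induction h with
  | @arrive s t x y hst hx hy h l =>
    obtain ⟨g₁, h1⟩ := exists_of_isDirected (c := c) hp hd hsu hx rfl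
    have hu := h u ⟨hsu, hut⟩
    exact ⟨g₁, c.map hu.lin, h1, .arrive hut rfl hy (fun v hv => h v ⟨hsu.trans hv.1, hv.2⟩) _,
      (h1.comp_arrive (fun v hv => h v ⟨hv.1, hv.2.trans hut⟩) _ _).symm⟩
  | @depart s t x y hst hx hy h l =>
    obtain ⟨g₂, h2⟩ := exists_of_isDirected (c := c) hp hd hut rfl hy
    have hu := h u ⟨hsu, hut⟩
    exact ⟨c.map hu.lin, g₂, .depart hsu hx rfl (fun v hv => h v ⟨hv.1, hv.2.trans hut⟩) _, h2,
      (h2.depart_comp (fun v hv => h v ⟨hsu.trans hv.1, hv.2⟩) _ _).symm⟩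
  | @comp s v t x y z g g' h h' ih ih' =>
    rcases le_total u v with huv | huv
    · obtain ⟨g₁, g₂, h1, h2, e⟩ := ih hsu huv
      exact ⟨g₁, g₂ ≫ g', h1, h2.comp h', by rw [e, Category.assoc]⟩
    · obtain ⟨g₁, g₂, h1, h2, e⟩ := ih' huv hut
      exact ⟨g ≫ g₁, g₂, h.comp h1, h2, by rw [e, Category.assoc]⟩

/-- By splitting, the claim is transitive in the time interval. On a short interval before `r` every
point arrives at `p r`, so `comp_arrive` with target `p r` shows that any transport equals the
single segment; after `r` it is dual. -/
theorem unique (hp : Continuous p) (hd : M.IsDirected p) {g' : c.obj x ⟶ c.obj y}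
    (h : c.Tr p s t x y g) (h' : c.Tr p s t x y g') : g = g' := by
  suffices H : ∀ x y (g g' : c.obj x ⟶ c.obj y), c.Tr p s t x y g → c.Tr p s t x y g' → g = g' from
    H x y g g' h h'
  refine unitInterval.rel_of_local (P := fun s t => ∀ x y (g g' : c.obj x ⟶ c.obj y),
    c.Tr p s t x y g → c.Tr p s t x y g' → g = g') ?_ ?_ h.le
  · intro a b d hab hbd h1 h2 x y g g' h h'
    obtain ⟨g₁, g₂, k1, k2, rfl⟩ := h.split hp hd hab hbd rfl
    obtain ⟨g₁', g₂', k1', k2', rfl⟩ := h'.split hp hd hab hbd rfl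
    rw [h1 _ _ _ _ k1 k1', h2 _ _ _ _ k2 k2']
  · intro r
    obtain ⟨N, hN, hs⟩ := T.exists_isSmall (p r)
    filter_upwards [unitInterval.eventually_uIcc (hp.continuousAt.eventually hN)] with a ha
    constructor
    · intro har x y g g' k k'
      rw [uIcc_of_le har] at ha
      have h : ∀ u ∈ Icc a r, T.In (p u) (p r) := fun u hu =>
        (hs.in_out hp hd (fun v hv => ha v ⟨hu.1.trans hv.1, hv.2⟩) hu.2).1 (In.refl _)
      obtain rfl := k.target
      obtain rfl := k.source
      have e := k.comp_arrive h (h a ⟨le_rfl, har⟩).lin (Lin.refl _)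
      have e' := k'.comp_arrive h (h a ⟨le_rfl, har⟩).lin (Lin.refl _)
      rw [c.map_self, Category.comp_id] at e e'
      rw [e, e']
    · intro har x y g g' k k'
      rw [uIcc_of_ge har] at ha
      have h : ∀ u ∈ Icc r a, T.Out (p u) (p r) := fun u hu =>
        (hs.in_out hp hd (fun v hv => ha v ⟨hv.1, hv.2.trans hu.2⟩) hu.1).2 (Out.refl _)
      obtain rfl := k.target
      obtain rfl := k.source
      have e := k.depart_comp h (Lin.refl _) (h a ⟨har, le_rfl⟩).lin
      have e' := k'.depart_comp h (Lin.refl _) (h a ⟨har, le_rfl⟩).lin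
      rw [c.map_self, Category.id_comp] at e e'
      rw [e, e']

/-- The image of a time interval under `f` is the whole interval between the image times, by the
intermediate value theorem, so the conditions on the steps carry over. -/
theorem of_reparam {f : I → I} (hf : Monotone f) (hfc : Continuous f)
    (h : c.Tr (fun u => p (f u)) s t x y g) : c.Tr p (f s) (f t) x y g := by
  induction h with
  | arrive hst hx hy h l =>
    refine .arrive (hf hst) hx hy (fun v hv => ?_) l
    obtain ⟨u, hu, rfl⟩ := intermediate_value_Icc hst hfc.continuousOn hv
    exact h u hu
  | depart hst hx hy h l =>
    refine .depart (hf hst) hx hy (fun v hv => ?_) l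
    obtain ⟨u, hu, rfl⟩ := intermediate_value_Icc hst hfc.continuousOn hv
    exact h u hu
  | comp _ _ h1 h2 => exact h1.comp h2

theorem of_const (h : ∀ u ∈ Icc s t, p u = x) (hst : s ≤ t) : c.Tr p s t x x (𝟙 (c.obj x)) := by
  rw [← c.map_self (Lin.refl x)]
  exact .arrive hst (h s ⟨le_rfl, hst⟩) (h t ⟨hst, le_rfl⟩)
    (fun u hu => by rw [h u hu]; exact In.refl x) _

/-- Transport close to `w` goes through `w`. -/
theorem eq_of_small {N : Set X} (hN : T.IsSmall w N) (hp : Continuous p) (hd : M.IsDirected p)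
    (hpN : ∀ u ∈ Icc s t, p u ∈ N) (h : c.Tr p s t x y g) (hx : T.In x w) (hy : T.Out y w) :
    g = c.map hx.lin ≫ c.map hy.lin := by
  obtain rfl := h.source
  obtain rfl := h.target
  obtain ⟨r, hr, h1, h2⟩ := hN.exists_in_out hp hpN h.le hx hy
  obtain ⟨g₁, g₂, k1, k2, rfl⟩ := h.split hp hd hr.1 hr.2 rfl
  have e1 := k1.comp_arrive (w := w) (fun u hu => (hN.in_out hp hd
    (fun v hv => hpN v ⟨hu.1.trans hv.1, hv.2.trans hr.2⟩) hu.2).1 h1) hx.lin h1.lin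
  have e2 := k2.depart_comp (w := w) (fun u hu => (hN.in_out hp hd
    (fun v hv => hpN v ⟨hr.1.trans hv.1, hv.2.trans hu.2⟩) hu.1).2 h2) h2.lin hy.lin
  -- The point `p r` both arrives at and departs from `w`, so the detour from `p r` to `w` and back
  -- is trivial and may be inserted between the two halves.
  have e3 := c.map_comp (T.car_mem (p r)) subset_rfl h1.1 subset_rfl h1.lin h2.lin (Lin.refl _)
  rw [c.map_self] at e3
  rw [← e1, ← e2, Category.assoc, ← Category.assoc (c.map h1.lin), e3, Category.id_comp]

end Tr

end Cocycle

theorem IsSmall.in_or_out {N : Set X} (hN : T.IsSmall w N) (hx : x ∈ N) : T.In x w ∨ T.Out x w := by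
  by_cases hw : w ∈ M.defect
  · by_cases hd : x ∈ M.defect
    · exact Or.inl (hN.in_of_mem hx hd)
    · obtain ⟨S, hS⟩ := exists_inLocalStratum hw
      obtain ⟨i, hi⟩ := M.exists_page_of_mem_range ((hN.2 S hS).1 hx) hd
      rw [hN.in_iff hS hx hi, hN.out_iff hS hx hi]
      exact em _
  · exact Or.inl (hN.in_of_notMem hw hx)

namespace Cocycle

variable {C : Type*} [Category C] {c : T.Cocycle C}

/-- The intermediate point `z` arrives or departs. If it arrives, all of the first path does and is
absorbed in front of `w`, and the second path goes through `w`; if it departs, the roles are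
exchanged. -/
theorem Tr.comp_eq_of_small {N : Set X} (hN : T.IsSmall w N) {p q : I → X} (hp : Continuous p)
    (hpd : M.IsDirected p) (hq : Continuous q) (hqd : M.IsDirected q) {s s' t t' : I}
    (hpN : ∀ u ∈ Icc s s', p u ∈ N) (hqN : ∀ u ∈ Icc t t', q u ∈ N)
    {g : c.obj x ⟶ c.obj z} {g' : c.obj z ⟶ c.obj y} (h : c.Tr p s s' x z g)
    (h' : c.Tr q t t' z y g') (hx : T.In x w) (hy : T.Out y w) :
    g ≫ g' = c.map hx.lin ≫ c.map hy.lin := by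
  have hz : z ∈ N := by
    rw [← h.target]
    exact hpN _ ⟨h.le, le_rfl⟩
  rcases hN.in_or_out hz with hz | hz
  · rw [h'.eq_of_small hN hq hqd hqN hz hy, ← Category.assoc, h.comp_arrive _ hx.lin hz.lin]
    intro u hu
    refine (hN.in_out hp hpd (fun v hv => hpN v ⟨hu.1.trans hv.1, hv.2⟩) hu.2).1 ?_
    rwa [h.target]
  · rw [h.eq_of_small hN hp hpd hpN hx hz, Category.assoc, h'.depart_comp _ hz.lin hy.lin]
    intro u hu
    refine (hN.in_out hq hqd (fun v hv => hqN v ⟨hv.1, hv.2.trans hu.2⟩) hu.1).2 ?_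
    rwa [h'.source]

/-! ### Homotopy invariance of transport -/

section Square

variable {h : I × I → X}

variable (c) in
/-- Transport around the boundary of the rectangle `[s, s'] × [t, t']` commutes. -/
def Commutes (h : I × I → X) (s s' t t' : I) : Prop :=
  ∀ (x y x' y' : X) (g₁ : c.obj x ⟶ c.obj y) (g₂ : c.obj y ⟶ c.obj y') (g₃ : c.obj x ⟶ c.obj x')
    (g₄ : c.obj x' ⟶ c.obj y'), c.Tr (fun u => h (u, t)) s s' x y g₁ →
    c.Tr (fun u => h (s', u)) t t' y y' g₂ → c.Tr (fun u => h (s, u)) t t' x x' g₃ →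
    c.Tr (fun u => h (u, t')) s s' x' y' g₄ → g₁ ≫ g₂ = g₃ ≫ g₄

/-- The lower left corner arrives at the centre `h (a, b)` and the upper right corner departs from
it. Both ways around the rectangle therefore equal the composition of the two segments through the
centre. -/
theorem commutes_of_small (hc : Continuous h) (hh : ∀ t, M.IsDirected fun u => h (u, t))
    (hv : ∀ s, M.IsDirected fun u => h (s, u)) {s s' t t' a b : I} {N : Set X}
    (ha : a ∈ Icc s s') (hb : b ∈ Icc t t') (hN : T.IsSmall (h (a, b)) N)
    (hsub : ∀ u ∈ Icc s s', ∀ v ∈ Icc t t', h (u, v) ∈ N) : c.Commutes h s s' t t' := by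
  intro x y x' y' g₁ g₂ g₃ g₄ h1 h2 h3 h4
  have ch : ∀ v, Continuous fun u => h (u, v) := fun v => by fun_prop
  have cv : ∀ u, Continuous fun v => h (u, v) := fun u => by fun_prop
  have hs : s ∈ Icc s s' := ⟨le_rfl, h1.le⟩
  have hs' : s' ∈ Icc s s' := ⟨h1.le, le_rfl⟩
  have ht : t ∈ Icc t t' := ⟨le_rfl, h2.le⟩
  have ht' : t' ∈ Icc t t' := ⟨h2.le, le_rfl⟩
  -- The corner is reached backwards from the centre, down the vertical line at `a` and then left
  -- along the bottom side.
  have hx : T.In x (h (a, b)) := by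
    have e1 := (hN.in_out (ch t) (hh t) (a := s) (b := a)
      (fun u hu => hsub u ⟨hu.1, hu.2.trans ha.2⟩ t ht) ha.1).1
    have e2 := (hN.in_out (cv a) (hv a) (a := t) (b := b)
      (fun u hu => hsub a ha u ⟨hu.1, hu.2.trans hb.2⟩) hb.1).1
    have := e1 (e2 (In.refl _))
    rwa [h1.source] at this
  have hy : T.Out y' (h (a, b)) := by
    have e1 := (hN.in_out (ch t') (hh t') (a := a) (b := s')
      (fun u hu => hsub u ⟨ha.1.trans hu.1, hu.2⟩ t' ht') ha.2).2
    have e2 := (hN.in_out (cv a) (hv a) (a := b) (b := t')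
      (fun u hu => hsub a ha u ⟨hb.1.trans hu.1, hu.2⟩) hb.2).2
    have := e1 (e2 (Out.refl _))
    rwa [h4.target] at this
  rw [h1.comp_eq_of_small hN (ch t) (hh t) (cv s') (hv s') (fun u hu => hsub u hu t ht)
      (fun u hu => hsub s' hs' u hu) h2 hx hy,
    h3.comp_eq_of_small hN (cv s) (hv s) (ch t') (hh t') (fun u hu => hsub s hs u hu)
      (fun u hu => hsub u hu t' ht') h4 hx hy]

theorem Commutes.horizontal (hc : Continuous h) (hh : ∀ t, M.IsDirected fun u => h (u, t))
    (hv : ∀ s, M.IsDirected fun u => h (s, u)) {s s' s'' t t' : I} (hs : s ≤ s') (hs' : s' ≤ s'')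
    (k : c.Commutes h s s' t t') (k' : c.Commutes h s' s'' t t') : c.Commutes h s s'' t t' := by
  intro x y x' y' g₁ g₂ g₃ g₄ h1 h2 h3 h4
  have ch : ∀ v, Continuous fun u => h (u, v) := fun v => by fun_prop
  have cv : ∀ u, Continuous fun v => h (u, v) := fun u => by fun_prop
  obtain ⟨a1, b1, ka1, kb1, rfl⟩ := h1.split (ch t) (hh t) hs hs' rfl
  obtain ⟨a4, b4, ka4, kb4, rfl⟩ := h4.split (ch t') (hh t') hs hs' rfl
  obtain ⟨m, km⟩ := Tr.exists_of_isDirected (c := c) (cv s') (hv s') h2.le rfl rfl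
  rw [Category.assoc, k' _ _ _ _ _ _ _ _ kb1 h2 km kb4, ← Category.assoc,
    k _ _ _ _ _ _ _ _ ka1 km h3 ka4, Category.assoc]

theorem Commutes.vertical (hc : Continuous h) (hh : ∀ t, M.IsDirected fun u => h (u, t))
    (hv : ∀ s, M.IsDirected fun u => h (s, u)) {s s' t t' t'' : I} (ht : t ≤ t') (ht' : t' ≤ t'')
    (k : c.Commutes h s s' t t') (k' : c.Commutes h s s' t' t'') : c.Commutes h s s' t t'' := by
  intro x y x' y' g₁ g₂ g₃ g₄ h1 h2 h3 h4
  have ch : ∀ v, Continuous fun u => h (u, v) := fun v => by fun_prop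
  have cv : ∀ u, Continuous fun v => h (u, v) := fun u => by fun_prop
  obtain ⟨a2, b2, ka2, kb2, rfl⟩ := h2.split (cv s') (hv s') ht ht' rfl
  obtain ⟨a3, b3, ka3, kb3, rfl⟩ := h3.split (cv s) (hv s) ht ht' rfl
  obtain ⟨m, km⟩ := Tr.exists_of_isDirected (c := c) (ch t') (hh t') h1.le rfl rfl
  rw [← Category.assoc, k _ _ _ _ _ _ _ _ h1 ka2 ka3 km, Category.assoc,
    k' _ _ _ _ _ _ _ _ km kb2 kb3 h4, Category.assoc]

/-- The local-to-global principle is applied twice and replaces a Lebesgue number. The inner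
relation contains "for all `t` near `b`", so that finitely many small rectangles give a strip of
common height across the square. -/
theorem commutes (hc : Continuous h) (hh : ∀ t, M.IsDirected fun u => h (u, t))
    (hv : ∀ s, M.IsDirected fun u => h (s, u)) : c.Commutes h 0 1 0 1 := by
  refine unitInterval.rel_of_local (P := fun t t' => c.Commutes h 0 1 t t')
    (fun a b d hab hbd k k' => k.vertical hc hh hv hab hbd k') (fun b => ?_) zero_le_one
  refine unitInterval.rel_of_local (P := fun s s' => ∀ᶠ t in 𝓝 b,
    (t ≤ b → c.Commutes h s s' t b) ∧ (b ≤ t → c.Commutes h s s' b t)) ?_ (fun a => ?_) zero_le_one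
  · intro s s' s'' hs hs' k k'
    filter_upwards [k, k'] with t k k'
    exact ⟨fun ht => (k.1 ht).horizontal hc hh hv hs hs' (k'.1 ht),
      fun ht => (k.2 ht).horizontal hc hh hv hs hs' (k'.2 ht)⟩
  · obtain ⟨N, hN, hs⟩ := T.exists_isSmall (h (a, b))
    have h1 := hc.continuousAt.eventually hN
    rw [nhds_prod_eq, Filter.eventually_prod_iff] at h1
    obtain ⟨U, hU, V, hV, hUV⟩ := h1
    filter_upwards [unitInterval.eventually_uIcc hU] with s hs'
    constructor
    · intro hsa
      filter_upwards [unitInterval.eventually_uIcc hV] with t ht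
      rw [uIcc_of_le hsa] at hs'
      constructor
      · intro htb
        rw [uIcc_of_le htb] at ht
        exact commutes_of_small hc hh hv ⟨hsa, le_rfl⟩ ⟨htb, le_rfl⟩ hs
          fun u hu v hv => hUV (hs' u hu) (ht v hv)
      · intro htb
        rw [uIcc_of_ge htb] at ht
        exact commutes_of_small hc hh hv ⟨hsa, le_rfl⟩ ⟨le_rfl, htb⟩ hs
          fun u hu v hv => hUV (hs' u hu) (ht v hv)
    · intro hsa
      filter_upwards [unitInterval.eventually_uIcc hV] with t ht
      rw [uIcc_of_ge hsa] at hs'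
      constructor
      · intro htb
        rw [uIcc_of_le htb] at ht
        exact commutes_of_small hc hh hv ⟨le_rfl, hsa⟩ ⟨htb, le_rfl⟩ hs
          fun u hu v hv => hUV (hs' u hu) (ht v hv)
      · intro htb
        rw [uIcc_of_ge htb] at ht
        exact commutes_of_small hc hh hv ⟨le_rfl, hsa⟩ ⟨le_rfl, htb⟩ hs
          fun u hu v hv => hUV (hs' u hu) (ht v hv)

end Square

/-! ### The functor of a cocycle -/

variable (c)

theorem exists_transport (p : M.dSpace.DirPath x y) :
    ∃ g : c.obj x ⟶ c.obj y, c.Tr p.1 0 1 x y g :=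
  Tr.exists_of_isDirected p.1.continuous p.2 zero_le_one p.1.source p.1.target

/-- Transport along a directed path. -/
noncomputable def transport (p : M.dSpace.DirPath x y) : c.obj x ⟶ c.obj y :=
  (c.exists_transport p).choose

theorem tr_transport (p : M.dSpace.DirPath x y) : c.Tr p.1 0 1 x y (c.transport p) :=
  (c.exists_transport p).choose_spec

variable {c} in
theorem Tr.eq_transport {p : M.dSpace.DirPath x y} {g : c.obj x ⟶ c.obj y}
    (h : c.Tr p.1 0 1 x y g) : g = c.transport p :=
  h.unique p.1.continuous p.2 (c.tr_transport p)

theorem transport_reparam {p q : M.dSpace.DirPath x y} (h : M.dSpace.Reparam p q) :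
    c.transport p = c.transport q := by
  obtain ⟨f, hf, f0, f1, h⟩ := h
  have hq := c.tr_transport q
  rw [show (q.1 : I → X) = fun t => p.1 (f t) from funext h] at hq
  have := hq.of_reparam hf f.continuous
  rw [f0, f1] at this
  exact this.eq_transport.symm

theorem transport_refl (x : X) : c.transport (DSpace.DirPath.refl M.dSpace x) = 𝟙 (c.obj x) :=
  (Tr.eq_transport (Tr.of_const (fun _ _ => rfl) zero_le_one)).symm

/-- Each half of the concatenation, parametrized affinely, is the original path, so the two chains
move to `[0, 1/2]` and `[1/2, 1]` and compose there. -/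
theorem transport_trans (p : M.dSpace.DirPath x y) (q : M.dSpace.DirPath y z) :
    c.transport (p.trans q) = c.transport p ≫ c.transport q := by
  have hp := c.tr_transport p
  have hq := c.tr_transport q
  let f : I → I := fun t => ⟨(t : ℝ) / 2, by constructor <;> linarith [t.2.1, t.2.2]⟩
  let f' : I → I := fun t => ⟨((t : ℝ) + 1) / 2, by constructor <;> linarith [t.2.1, t.2.2]⟩
  have hf : Continuous f := by fun_prop
  have hf' : Continuous f' := by fun_prop
  have mf : Monotone f := fun a b hab => by
    have : (a : ℝ) ≤ b := hab
    change (a : ℝ) / 2 ≤ b / 2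
    linarith
  have mf' : Monotone f' := fun a b hab => by
    have : (a : ℝ) ≤ b := hab
    change ((a : ℝ) + 1) / 2 ≤ (b + 1) / 2
    linarith
  have ep : (p.1 : I → X) = fun t => (p.trans q).1 (f t) := funext fun t => by
    change _ = (p.1.trans q.1) (f t)
    have ht := t.2.2
    rw [DSpace.trans_eq, if_pos (by change (t : ℝ) / 2 ≤ 1 / 2; linarith)]
    congr 1
    have : 2 * ((f t : I) : ℝ) = t := by change 2 * ((t : ℝ) / 2) = t; ring
    rw [this, projIcc_val]
  have eq : (q.1 : I → X) = fun t => (p.trans q).1 (f' t) := funext fun t => by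
    change _ = (p.1.trans q.1) (f' t)
    have ht := t.2.1
    have e : 2 * ((f' t : I) : ℝ) - 1 = t := by change 2 * (((t : ℝ) + 1) / 2) - 1 = t; ring
    rw [DSpace.trans_eq]
    split_ifs with h
    · have h' : ((t : ℝ) + 1) / 2 ≤ 1 / 2 := h
      have t0 : t = 0 := Subtype.ext (le_antisymm (by simp only [Icc.coe_zero]; linarith) ht)
      rw [projIcc_of_right_le _ (by linarith), t0, q.1.source]
      exact p.1.target.symm
    · rw [e, projIcc_val]
  rw [ep] at hp
  rw [eq] at hq
  have hp' := hp.of_reparam mf hf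
  have hq' := hq.of_reparam mf' hf'
  have e0 : f 0 = 0 := Subtype.ext (by simp [f])
  have e1 : f 1 = f' 0 := Subtype.ext (by simp [f, f'])
  have e2 : f' 1 = 1 := Subtype.ext (by norm_num [f'])
  rw [e0, e1] at hp'
  rw [e2] at hq'
  exact (hp'.comp hq').eq_transport.symm

/-- Horizontal and vertical lines are monotone in both coordinates, hence directed in `X`; the two
vertical sides are constant and contribute identities. -/
theorem transport_homotopy {p q : M.dSpace.DirPath x y} {h : C(I × I, X)}
    (hd : M.dSpace.IsDirectedSquare h) (h0 : ∀ t, h (t, 0) = p.1 t) (h1 : ∀ t, h (t, 1) = q.1 t)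
    (hx : ∀ s, h (0, s) = x) (hy : ∀ s, h (1, s) = y) : c.transport p = c.transport q := by
  have hh : ∀ t, M.IsDirected fun u => h (u, t) := fun t =>
    hd (ContinuousMap.id I) (ContinuousMap.const I t) monotone_id monotone_const
  have hv : ∀ s, M.IsDirected fun u => h (s, u) := fun s =>
    hd (ContinuousMap.const I s) (ContinuousMap.id I) monotone_const monotone_id
  have hp := c.tr_transport p
  have hq := c.tr_transport q
  rw [← show (fun u => h (u, 0)) = (p.1 : I → X) from funext h0] at hp
  rw [← show (fun u => h (u, 1)) = (q.1 : I → X) from funext h1] at hq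
  have := commutes (c := c) h.continuous hh hv _ _ _ _ _ _ _ _ hp
    (Tr.of_const (fun u _ => hy u) zero_le_one) (Tr.of_const (fun u _ => hx u) zero_le_one) hq
  simpa using this

/-- Transport as a functor on directed paths up to reparametrization. -/
noncomputable def pathFunctor : DSpace.PathCat M.dSpace ⥤ C where
  obj x := c.obj x.pt
  map := Quot.lift (fun p => c.transport p) fun _ _ h => c.transport_reparam h
  map_id x := c.transport_refl x.pt
  map_comp := by
    rintro x y z ⟨p⟩ ⟨q⟩
    exact c.transport_trans p q

/-- Transport as a functor on the fundamental category. -/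
noncomputable def functor : M.dSpace.FundamentalCategory ⥤ C :=
  CategoryTheory.Quotient.lift _ c.pathFunctor (by
    rintro x y _ _ ⟨p, q, rfl, rfl, h, hd, h0, h1, hx, hy⟩
    exact c.transport_homotopy hd h0 h1 hx hy)

theorem functor_map_homotopyClass (p : M.dSpace.DirPath x y) :
    c.functor.map (M.dSpace.homotopyClass p) = c.transport p := rfl

end Cocycle

end ManifoldWithDefect.DirectedTriangulation

/-! ### Relations in the fundamental category -/

namespace DSpace

variable {X : Type*} [TopologicalSpace X] {d : DSpace X} {x y z x' y' : X}

theorem homotopyClass_trans (p : d.DirPath x y) (q : d.DirPath y z) :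
    d.homotopyClass (p.trans q) = d.homotopyClass p ≫ d.homotopyClass q := rfl

theorem homotopyClass_refl (x : X) :
    d.homotopyClass (DirPath.refl d x) = 𝟙 (d.fundObj x) := rfl

theorem homotopyClass_eq_id {p : d.DirPath x x} (h : ∀ t, p.1 t = x) :
    d.homotopyClass p = 𝟙 (d.fundObj x) := by
  rw [← homotopyClass_refl]
  congr 1
  exact Subtype.ext (Path.ext (funext h))

theorem homotopyClass_eq {p q : d.DirPath x y} (h : C(I × I, X)) (hd : d.IsDirectedSquare h)
    (h0 : ∀ t, h (t, 0) = p.1 t) (h1 : ∀ t, h (t, 1) = q.1 t) (hx : ∀ s, h (0, s) = x)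
    (hy : ∀ s, h (1, s) = y) : d.homotopyClass p = d.homotopyClass q :=
  CategoryTheory.Quotient.sound _ ⟨p, q, rfl, rfl, h, hd, h0, h1, hx, hy⟩

/-- `t ↦ min (2 * t) 1`. -/
noncomputable def firstHalf : C(I, I) :=
  ⟨fun t => projIcc 0 1 zero_le_one (2 * (t : ℝ)), continuous_projIcc.comp (by fun_prop)⟩

/-- `t ↦ max (2 * t - 1) 0`. -/
noncomputable def secondHalf : C(I, I) :=
  ⟨fun t => projIcc 0 1 zero_le_one (2 * (t : ℝ) - 1), continuous_projIcc.comp (by fun_prop)⟩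

theorem monotone_firstHalf : Monotone firstHalf := fun s t h =>
  monotone_projIcc zero_le_one (by have : (s : ℝ) ≤ t := h; linarith)

theorem monotone_secondHalf : Monotone secondHalf := fun s t h =>
  monotone_projIcc zero_le_one (by have : (s : ℝ) ≤ t := h; linarith)

theorem secondHalf_le_firstHalf (t : I) : secondHalf t ≤ firstHalf t :=
  monotone_projIcc zero_le_one (by linarith)

theorem firstHalf_zero : firstHalf 0 = 0 := projIcc_of_le_left zero_le_one (by simp)

theorem firstHalf_one : firstHalf 1 = 1 := projIcc_of_right_le zero_le_one (by norm_num)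

theorem secondHalf_zero : secondHalf 0 = 0 := projIcc_of_le_left zero_le_one (by simp)

theorem secondHalf_one : secondHalf 1 = 1 := projIcc_of_right_le zero_le_one (by norm_num)

theorem trans_apply (p : Path x y) (q : Path y z) (t : I) : (p.trans q) t =
    if (t : ℝ) ≤ 1 / 2 then p (firstHalf t) else q (secondHalf t) := rfl

theorem secondHalf_of_le {t : I} (h : (t : ℝ) ≤ 1 / 2) : secondHalf t = 0 :=
  projIcc_of_le_left zero_le_one (by linarith)

theorem firstHalf_of_ge {t : I} (h : 1 / 2 ≤ (t : ℝ)) : firstHalf t = 1 :=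
  projIcc_of_right_le zero_le_one (by linarith)

/-- In a directed square, going along the bottom and up is homotopic to going along the
diagonal. -/
theorem IsDirectedSquare.homotopyClass_diag {h : C(I × I, X)} (hd : d.IsDirectedSquare h)
    (b : d.DirPath x y) (r : d.DirPath y z) (hb : ∀ u, h (u, 0) = b.1 u)
    (hr : ∀ u, h (1, u) = r.1 u) (m : d.DirPath x z) (hm : ∀ u, h (firstHalf u, firstHalf u) = m.1 u) :
    d.homotopyClass b ≫ d.homotopyClass r = d.homotopyClass m := by
  rw [← homotopyClass_trans]
  -- At height `0` this runs along the bottom and then up the right side, at height `1` along the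
  -- diagonal. Maxima and minima of monotone maps keep it monotone in both parameters.
  let k : C(I × I, I × I) :=
    ⟨fun z => (firstHalf z.1, max (secondHalf z.1) (min z.2 (firstHalf z.1))), by fun_prop⟩
  refine homotopyClass_eq (h.comp k) ?_ ?_ ?_ ?_ ?_
  · intro a a' ha ha'
    exact hd (firstHalf.comp a)
      ⟨fun t => max (secondHalf (a t)) (min (a' t) (firstHalf (a t))), by fun_prop⟩
      (monotone_firstHalf.comp ha)
      fun s t hst => max_le_max (monotone_secondHalf (ha hst))
        (min_le_min (ha' hst) (monotone_firstHalf (ha hst)))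
  · intro t
    change h (firstHalf t, max (secondHalf t) (min 0 (firstHalf t))) = (b.1.trans r.1) t
    rw [min_eq_left (show 0 ≤ firstHalf t from unitInterval.nonneg _),
      max_eq_left (show 0 ≤ secondHalf t from unitInterval.nonneg _), trans_apply]
    split_ifs with ht
    · rw [secondHalf_of_le ht, hb]
    · rw [firstHalf_of_ge (not_le.1 ht).le, hr]
  · intro t
    change h (firstHalf t, max (secondHalf t) (min 1 (firstHalf t))) = _
    rw [min_eq_right (show firstHalf t ≤ 1 from unitInterval.le_one _),
      max_eq_right (secondHalf_le_firstHalf t), hm]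
  · intro s
    change h (firstHalf 0, max (secondHalf 0) (min s (firstHalf 0))) = x
    rw [firstHalf_zero, secondHalf_zero, min_eq_right (show 0 ≤ s from unitInterval.nonneg _),
      max_self, hb, b.1.source]
  · intro s
    change h (firstHalf 1, max (secondHalf 1) (min s (firstHalf 1))) = z
    rw [firstHalf_one, secondHalf_one, max_eq_left (min_le_right _ _), hr, r.1.target]

/-- The boundary of a directed square commutes. -/
theorem IsDirectedSquare.comm {h : C(I × I, X)} (hd : d.IsDirectedSquare h)
    {b : d.DirPath x y} {r : d.DirPath y y'} {l : d.DirPath x x'} {t : d.DirPath x' y'}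
    (hb : ∀ u, h (u, 0) = b.1 u) (hr : ∀ u, h (1, u) = r.1 u) (hl : ∀ u, h (0, u) = l.1 u)
    (ht : ∀ u, h (u, 1) = t.1 u) :
    d.homotopyClass b ≫ d.homotopyClass r = d.homotopyClass l ≫ d.homotopyClass t := by
  let m : d.DirPath x y' := ⟨⟨h.comp (firstHalf.prodMk firstHalf), by
      change h (firstHalf 0, firstHalf 0) = x
      rw [firstHalf_zero, hb, b.1.source], by
      change h (firstHalf 1, firstHalf 1) = y'
      rw [firstHalf_one, hr, r.1.target]⟩,
    hd _ _ monotone_firstHalf monotone_firstHalf⟩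
  rw [hd.homotopyClass_diag b r hb hr m fun _ => rfl]
  have hd' : d.IsDirectedSquare (h.comp ⟨Prod.swap, continuous_swap⟩) := fun a a' ha ha' =>
    hd a' a ha' ha
  exact (hd'.homotopyClass_diag l t (fun u => hl u) (fun u => ht u) m fun _ => rfl).symm

/-- The directed path `p ∘ a` for weakly monotone `a`. -/
def along {p : C(I, X)} (hp : p ∈ d.dpaths) {a : C(I, I)} (ha : Monotone a) (hx : p (a 0) = x)
    (hy : p (a 1) = y) : d.DirPath x y :=
  ⟨⟨p.comp a, hx, hy⟩, d.reparam_mem p hp a ha⟩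

/-- A directed homotopy must move forward in its second parameter as well, and neither `a` nor `b`
need dominate the other. Both are deformed upwards to their maximum. -/
theorem homotopyClass_along_eq {p : C(I, X)} (hp : p ∈ d.dpaths) {a b : C(I, I)} (ha : Monotone a)
    (hb : Monotone b) (h0 : a 0 = b 0) (h1 : a 1 = b 1) (hx : p (a 0) = x) (hy : p (a 1) = y)
    (hx' : p (b 0) = x) (hy' : p (b 1) = y) :
    d.homotopyClass (along hp ha hx hy) = d.homotopyClass (along hp hb hx' hy') := by
  have key : ∀ {a b c : C(I, I)} (ha : Monotone a) (hb : Monotone b) (hc : Monotone c)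
      (_ : a 0 = b 0) (_ : a 1 = b 1) (hx : p (a 0) = x) (hy : p (a 1) = y) (hx' : p (c 0) = x)
      (hy' : p (c 1) = y), (∀ t, c t = max (a t) (b t)) →
      d.homotopyClass (along hp ha hx hy) = d.homotopyClass (along hp hc hx' hy') := by
    intro a b c ha hb hc h0 h1 hx hy hx' hy' e
    let k : C(I × I, I) := ⟨fun z => max (a z.1) (min z.2 (b z.1)), by fun_prop⟩
    refine homotopyClass_eq (p.comp k) ?_ ?_ ?_ ?_ ?_
    · intro f g hf hg
      exact d.reparam_mem p hp ⟨fun t => max (a (f t)) (min (g t) (b (f t))), by fun_prop⟩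
        fun s t hst => max_le_max (ha (hf hst)) (min_le_min (hg hst) (hb (hf hst)))
    · intro t
      change p (max (a t) (min 0 (b t))) = p (a t)
      rw [min_eq_left (show 0 ≤ b t from unitInterval.nonneg _),
        max_eq_left (show 0 ≤ a t from unitInterval.nonneg _)]
    · intro t
      change p (max (a t) (min 1 (b t))) = p (c t)
      rw [min_eq_right (show b t ≤ 1 from unitInterval.le_one _), e]
    · intro s
      change p (max (a 0) (min s (b 0))) = x
      rw [h0, max_eq_left (min_le_right _ _), ← h0, hx]
    · intro s
      change p (max (a 1) (min s (b 1))) = y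
      rw [h1, max_eq_left (min_le_right _ _), ← h1, hy]
  let c : C(I, I) := ⟨fun t => max (a t) (b t), by fun_prop⟩
  have hc : Monotone c := fun s t hst => max_le_max (ha hst) (hb hst)
  have c0 : c 0 = a 0 := by
    change max (a 0) (b 0) = a 0
    rw [h0, max_self]
  have c1 : c 1 = a 1 := by
    change max (a 1) (b 1) = a 1
    rw [h1, max_self]
  rw [key ha hb hc h0 h1 hx hy (by rw [c0, hx]) (by rw [c1, hy]) fun _ => rfl,
    key hb ha hc h0.symm h1.symm hx' hy' (by rw [c0, hx]) (by rw [c1, hy]) fun t => max_comm _ _]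

/-- The concatenation of `a` and `b` is itself a monotone path in the interval with the end points
of `c`. -/
theorem homotopyClass_along_comp {p : C(I, X)} (hp : p ∈ d.dpaths) {a b c : C(I, I)}
    (ha : Monotone a) (hb : Monotone b) (hc : Monotone c) (hab : a 1 = b 0) (h0 : c 0 = a 0)
    (h1 : c 1 = b 1) (hx : p (a 0) = x) (hy : p (a 1) = y) (hy' : p (b 0) = y) (hz : p (b 1) = z)
    (hx' : p (c 0) = x) (hz' : p (c 1) = z) :
    d.homotopyClass (along hp ha hx hy) ≫ d.homotopyClass (along hp hb hy' hz) =
      d.homotopyClass (along hp hc hx' hz') := by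
  let α : Path (a 0) (a 1) := ⟨a, rfl, rfl⟩
  let β : Path (a 1) (b 1) := ⟨b, hab.symm, rfl⟩
  let e : C(I, I) := (α.trans β).toContinuousMap
  have e_apply : ∀ t, e t = if (t : ℝ) ≤ 1 / 2 then a (firstHalf t) else b (secondHalf t) :=
    fun t => trans_apply α β t
  have he : Monotone e := by
    intro s t hst
    have hst' : (s : ℝ) ≤ t := hst
    rw [e_apply, e_apply]
    split_ifs with h1 h2 h2
    · exact ha (monotone_firstHalf hst)
    · exact (ha (unitInterval.le_one (firstHalf s))).trans
        (hab.le.trans (hb (unitInterval.nonneg (secondHalf t))))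
    · exact absurd (hst'.trans h2) h1
    · exact hb (monotone_secondHalf hst)
  have e0 : e 0 = a 0 := (α.trans β).source
  have e1 : e 1 = b 1 := (α.trans β).target
  rw [← homotopyClass_trans,
    homotopyClass_along_eq hp hc he (h0.trans e0.symm) (h1.trans e1.symm) hx' hz'
      (by rw [e0, hx]) (by rw [e1, hz])]
  congr 1
  refine Subtype.ext (Path.ext (funext fun t => ?_))
  change ((along hp ha hx hy).1.trans (along hp hb hy' hz).1) t = p (e t)
  rw [trans_apply, e_apply]
  split_ifs <;> rfl

end DSpace

namespace ManifoldWithDefect.DirectedTriangulation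

variable {n : ℕ} {X : Type*} [TopologicalSpace X] {M : ManifoldWithDefect n X}
  {T : M.DirectedTriangulation} {x y z w : X}

/-! ### Criteria for squares to be directed -/

theorem isDirectedSquare_of_bulk {h : C(I × I, X)} (hb : ∀ a, h a ∉ M.defect) :
    M.dSpace.IsDirectedSquare h := fun _ _ _ _ => isDirected_of_bulk fun _ => hb _

theorem isDirectedSquare_of_upper {h : C(I × I, X)}
    (hu : ∀ a b, a ≤ b → h a ∈ M.defect → h b ∈ M.defect)
    (hin : ∀ a, h a ∉ M.defect → ¬ T.Outb (T.car (h a))) : M.dSpace.IsDirectedSquare h :=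
  fun a b ha hb => isDirected_of_upper (T := T) (h.comp (a.prodMk b)).continuous
    (fun s t hst hd => hu (a s, b s) (a t, b t) ⟨ha hst, hb hst⟩ hd) fun _ hd => hin _ hd

theorem isDirectedSquare_of_lower {h : C(I × I, X)}
    (hu : ∀ a b, a ≤ b → h b ∈ M.defect → h a ∈ M.defect)
    (hout : ∀ a, h a ∉ M.defect → ¬ T.Inb (T.car (h a))) : M.dSpace.IsDirectedSquare h :=
  fun a b ha hb => isDirected_of_lower (T := T) (h.comp (a.prodMk b)).continuous
    (fun s t hst hd => hu (a s, b s) (a t, b t) ⟨ha hst, hb hst⟩ hd) fun _ hd => hout _ hd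

/-! ### Segments -/

theorem comb_mem_defect_iff {s : Finset (EuclideanSpace ℝ (Fin T.dim))} (hs : s ∈ T.K.faces)
    (hx : T.car x ⊆ s) (hy : T.car y ⊆ s) (t : I) :
    T.comb x y t ∈ M.defect ↔ (t < 1 → x ∈ M.defect) ∧ (0 < t → y ∈ M.defect) := by
  rcases (show (0 : I) ≤ t from unitInterval.nonneg t).eq_or_lt with rfl | h0
  · simp [comb_zero]
  · rcases (show t ≤ (1 : I) from unitInterval.le_one t).eq_or_lt with rfl | h1
    · simp [comb_one]
    · rw [comb_mem_defect hs hx hy h0 h1]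
      simp [h0, h1]

theorem Lin.isDirected (l : T.Lin x y) : M.IsDirected fun t : I => T.comb x y t := by
  obtain ⟨s, hs, hx, hy, hin, hout⟩ := l
  have hc := continuous_comb_unit hs hx hy
  have hm := comb_mem_defect_iff hs hx hy
  have hsub : ∀ t : I, T.car (T.comb x y t) ⊆ s := fun t => comb_subset hs hx hy t.2
  by_cases h1 : x ∈ M.defect <;> by_cases h2 : y ∈ M.defect
  · refine isDirected_of_upper (T := T) hc (fun a b _ _ => ?_) fun a ha => ?_
    · simp [hm, h1, h2]
    · simp [hm, h1, h2] at ha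
  · refine isDirected_of_lower (T := T) hc (fun a b hab => ?_) fun a _ =>
      (hout h1 h2).not_inb_face hs (T.car_mem _) (hsub a)
    simp only [hm, h1, h2, implies_true, true_and, imp_false, not_lt]
    exact hab.trans
  · refine isDirected_of_upper (T := T) hc (fun a b hab => ?_) fun a _ =>
      (hin h1 h2).not_outb_face hs (T.car_mem _) (hsub a)
    simp only [hm, h1, h2, implies_true, and_true, imp_false, not_lt]
    exact fun h => h.trans hab
  · refine isDirected_of_bulk fun t => ?_
    rw [hm]
    simp only [h1, h2, imp_false, not_lt, not_and_or, not_le]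
    rcases lt_or_ge t 1 with h | h
    · exact Or.inl h
    · exact Or.inr (zero_lt_one.trans_le h)

/-- The directed segment from `x` to `y`. -/
noncomputable def line (l : T.Lin x y) : M.dSpace.DirPath x y :=
  ⟨⟨⟨fun t : I => T.comb x y t, by
      obtain ⟨s, hs, hx, hy, -⟩ := l
      exact continuous_comb_unit hs hx hy⟩,
    by simp [comb_zero], by simp [comb_one]⟩, l.isDirected⟩

theorem homotopyClass_line_self (l : T.Lin x x) :
    M.dSpace.homotopyClass (line l) = 𝟙 (M.dSpace.fundObj x) :=
  DSpace.homotopyClass_eq_id fun _ => comb_self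

/-- The square formed by the segments from the points of a path to a point. -/
noncomputable def coneSquare (q : C(I, X)) (z : X)
    (h : ∀ u, ∃ s ∈ T.K.faces, T.car (q u) ⊆ s ∧ T.car z ⊆ s) : C(I × I, X) :=
  ⟨fun a => T.comb (q a.1) z a.2, continuous_comb (by fun_prop) continuous_const
    (continuous_subtype_val.comp continuous_snd) (fun a => a.2.2) fun a => h a.1⟩

/-- The square of segments from the points of the first edge to `z` has the three edges and a
constant path as sides. It is directed because the simplex is not both inbound and outbound, which
excludes the patterns bulk, defect, bulk and defect, bulk, defect. -/
theorem homotopyClass_triangle {s : Finset (EuclideanSpace ℝ (Fin T.dim))} (hs : s ∈ T.K.faces)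
    (hx : T.car x ⊆ s) (hy : T.car y ⊆ s) (hz : T.car z ⊆ s) (lxy : T.Lin x y) (lyz : T.Lin y z)
    (lxz : T.Lin x z) :
    M.dSpace.homotopyClass (line lxy) ≫ M.dSpace.homotopyClass (line lyz) =
      M.dSpace.homotopyClass (line lxz) := by
  have hq : ∀ u : I, T.car (T.comb x y u) ⊆ s := fun u => comb_subset hs hx hy u.2
  let h : C(I × I, X) := coneSquare (T := T) (line lxy).1.toContinuousMap z
    fun u => ⟨s, hs, hq u, hz⟩
  have hsub : ∀ a : I × I, T.car (h a) ⊆ s := fun a => comb_subset hs (hq a.1) hz a.2.2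
  have hm : ∀ a : I × I, h a ∈ M.defect ↔
      (a.2 < 1 → (a.1 < 1 → x ∈ M.defect) ∧ (0 < a.1 → y ∈ M.defect)) ∧
        (0 < a.2 → z ∈ M.defect) := fun a => by
    rw [← comb_mem_defect_iff hs hx hy]
    exact comb_mem_defect_iff hs (hq a.1) hz a.2
  have hd : M.dSpace.IsDirectedSquare h := by
    by_cases hzd : z ∈ M.defect
    · refine isDirectedSquare_of_upper (T := T) (fun a b hab => ?_) fun a ha => ?_
      · rw [hm, hm]
        simp only [hzd, implies_true, and_true]
        intro h hb
        obtain ⟨h1, h2⟩ := h (hab.2.trans_lt hb)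
        refine ⟨fun hb' => h1 (hab.1.trans_lt hb'), fun hb' => ?_⟩
        by_contra hyd
        have hxd := h1 (lt_of_not_ge fun h => hyd (h2 (zero_lt_one.trans_le h)))
        exact (lyz.inb hs hy hz hyd hzd).not_outb hs (lxy.outb hs hx hy hxd hyd)
      · have hin : T.Inb s := by
          by_cases hxd : x ∈ M.defect
          · by_cases hyd : y ∈ M.defect
            · simp [hm, hxd, hyd, hzd] at ha
            · exact lyz.inb hs hy hz hyd hzd
          · exact lxz.inb hs hx hz hxd hzd
        exact hin.not_outb_face hs (T.car_mem _) (hsub a)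
    · by_cases hxd : x ∈ M.defect
      · refine isDirectedSquare_of_lower (T := T) (fun a b hab => ?_) fun a _ =>
          (lxz.outb hs hx hz hxd hzd).not_inb_face hs (T.car_mem _) (hsub a)
        rw [hm, hm]
        simp only [hxd, hzd, implies_true, true_and, imp_false, not_lt]
        rintro ⟨h1, h2⟩
        refine ⟨fun _ ha => h1 (h2.trans_lt zero_lt_one) (ha.trans_le hab.1), hab.2.trans h2⟩
      · have hyd : y ∉ M.defect := fun hyd =>
          (lxy.inb hs hx hy hxd hyd).not_outb hs (lyz.outb hs hy hz hyd hzd)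
        refine isDirectedSquare_of_bulk fun a => ?_
        rw [hm]
        simp only [hxd, hyd, hzd, imp_false, not_lt]
        rintro ⟨h1, h2⟩
        obtain ⟨h3, h4⟩ := h1 (h2.trans_lt zero_lt_one)
        exact absurd (h3.trans h4) (not_le.2 zero_lt_one)
  have := hd.comm (b := line lxy) (r := line lyz) (l := line lxz) (t := DSpace.DirPath.refl _ z)
    (fun u => comb_zero) (fun u => ?_) (fun u => ?_) (fun u => comb_one)
  · rw [this, DSpace.homotopyClass_refl, Category.comp_id]
  · change T.comb (T.comb x y (1 : I)) z u = T.comb y z u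
    rw [Icc.coe_one, comb_one]
  · change T.comb (T.comb x y (0 : I)) z u = T.comb x z u
    rw [Icc.coe_zero, comb_zero]

/-- Just after a defect point a directed path can enter only outbound simplices, whereas its bulk
points are assumed to lie in inbound ones. -/
theorem mem_defect_of_in {q : I → X} (hq : Continuous q) (hd : M.IsDirected q)
    (h : ∀ u, T.In (q u) w) {u v : I} (huv : u ≤ v) (hu : q u ∈ M.defect) : q v ∈ M.defect := by
  refine unitInterval.rel_of_local (P := fun u v => q u ∈ M.defect → q v ∈ M.defect)
    (fun _ _ _ _ _ h1 h2 h => h2 (h1 h)) (fun r => ?_) huv hu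
  by_cases hr : q r ∈ M.defect
  · obtain ⟨N, hN, hs⟩ := T.exists_isSmall (q r)
    filter_upwards [unitInterval.eventually_uIcc (hq.continuousAt.eventually hN)] with a ha
    refine ⟨fun _ _ => hr, fun hra _ => ?_⟩
    by_contra hd'
    rw [uIcc_of_ge hra] at ha
    have ho := (hs.in_out hq hd ha hra).2 (Out.refl _)
    exact ((h a).2 (mem_defect_of_car_subset (h r).1 hr) hd').not_outb (T.car_mem _)
      (ho.2 hr hd')
  · filter_upwards [hq.continuousAt.eventually (M.isClosed_defect.isOpen_compl.mem_nhds hr)] with a ha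
    exact ⟨fun _ h => absurd h ha, fun _ h => absurd h hr⟩

theorem mem_defect_of_out {q : I → X} (hq : Continuous q) (hd : M.IsDirected q)
    (h : ∀ u, T.Out (q u) w) {u v : I} (huv : u ≤ v) (hv : q v ∈ M.defect) : q u ∈ M.defect := by
  refine unitInterval.rel_of_local (P := fun u v => q v ∈ M.defect → q u ∈ M.defect)
    (fun _ _ _ _ _ h1 h2 h => h1 (h2 h)) (fun r => ?_) huv hv
  by_cases hr : q r ∈ M.defect
  · obtain ⟨N, hN, hs⟩ := T.exists_isSmall (q r)
    filter_upwards [unitInterval.eventually_uIcc (hq.continuousAt.eventually hN)] with a ha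
    refine ⟨fun hra _ => ?_, fun _ _ => hr⟩
    by_contra hd'
    rw [uIcc_of_le hra] at ha
    have hi := (hs.in_out hq hd ha hra).1 (In.refl _)
    exact (hi.2 hr hd').not_outb (T.car_mem _)
      ((h a).2 (mem_defect_of_car_subset (h r).1 hr) hd')
  · filter_upwards [hq.continuousAt.eventually (M.isClosed_defect.isOpen_compl.mem_nhds hr)] with a ha
    exact ⟨fun _ h => absurd h hr, fun _ h => absurd h ha⟩

/-- A directed path in the arriving side of the star of its end point is homotopic to a segment. -/
theorem homotopyClass_of_in (q : M.dSpace.DirPath x y) (h : ∀ u, T.In (q.1 u) y) (l : T.Lin x y) :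
    M.dSpace.homotopyClass q = M.dSpace.homotopyClass (line l) := by
  -- The path is pushed along segments into `y`: the left side of the square is the segment from
  -- `x`, the top and right sides are constant.
  let f : C(I × I, X) := coneSquare (T := T) q.1.toContinuousMap y
    fun u => ⟨_, T.car_mem _, subset_rfl, (h u).1⟩
  have hsub : ∀ a : I × I, T.car (f a) ⊆ T.car (q.1 a.1) := fun a =>
    comb_subset (T.car_mem _) subset_rfl (h a.1).1 a.2.2
  have hm : ∀ a : I × I, f a ∈ M.defect ↔
      (a.2 < 1 → q.1 a.1 ∈ M.defect) ∧ (0 < a.2 → y ∈ M.defect) := fun a =>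
    comb_mem_defect_iff (T.car_mem (q.1 a.1)) subset_rfl (h a.1).1 a.2
  have hd : M.dSpace.IsDirectedSquare f := by
    by_cases hy : y ∈ M.defect
    · refine isDirectedSquare_of_upper (T := T) (fun a b hab => ?_) fun a ha => ?_
      · rw [hm, hm]
        simp only [hy, implies_true, and_true]
        exact fun k hb => mem_defect_of_in q.1.continuous q.2 h hab.1 (k (hab.2.trans_lt hb))
      · have : q.1 a.1 ∉ M.defect := fun hqd => ha ((hm a).2 ⟨fun _ => hqd, fun _ => hy⟩)
        exact ((h a.1).2 hy this).not_outb_face (T.car_mem _) (T.car_mem _) (hsub a)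
    · refine isDirectedSquare_of_bulk fun a ha => ?_
      have hq : q.1 a.1 ∉ M.defect := fun hqd => hy (mem_defect_of_car_subset (h a.1).1 hqd)
      rw [hm] at ha
      simp only [hq, hy, imp_false, not_lt] at ha
      exact absurd (ha.1.trans ha.2) (not_le.2 zero_lt_one)
  have := hd.comm (b := q) (r := DSpace.DirPath.refl _ y) (l := line l)
    (t := DSpace.DirPath.refl _ y) (fun u => comb_zero) (fun u => ?_) (fun u => ?_)
    (fun u => comb_one)
  · rwa [DSpace.homotopyClass_refl, Category.comp_id, Category.comp_id] at this
  · change T.comb (q.1 1) y u = y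
    rw [q.1.target, comb_self]
  · change T.comb (q.1 0) y u = T.comb x y u
    rw [q.1.source]

/-- A directed path in the departing side of the star of its source is homotopic to a segment. -/
theorem homotopyClass_of_out (q : M.dSpace.DirPath x y) (h : ∀ u, T.Out (q.1 u) x)
    (l : T.Lin x y) : M.dSpace.homotopyClass q = M.dSpace.homotopyClass (line l) := by
  let f : C(I × I, X) := ⟨fun a => T.comb x (q.1 a.1) a.2, continuous_comb continuous_const
    (by fun_prop) (continuous_subtype_val.comp continuous_snd) (fun a => a.2.2)
    fun a => ⟨_, T.car_mem _, (h a.1).1, subset_rfl⟩⟩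
  have hsub : ∀ a : I × I, T.car (f a) ⊆ T.car (q.1 a.1) := fun a =>
    comb_subset (T.car_mem _) (h a.1).1 subset_rfl a.2.2
  have hm : ∀ a : I × I, f a ∈ M.defect ↔
      (a.2 < 1 → x ∈ M.defect) ∧ (0 < a.2 → q.1 a.1 ∈ M.defect) := fun a =>
    comb_mem_defect_iff (T.car_mem (q.1 a.1)) (h a.1).1 subset_rfl a.2
  have hd : M.dSpace.IsDirectedSquare f := by
    by_cases hx : x ∈ M.defect
    · refine isDirectedSquare_of_lower (T := T) (fun a b hab => ?_) fun a ha => ?_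
      · rw [hm, hm]
        simp only [hx, implies_true, true_and]
        exact fun k ha => mem_defect_of_out q.1.continuous q.2 h hab.1 (k (ha.trans_le hab.2))
      · have : q.1 a.1 ∉ M.defect := fun hqd => ha ((hm a).2 ⟨fun _ => hx, fun _ => hqd⟩)
        exact ((h a.1).2 hx this).not_inb_face (T.car_mem _) (T.car_mem _) (hsub a)
    · refine isDirectedSquare_of_bulk fun a ha => ?_
      have hq : q.1 a.1 ∉ M.defect := fun hqd => hx (mem_defect_of_car_subset (h a.1).1 hqd)
      rw [hm] at ha
      simp only [hq, hx, imp_false, not_lt] at ha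
      exact absurd (ha.1.trans ha.2) (not_le.2 zero_lt_one)
  have := hd.comm (b := DSpace.DirPath.refl _ x) (r := line l) (l := DSpace.DirPath.refl _ x)
    (t := q) (fun u => comb_zero) (fun u => ?_) (fun u => ?_) (fun u => comb_one)
  · rw [DSpace.homotopyClass_refl, Category.id_comp, Category.id_comp] at this
    exact this.symm
  · change T.comb x (q.1 1) u = T.comb x y u
    rw [q.1.target]
  · change T.comb x (q.1 0) u = x
    rw [q.1.source, comb_self]

variable (T) in
/-- The classes of the directed segments. -/
noncomputable def univCocycle : T.Cocycle M.dSpace.FundamentalCategory where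
  obj x := M.dSpace.fundObj x
  map l := M.dSpace.homotopyClass (line l)
  map_self := homotopyClass_line_self
  map_comp hs hx hy hz hxy hyz hxz := homotopyClass_triangle hs hx hy hz hxy hyz hxz

/-- Chains of short segments along a path represent the class of the path. -/
theorem Cocycle.Tr.eq_homotopyClass_along {p : C(I, X)} (hp : p ∈ M.dSpace.dpaths) {s t : I}
    {g : (univCocycle T).obj x ⟶ (univCocycle T).obj y} (h : (univCocycle T).Tr p s t x y g)
    {a : C(I, I)} (ha : Monotone a) (a0 : a 0 = s) (a1 : a 1 = t) (hx : p (a 0) = x)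
    (hy : p (a 1) = y) : g = M.dSpace.homotopyClass (DSpace.along hp ha hx hy) := by
  induction h generalizing a with
  | @arrive s t x y hst hx' hy' h l =>
    have hu : ∀ u, T.In (p (a u)) y := fun u =>
      h (a u) ⟨a0 ▸ ha (unitInterval.nonneg u), a1 ▸ ha (unitInterval.le_one u)⟩
    exact (homotopyClass_of_in (DSpace.along hp ha hx hy) hu l).symm
  | @depart s t x y hst hx' hy' h l =>
    have hu : ∀ u, T.Out (p (a u)) x := fun u =>
      h (a u) ⟨a0 ▸ ha (unitInterval.nonneg u), a1 ▸ ha (unitInterval.le_one u)⟩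
    exact (homotopyClass_of_out (DSpace.along hp ha hx hy) hu l).symm
  | @comp s u t x y z g g' h h' ih ih' =>
    -- Any monotone parametrization of the two subintervals will do, since the class along `p`
    -- depends only on the end times.
    have clamp : ∀ {s t : I}, s ≤ t → ∃ b : C(I, I), Monotone b ∧ b 0 = s ∧ b 1 = t := by
      intro s t hst
      refine ⟨⟨fun r => max s (min t r), by fun_prop⟩,
        fun _ _ h => max_le_max le_rfl (min_le_min le_rfl h), ?_, ?_⟩
      · exact max_eq_left ((min_le_right _ _).trans (unitInterval.nonneg _))
      · change max s (min t 1) = t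
        rw [min_eq_left (show t ≤ 1 from unitInterval.le_one t), max_eq_right hst]
    obtain ⟨b, hb, b0, b1⟩ := clamp h.le
    obtain ⟨b', hb', b0', b1'⟩ := clamp h'.le
    have hbx : p (b 0) = x := by rw [b0, h.source]
    have hby : p (b 1) = y := by rw [b1, h.target]
    have hby' : p (b' 0) = y := by rw [b0', h'.source]
    have hbz : p (b' 1) = z := by rw [b1', h'.target]
    rw [ih hb b0 b1 hbx hby, ih' hb' b0' b1' hby' hbz]
    exact DSpace.homotopyClass_along_comp hp hb hb' ha (b1.trans b0'.symm) (a0.trans b0.symm)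
      (a1.trans b1'.symm) _ _ _ _ _ _

theorem Cocycle.Tr.eq_homotopyClass {p : M.dSpace.DirPath x y}
    {g : (univCocycle T).obj x ⟶ (univCocycle T).obj y} (h : (univCocycle T).Tr p.1 0 1 x y g) :
    g = M.dSpace.homotopyClass p :=
  Cocycle.Tr.eq_homotopyClass_along (p := p.1.toContinuousMap) p.2 h (a := ContinuousMap.id I)
    monotone_id rfl rfl p.1.source p.1.target

end ManifoldWithDefect.DirectedTriangulation

/-! ### Equality of arrows -/

namespace CategoryTheory

theorem Arrow.mk_eq_cases {C : Type*} [Category C] {a b a' b' : C} {f : a ⟶ b} {f' : a' ⟶ b'}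
    (h : Arrow.mk f = Arrow.mk f') : ∃ (_ : a = a') (_ : b = b'), HEq f f' := by
  have h1 : a = a' := congrArg Comma.left h
  have h2 : b = b' := congrArg Comma.right h
  subst h1 h2
  exact ⟨rfl, rfl, heq_of_eq (Arrow.mk_injective _ _ h)⟩

theorem Arrow.mk_comp_congr {C : Type*} [Category C] {a b c a' b' c' : C} {f : a ⟶ b} {g : b ⟶ c}
    {f' : a' ⟶ b'} {g' : b' ⟶ c'} (hf : Arrow.mk f = Arrow.mk f') (hg : Arrow.mk g = Arrow.mk g') :
    Arrow.mk (f ≫ g) = Arrow.mk (f' ≫ g') := by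
  obtain ⟨rfl, rfl, hf⟩ := Arrow.mk_eq_cases hf
  obtain ⟨-, rfl, hg⟩ := Arrow.mk_eq_cases hg
  rw [eq_of_heq hf, eq_of_heq hg]

theorem comp_split_iso {C : Type*} [Category C] {a b c d e f : C} (u : a ⟶ b) (g : b ⟶ c)
    (g' : c ⟶ d) (v : d ⟶ e) (k : c ≅ f) :
    u ≫ (g ≫ g') ≫ v = (u ≫ g ≫ k.hom) ≫ (k.inv ≫ g' ≫ v) := by simp

theorem Functor.ext_of_arrow {C D : Type*} [Category C] [Category D] {F G : C ⥤ D}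
    (h : ∀ {x y : C} (f : x ⟶ y), Arrow.mk (F.map f) = Arrow.mk (G.map f)) : F = G :=
  Functor.hext (fun x => (Arrow.mk_eq_cases (h (𝟙 x))).1)
    fun _ _ f => (Arrow.mk_eq_cases (h f)).2.2

end CategoryTheory

/-! ### The standard cocycle with values in the path category -/

namespace Gamma2

/-- The shortest arrow between two objects of the path category. -/
def std : ∀ k l : Gamma2, (Paths.of Gamma2).obj k ⟶ (Paths.of Gamma2).obj l
  | .beta, .beta => 𝟙 _
  | .delta, .delta => 𝟙 _
  | .beta, .delta => arrIota
  | .delta, .beta => arrOmega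

theorem std_self (k : Gamma2) : std k k = 𝟙 _ := by cases k <;> rfl

/-- The excluded triples are exactly those in which a composition of shortest arrows is not
shortest. -/
theorem std_comp (k m l : Gamma2) (h : k = .beta → m = .delta → l ≠ .beta)
    (h' : k = .delta → m = .beta → l ≠ .delta) : std k m ≫ std m l = std k l := by
  cases k <;> cases m <;> cases l <;> first | rfl | exact absurd rfl (h rfl rfl) |
    exact absurd rfl (h' rfl rfl)

end Gamma2

open Gamma2

namespace ManifoldWithDefect

variable {n : ℕ} {X : Type*} [TopologicalSpace X] {M : ManifoldWithDefect n X}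

open Classical in
variable (M) in
/-- The object of the path category to which a point belongs. -/
noncomputable def kind (x : X) : Gamma2 := if x ∈ M.defect then .delta else .beta

theorem kind_of_mem {x : X} (h : x ∈ M.defect) : M.kind x = .delta := if_pos h

theorem kind_of_notMem {x : X} (h : x ∉ M.defect) : M.kind x = .beta := if_neg h

theorem kind_eq_delta {x : X} : M.kind x = .delta ↔ x ∈ M.defect := by
  by_cases h : x ∈ M.defect <;> simp [kind, h]

theorem kind_eq_beta {x : X} : M.kind x = .beta ↔ x ∉ M.defect := by
  by_cases h : x ∈ M.defect <;> simp [kind, h]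

theorem arrow_std_bulk {x y : X} (hx : x ∉ M.defect) (hy : y ∉ M.defect) :
    Arrow.mk (std (M.kind x) (M.kind y)) = Arrow.mk (𝟙 objBeta) := by
  rw [kind_of_notMem hx, kind_of_notMem hy]
  rfl

theorem arrow_std_defect {x y : X} (hx : x ∈ M.defect) (hy : y ∈ M.defect) :
    Arrow.mk (std (M.kind x) (M.kind y)) = Arrow.mk (𝟙 objDelta) := by
  rw [kind_of_mem hx, kind_of_mem hy]
  rfl

theorem arrow_std_inbound {x y : X} (hx : x ∉ M.defect) (hy : y ∈ M.defect) :
    Arrow.mk (std (M.kind x) (M.kind y)) = Arrow.mk arrIota := by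
  rw [kind_of_notMem hx, kind_of_mem hy]
  rfl

theorem arrow_std_outbound {x y : X} (hx : x ∈ M.defect) (hy : y ∉ M.defect) :
    Arrow.mk (std (M.kind x) (M.kind y)) = Arrow.mk arrOmega := by
  rw [kind_of_mem hx, kind_of_notMem hy]
  rfl

/-- The path does not leave the defect. -/
def UpperPath (M : ManifoldWithDefect n X) (p : I → X) : Prop :=
  ∀ s t, s ≤ t → p s ∈ M.defect → p t ∈ M.defect

/-- The path does not enter the defect. -/
def LowerPath (M : ManifoldWithDefect n X) (p : I → X) : Prop :=
  ∀ s t, s ≤ t → p t ∈ M.defect → p s ∈ M.defect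

/-- The path stays in the bulk or in the defect. -/
def PurePath (M : ManifoldWithDefect n X) (p : I → X) : Prop :=
  (∀ t, p t ∈ M.defect) ∨ ∀ t, p t ∉ M.defect

theorem PurePath.upper {p : I → X} (h : M.PurePath p) : M.UpperPath p := by
  rcases h with h | h
  · exact fun _ t _ _ => h t
  · exact fun s _ _ hs => absurd hs (h s)

theorem PurePath.lower {p : I → X} (h : M.PurePath p) : M.LowerPath p := by
  rcases h with h | h
  · exact fun s _ _ _ => h s
  · exact fun _ t _ ht => absurd ht (h t)

theorem UpperPath.trans {x y z : X} {p : Path x y} {q : Path y z} (hp : M.UpperPath p)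
    (hq : M.UpperPath q) : M.UpperPath (p.trans q) := by
  intro s t hst
  have hst' : (s : ℝ) ≤ t := hst
  rw [DSpace.trans_apply, DSpace.trans_apply]
  split_ifs with h1 h2 h2
  · exact hp _ _ (DSpace.monotone_firstHalf hst)
  · intro h
    have := hp _ 1 (unitInterval.le_one _) h
    rw [p.target] at this
    exact hq 0 _ (unitInterval.nonneg _) (by rwa [q.source])
  · exact absurd (hst'.trans h2) h1
  · exact hq _ _ (DSpace.monotone_secondHalf hst)

theorem LowerPath.trans {x y z : X} {p : Path x y} {q : Path y z} (hp : M.LowerPath p)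
    (hq : M.LowerPath q) : M.LowerPath (p.trans q) := by
  intro s t hst
  have hst' : (s : ℝ) ≤ t := hst
  rw [DSpace.trans_apply, DSpace.trans_apply]
  split_ifs with h1 h2 h2
  · exact hp _ _ (DSpace.monotone_firstHalf hst)
  · exact absurd (hst'.trans h1) h2
  · intro h
    have := hq 0 _ (unitInterval.nonneg _) h
    rw [q.source] at this
    exact hp _ 1 (unitInterval.le_one _) (by rwa [p.target])
  · exact hq _ _ (DSpace.monotone_secondHalf hst)

namespace DirectedTriangulation

variable (T : M.DirectedTriangulation) {x y z : X}

/-- The cocycle that counts the passages between bulk and defect. -/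
noncomputable def stdCocycle : T.Cocycle (Paths Gamma2) where
  obj x := (Paths.of Gamma2).obj (M.kind x)
  map {x y} _ := std (M.kind x) (M.kind y)
  map_self _ := std_self _
  map_comp {x y z s} hs hx hy hz hxy hyz _ := by
    -- Either excluded pattern would make the simplex inbound and outbound at once.
    refine std_comp _ _ _ (fun h1 h2 h3 => ?_) fun h1 h2 h3 => ?_
    · rw [kind_eq_beta] at h1 h3
      rw [kind_eq_delta] at h2
      exact (hxy.inb hs hx hy h1 h2).not_outb hs (hyz.outb hs hy hz h2 h3)
    · rw [kind_eq_delta] at h1 h3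
      rw [kind_eq_beta] at h2
      exact (hyz.inb hs hy hz h2 h3).not_outb hs (hxy.outb hs hx hy h1 h2)

variable {T}

/-- A path that does not leave the defect changes kind at most once, so the intermediate points of
the chain never produce an excluded triple. -/
theorem tr_std_of_upper {p : I → X} (hp : M.UpperPath p) {s t : I}
    {g : (stdCocycle T).obj x ⟶ (stdCocycle T).obj y} (h : (stdCocycle T).Tr p s t x y g) :
    g = std (M.kind x) (M.kind y) := by
  induction h with
  | arrive | depart => rfl
  | @comp s u t x y z g g' h h' ih ih' =>
    rw [ih, ih']
    have h1 := hp s u h.le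
    have h2 := hp u t h'.le
    rw [h.source, h.target] at h1
    rw [h.target, h'.target] at h2
    refine std_comp _ _ _ (fun _ e2 e3 => ?_) fun e1 e2 _ => ?_
    · rw [kind_eq_delta] at e2
      rw [kind_eq_beta] at e3
      exact e3 (h2 e2)
    · rw [kind_eq_delta] at e1
      rw [kind_eq_beta] at e2
      exact e2 (h1 e1)

theorem tr_std_of_lower {p : I → X} (hp : M.LowerPath p) {s t : I}
    {g : (stdCocycle T).obj x ⟶ (stdCocycle T).obj y} (h : (stdCocycle T).Tr p s t x y g) :
    g = std (M.kind x) (M.kind y) := by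
  induction h with
  | arrive | depart => rfl
  | @comp s u t x y z g g' h h' ih ih' =>
    rw [ih, ih']
    have h1 := hp s u h.le
    have h2 := hp u t h'.le
    rw [h.source, h.target] at h1
    rw [h.target, h'.target] at h2
    refine std_comp _ _ _ (fun e1 e2 _ => ?_) fun _ e2 e3 => ?_
    · rw [kind_eq_delta] at e2
      rw [kind_eq_beta] at e1
      exact e1 (h1 e2)
    · rw [kind_eq_delta] at e3
      rw [kind_eq_beta] at e2
      exact e2 (h2 e3)

theorem std_map_of_upper_or_lower (p : M.dSpace.DirPath x y)
    (h : M.UpperPath p.1 ∨ M.LowerPath p.1) :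
    (stdCocycle T).functor.map (M.dSpace.homotopyClass p) = std (M.kind x) (M.kind y) := by
  rcases h with h | h
  · exact tr_std_of_upper h ((stdCocycle T).tr_transport p)
  · exact tr_std_of_lower h ((stdCocycle T).tr_transport p)

theorem Lin.upper_or_lower (l : T.Lin x y) :
    M.UpperPath (line l).1 ∨ M.LowerPath (line l).1 := by
  obtain ⟨s, hs, hx, hy, -⟩ := id l
  have hm : ∀ t, (line l).1 t ∈ M.defect ↔ _ := comb_mem_defect_iff hs hx hy
  by_cases h1 : x ∈ M.defect
  · right
    intro a b hab
    rw [hm, hm]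
    exact fun h => ⟨fun _ => h1, fun h' => h.2 (h'.trans_le hab)⟩
  · left
    intro a b hab
    rw [hm, hm]
    refine fun h => ⟨fun h' => h.1 (hab.trans_lt h'), fun _ => ?_⟩
    rcases lt_or_ge a 1 with ha | ha
    · exact absurd (h.1 ha) h1
    · exact h.2 (zero_lt_one.trans_le ha)

/-! ### Paths inside strata -/

section Strata

variable {A : Set X}

theorem isDirected_of_pure (T : M.DirectedTriangulation)
    {p : I → X} (hp : Continuous p) (h : M.PurePath p) : M.IsDirected p := by
  rcases h with h | h
  · exact isDirected_of_upper (T := T) hp (fun _ t _ _ => h t) fun t ht => absurd (h t) ht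
  · exact isDirected_of_bulk h

/-- A path in the defect or in the bulk as a directed path. -/
def incl (T : M.DirectedTriangulation)
    (hA : A ⊆ M.defect ∨ A ⊆ M.defectᶜ) {a b : ↥A} (γ : Path a b) :
    M.dSpace.DirPath a.1 b.1 :=
  ⟨γ.map continuous_subtype_val, isDirected_of_pure T (γ.map continuous_subtype_val).continuous
    (hA.imp (fun h t => h (γ t).2) fun h t => h (γ t).2)⟩

theorem incl_pure (T : M.DirectedTriangulation)
    (hA : A ⊆ M.defect ∨ A ⊆ M.defectᶜ) {a b : ↥A} (γ : Path a b) :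
    M.PurePath (incl T hA γ).1 := hA.imp (fun h t => h (γ t).2) fun h t => h (γ t).2

theorem homotopyClass_incl_eq (T : M.DirectedTriangulation)
    (hA : A ⊆ M.defect ∨ A ⊆ M.defectᶜ) {a b : ↥A} {γ γ' : Path a b}
    (h : γ.Homotopic γ') :
    M.dSpace.homotopyClass (incl T hA γ) = M.dSpace.homotopyClass (incl T hA γ') := by
  obtain ⟨F⟩ := h
  -- The coordinates are interchanged because the homotopy parameter of `F` comes first. Any square
  -- inside the bulk or the defect is directed.
  refine DSpace.homotopyClass_eq ⟨fun z => (F (z.2, z.1)).1, by fun_prop⟩ ?_ ?_ ?_ ?_ ?_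
  · intro f g _ _
    exact isDirected_of_pure T (by fun_prop)
      (hA.imp (fun h t => h (F (g t, f t)).2) fun h t => h (F (g t, f t)).2)
  · intro t
    exact congrArg Subtype.val (F.apply_zero t)
  · intro t
    exact congrArg Subtype.val (F.apply_one t)
  · intro s
    exact congrArg Subtype.val (F.source s)
  · intro s
    exact congrArg Subtype.val (F.target s)

theorem homotopyClass_incl_trans (T : M.DirectedTriangulation)
    (hA : A ⊆ M.defect ∨ A ⊆ M.defectᶜ) {a b c : ↥A} (γ : Path a b)
    (γ' : Path b c) : M.dSpace.homotopyClass (incl T hA γ) ≫ M.dSpace.homotopyClass (incl T hA γ') =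
      M.dSpace.homotopyClass (incl T hA (γ.trans γ')) := by
  rw [← DSpace.homotopyClass_trans]
  congr 1
  exact Subtype.ext (γ.map_trans γ' continuous_subtype_val).symm

theorem homotopyClass_incl_refl (T : M.DirectedTriangulation)
    (hA : A ⊆ M.defect ∨ A ⊆ M.defectᶜ) (a : ↥A) :
    M.dSpace.homotopyClass (incl T hA (Path.refl a)) = 𝟙 (M.dSpace.fundObj a.1) :=
  DSpace.homotopyClass_eq_id fun _ => rfl

/-- A path in the defect or in the bulk gives an isomorphism. -/
noncomputable def inclIso (T : M.DirectedTriangulation)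
    (hA : A ⊆ M.defect ∨ A ⊆ M.defectᶜ) {a b : ↥A} (γ : Path a b) :
    M.dSpace.fundObj a.1 ≅ M.dSpace.fundObj b.1 where
  hom := M.dSpace.homotopyClass (incl T hA γ)
  inv := M.dSpace.homotopyClass (incl T hA γ.symm)
  hom_inv_id := by
    rw [homotopyClass_incl_trans, ← homotopyClass_incl_refl T hA]
    exact homotopyClass_incl_eq T hA ⟨(Path.Homotopy.reflTransSymm γ).symm⟩
  inv_hom_id := by
    rw [homotopyClass_incl_trans, ← homotopyClass_incl_refl T hA]
    exact homotopyClass_incl_eq T hA ⟨(Path.Homotopy.reflSymmTrans γ).symm⟩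

/-- Points of the same stratum are isomorphic. -/
theorem exists_iso (T : M.DirectedTriangulation)
    (h : M.stratumOf x = M.stratumOf y) :
    ∃ (k : M.dSpace.fundObj x ≅ M.dSpace.fundObj y) (p : M.dSpace.DirPath x y)
      (q : M.dSpace.DirPath y x), k.hom = M.dSpace.homotopyClass p ∧
        k.inv = M.dSpace.homotopyClass q ∧ M.PurePath p.1 ∧ M.PurePath q.1 := by
  have key : ∀ {A : Set X} (hA : A ⊆ M.defect ∨ A ⊆ M.defectᶜ) [LocallyPathConnectedSpace ↥A]
      (a b : ↥A), ConnectedComponents.mk a = ConnectedComponents.mk b →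
      ∃ (k : M.dSpace.fundObj a.1 ≅ M.dSpace.fundObj b.1) (p : M.dSpace.DirPath a.1 b.1)
        (q : M.dSpace.DirPath b.1 a.1), k.hom = M.dSpace.homotopyClass p ∧
        k.inv = M.dSpace.homotopyClass q ∧ M.PurePath p.1 ∧ M.PurePath q.1 := by
    intro A hA _ a b hab
    -- In a locally path-connected space components are path components; bulk and defect are such
    -- spaces as topological manifolds.
    have hj : Joined a b := by
      rw [ConnectedComponents.coe_eq_coe'] at hab
      have : a ∈ pathComponent b := by rwa [pathComponent_eq_connectedComponent]
      exact Joined.symm this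
    obtain ⟨γ⟩ := hj
    exact ⟨inclIso T hA γ, _, _, rfl, rfl, incl_pure T hA γ, incl_pure T hA γ.symm⟩
  obtain ⟨hb⟩ := M.bulk_manifold
  obtain ⟨hd⟩ := M.defect_manifold
  have : LocallyPathConnectedSpace ↥(M.defectᶜ) :=
    ChartedSpace.locallyPathConnectedSpace (Fin (n + 1) → ℝ) _
  have : LocallyPathConnectedSpace ↥M.defect :=
    ChartedSpace.locallyPathConnectedSpace (Fin n → ℝ) _
  by_cases hx : x ∈ M.defect <;> by_cases hy : y ∈ M.defect <;>
    simp only [stratumOf, hx, hy, dif_pos, dif_neg, not_false_eq_true, reduceCtorEq, Sum.inl.injEq,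
      Sum.inr.injEq] at h
  · exact key (Or.inl subset_rfl) ⟨x, hx⟩ ⟨y, hy⟩ h
  · exact key (Or.inr subset_rfl) ⟨x, hx⟩ ⟨y, hy⟩ h

end Strata

theorem kind_eq_of_stratumOf_eq (h : M.stratumOf x = M.stratumOf y) : M.kind x = M.kind y := by
  by_cases hx : x ∈ M.defect <;> by_cases hy : y ∈ M.defect <;> simp [stratumOf, hx, hy] at h <;>
    simp [kind, hx, hy]

end DirectedTriangulation

theorem BasePoints.stratumOf_pt (b : M.BasePoints) (st : M.Strata) :
    M.stratumOf (b.pt st) = st := by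
  rcases st with B | S
  · have : b.pt (Sum.inl B) ∉ M.defect := (b.bulkPt B).2
    rw [stratumOf, dif_neg this]
    exact congrArg Sum.inl (b.mk_bulkPt B)
  · have : b.pt (Sum.inr S) ∈ M.defect := (b.defectPt S).2
    rw [stratumOf, dif_pos this]
    exact congrArg Sum.inr (b.mk_defectPt S)

theorem BasePoints.pt_inl_notMem (b : M.BasePoints) (B) : b.pt (Sum.inl B) ∉ M.defect :=
  (b.bulkPt B).2

theorem BasePoints.pt_inr_mem (b : M.BasePoints) (S) : b.pt (Sum.inr S) ∈ M.defect :=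
  (b.defectPt S).2

/-! ### The structural functor -/

namespace DirectedTriangulation

variable (T : M.DirectedTriangulation) (b : M.BasePoints)

/-- The structural functor of the fundamental parcel. -/
noncomputable def structuralFunctor : b.FundamentalParcel ⥤ Paths Gamma2 :=
  inducedFunctor _ ⋙ (stdCocycle T).functor

theorem structuralFunctor_map {st st' : M.Strata}
    (f : (show b.FundamentalParcel from st) ⟶ (show b.FundamentalParcel from st')) :
    (T.structuralFunctor b).map f = (stdCocycle T).functor.map f.hom := rfl

theorem isStructuralFunctor : IsStructuralFunctor b (T.structuralFunctor b) where
  obj_bulk B := congrArg (Paths.of Gamma2).obj (kind_of_notMem (b.pt_inl_notMem B))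
  obj_defect S := congrArg (Paths.of Gamma2).obj (kind_of_mem (b.pt_inr_mem S))
  map_bulk {B B'} p hp := by
    rw [structuralFunctor_map, ← arrow_std_bulk (b.pt_inl_notMem B) (b.pt_inl_notMem B')]
    exact congrArg Arrow.mk (std_map_of_upper_or_lower p (Or.inl (PurePath.upper (Or.inr hp))))
  map_defect {S S'} p hp := by
    rw [structuralFunctor_map, ← arrow_std_defect (b.pt_inr_mem S) (b.pt_inr_mem S')]
    exact congrArg Arrow.mk (std_map_of_upper_or_lower p (Or.inl (PurePath.upper (Or.inl hp))))
  map_inbound {B S} p r h1 h2 := by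
    rw [structuralFunctor_map, ← arrow_std_inbound (b.pt_inl_notMem B) (b.pt_inr_mem S)]
    refine congrArg Arrow.mk (std_map_of_upper_or_lower p (Or.inl fun s t hst hs => ?_))
    exact h2 t ((not_lt.1 fun h => h1 s h hs).trans hst)
  map_outbound {S B} p r h1 h2 := by
    rw [structuralFunctor_map, ← arrow_std_outbound (b.pt_inr_mem S) (b.pt_inl_notMem B)]
    refine congrArg Arrow.mk (std_map_of_upper_or_lower p (Or.inr fun s t hst ht => ?_))
    exact h1 s (hst.trans (not_lt.1 fun h => h2 t h ht))

end DirectedTriangulation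

/-! ### Uniqueness of the structural functor -/

namespace IsStructuralFunctor

variable {b : M.BasePoints} {Ψ : b.FundamentalParcel ⥤ Paths Gamma2}

/-- The switching time asked for by the definition is the first time in the defect on an inbound
path, and the last one on an outbound path; they exist because the preimage of the defect is
compact. -/
theorem map_of_upper_or_lower (h : IsStructuralFunctor b Ψ) {st st' : M.Strata}
    (p : M.dSpace.DirPath (b.pt st) (b.pt st')) (hp : M.UpperPath p.1 ∨ M.LowerPath p.1) :
    Arrow.mk (Ψ.map (b.arrow p)) = Arrow.mk (std (M.kind (b.pt st)) (M.kind (b.pt st'))) := by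
  have hcl : IsCompact {t | p.1 t ∈ M.defect} :=
    (M.isClosed_defect.preimage p.1.continuous).isCompact
  have h0 : ∀ t : I, 0 ≤ t := fun t => unitInterval.nonneg t
  have h1 : ∀ t : I, t ≤ 1 := fun t => unitInterval.le_one t
  rcases st with B | S <;> rcases st' with B' | S'
  · have hb := b.pt_inl_notMem B
    have hb' := b.pt_inl_notMem B'
    rw [arrow_std_bulk hb hb']
    refine h.map_bulk p fun t ht => ?_
    rcases hp with hp | hp
    · exact hb' (by simpa using hp t 1 (h1 t) ht)
    · exact hb (by simpa using hp 0 t (h0 t) ht)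
  · have hb := b.pt_inl_notMem B
    have hb' := b.pt_inr_mem S'
    rw [arrow_std_inbound hb hb']
    rcases hp with hp | hp
    · obtain ⟨r, hr, hr'⟩ := hcl.exists_isLeast ⟨1, by simpa using hb'⟩
      exact h.map_inbound p r (fun t ht htd => absurd (hr' htd) (not_le.2 ht))
        fun t ht => hp r t ht hr
    · exact absurd (by simpa using hp 0 1 (h0 1) (by simpa using hb')) hb
  · have hb := b.pt_inr_mem S
    have hb' := b.pt_inl_notMem B'
    rw [arrow_std_outbound hb hb']
    rcases hp with hp | hp
    · exact absurd (by simpa using hp 0 1 (h0 1) (by simpa using hb)) hb'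
    · obtain ⟨r, hr, hr'⟩ := hcl.exists_isGreatest ⟨0, by simpa using hb⟩
      exact h.map_outbound p r (fun t ht => hp t r ht hr)
        fun t ht htd => absurd (hr' htd) (not_le.2 ht)
  · have hb := b.pt_inr_mem S
    have hb' := b.pt_inr_mem S'
    rw [arrow_std_defect hb hb']
    refine h.map_defect p fun t => ?_
    rcases hp with hp | hp
    · exact hp 0 t (h0 t) (by simpa using hb)
    · exact hp t 1 (h1 t) (by simpa using hb')

-- The points of a chain need not be base points, so each step is flanked by paths inside strata
-- that lead to base points. A flanked segment still changes kind at most once in a fixed direction,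
-- and its value is prescribed.
open DirectedTriangulation in
theorem map_eq_of_tr (T : M.DirectedTriangulation) {Ψ' : b.FundamentalParcel ⥤ Paths Gamma2}
    (h : IsStructuralFunctor b Ψ) (h' : IsStructuralFunctor b Ψ') {p : I → X} {s t : I} {x y : X}
    {g : (univCocycle T).obj x ⟶ (univCocycle T).obj y} (hg : (univCocycle T).Tr p s t x y g)
    (st st' : M.Strata) (a : M.dSpace.DirPath (b.pt st) x) (a' : M.dSpace.DirPath y (b.pt st'))
    (ha : M.PurePath a.1) (ha' : M.PurePath a'.1) :
    Arrow.mk (Ψ.map (InducedCategory.homMk (F := fun st => M.dSpace.fundObj (b.pt st))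
      (X := st) (Y := st') (M.dSpace.homotopyClass a ≫ g ≫ M.dSpace.homotopyClass a'))) =
    Arrow.mk (Ψ'.map (InducedCategory.homMk
      (M.dSpace.homotopyClass a ≫ g ≫ M.dSpace.homotopyClass a'))) := by
  have step : ∀ {x y : X} (l : T.Lin x y) (st st' : M.Strata) (a : M.dSpace.DirPath (b.pt st) x)
      (a' : M.dSpace.DirPath y (b.pt st')), M.PurePath a.1 → M.PurePath a'.1 →
      ∀ {Ψ : b.FundamentalParcel ⥤ Paths Gamma2}, IsStructuralFunctor b Ψ →
      Arrow.mk (Ψ.map (InducedCategory.homMk (F := fun st => M.dSpace.fundObj (b.pt st))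
      (X := st) (Y := st') (M.dSpace.homotopyClass a ≫ (univCocycle T).map l ≫
        M.dSpace.homotopyClass a'))) =
      Arrow.mk (std (M.kind (b.pt st)) (M.kind (b.pt st'))) := by
    intro x y l st st' a a' ha ha' Ψ h
    refine h.map_of_upper_or_lower (a.trans ((line l).trans a')) ?_
    rcases l.upper_or_lower with hl | hl
    · exact Or.inl (ha.upper.trans (hl.trans ha'.upper))
    · exact Or.inr (ha.lower.trans (hl.trans ha'.lower))
  induction hg generalizing st st' with
  | arrive hst hx hy _ l | depart hst hx hy _ l =>
    rw [step l st st' a a' ha ha' h, step l st st' a a' ha ha' h']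
  | @comp s u t x y z g g' _ _ ih ih' =>
    -- The chain is cut at `y` by inserting the isomorphism to the base point of its stratum and its
    -- inverse.
    obtain ⟨k, q, q', hk, hk', hq, hq'⟩ := exists_iso T (b.stratumOf_pt (M.stratumOf y)).symm
    have e : M.dSpace.homotopyClass a ≫ (g ≫ g') ≫ M.dSpace.homotopyClass a' =
        (M.dSpace.homotopyClass a ≫ g ≫ M.dSpace.homotopyClass q) ≫
          (M.dSpace.homotopyClass q' ≫ g' ≫ M.dSpace.homotopyClass a') := by
      rw [← hk, ← hk']
      exact comp_split_iso _ g g' _ k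
    have e' : InducedCategory.homMk (F := fun st => M.dSpace.fundObj (b.pt st)) (X := st) (Y := st')
        (M.dSpace.homotopyClass a ≫ (g ≫ g') ≫ M.dSpace.homotopyClass a') =
        InducedCategory.homMk (F := fun st => M.dSpace.fundObj (b.pt st)) (X := st)
          (Y := M.stratumOf y) (M.dSpace.homotopyClass a ≫ g ≫ M.dSpace.homotopyClass q) ≫
        InducedCategory.homMk (F := fun st => M.dSpace.fundObj (b.pt st)) (X := M.stratumOf y)
          (Y := st') (M.dSpace.homotopyClass q' ≫ g' ≫ M.dSpace.homotopyClass a') :=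
      InducedCategory.hom_ext e
    refine (congrArg (fun f => Arrow.mk (Ψ.map f)) e').trans (Eq.trans ?_
      (congrArg (fun f => Arrow.mk (Ψ'.map f)) e').symm)
    rw [Functor.map_comp, Functor.map_comp]
    exact Arrow.mk_comp_congr (ih _ _ a q ha hq) (ih' _ _ q' a' hq' ha')

end IsStructuralFunctor

theorem _root_.DSpace.exists_homotopyClass {d : DSpace X} {x y : X}
    (f : d.fundObj x ⟶ d.fundObj y) : ∃ p : d.DirPath x y, f = d.homotopyClass p := by
  obtain ⟨f, rfl⟩ := (CategoryTheory.Quotient.functor d.ImmediateHomotopy).map_surjective f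
  obtain ⟨p, rfl⟩ := Quot.exists_rep f
  exact ⟨p, rfl⟩

open DirectedTriangulation in
theorem IsStructuralFunctor.unique (T : M.DirectedTriangulation) {b : M.BasePoints}
    {Ψ Ψ' : b.FundamentalParcel ⥤ Paths Gamma2} (h : IsStructuralFunctor b Ψ)
    (h' : IsStructuralFunctor b Ψ') : Ψ = Ψ' := by
  refine Functor.ext_of_arrow fun {st st'} f => ?_
  obtain ⟨p, hp⟩ := DSpace.exists_homotopyClass f.hom
  have ht := (univCocycle T).tr_transport p
  have pure : ∀ x : X, M.PurePath (DSpace.DirPath.refl M.dSpace x).1 := fun x => by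
    by_cases hx : x ∈ M.defect
    · exact Or.inl fun _ => hx
    · exact Or.inr fun _ => hx
  have := map_eq_of_tr T h h' ht st st' (DSpace.DirPath.refl _ _) (DSpace.DirPath.refl _ _)
    (pure _) (pure _)
  have e : M.dSpace.homotopyClass (DSpace.DirPath.refl _ _) ≫ M.dSpace.homotopyClass p ≫
      M.dSpace.homotopyClass (DSpace.DirPath.refl _ _) = f.hom := by
    rw [DSpace.homotopyClass_refl, DSpace.homotopyClass_refl, Category.id_comp, Category.comp_id,
      hp]
  rw [ht.eq_homotopyClass] at this
  have hf : InducedCategory.homMk (F := fun st => M.dSpace.fundObj (b.pt st)) (X := st) (Y := st')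
    (M.dSpace.homotopyClass (DSpace.DirPath.refl _ _) ≫ M.dSpace.homotopyClass p ≫
      M.dSpace.homotopyClass (DSpace.DirPath.refl _ _)) = f := InducedCategory.hom_ext e
  rw [← hf]
  exact this

end ManifoldWithDefect

/-! ### Orientation of the edges -/

namespace ManifoldWithDefect.DirectedTriangulation

variable {n : ℕ} {X : Type*} [TopologicalSpace X] {M : ManifoldWithDefect n X}
  {T : M.DirectedTriangulation} {x y z w : X}

/-- Interior points of a mixed segment lie in the bulk, and those close to the defect end arrive at
it or depart from it, according to the direction. Their carriers are faces that reveal the type of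
`s`. -/
theorem lin_of_isDirected {s : Finset (EuclideanSpace ℝ (Fin T.dim))} (hs : s ∈ T.K.faces)
    (hx : T.car x ⊆ s) (hy : T.car y ⊆ s) (hd : M.IsDirected fun t : I => T.comb x y t) :
    T.Lin x y := by
  have hc := continuous_comb_unit hs hx hy
  have hm := comb_mem_defect_iff hs hx hy
  have hsub : ∀ t : I, T.car (T.comb x y t) ⊆ s := fun t => comb_subset hs hx hy t.2
  have hbulk : ∀ t : I, T.comb x y t ∉ M.defect →
      ¬ (T.car (T.comb x y t) : Set _) ⊆ T.defectVertices := fun t ht h =>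
    ht ((T.mem_defect_iff _).2 h)
  refine ⟨s, hs, hx, hy, fun h1 h2 => ?_, fun h1 h2 => ?_⟩
  · have e : T.comb x y (1 : I) = y := by simp [comb_one]
    obtain ⟨N, hN, hsm⟩ := T.exists_isSmall (T.comb x y (1 : I))
    have : (𝓝[<] (1 : I)).NeBot := nhdsLT_neBot_of_exists_lt ⟨0, zero_lt_one⟩
    obtain ⟨t, ht, ht1⟩ := (((unitInterval.eventually_uIcc (hc.continuousAt.eventually hN)).filter_mono
      nhdsWithin_le_nhds).and self_mem_nhdsWithin).exists (f := 𝓝[<] (1 : I))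
    have ht1 : t < 1 := ht1
    rw [uIcc_of_le ht1.le] at ht
    have hin := (hsm.in_out hc hd ht ht1.le).1 (In.refl _)
    have htd : T.comb x y t ∉ M.defect := fun h => h1 (((hm t).1 h).1 ht1)
    exact (inb_face_iff hs (T.car_mem _) (hsub t) (hbulk t htd) hin.1 (by rwa [e])).1
      (hin.2 (by rwa [e]) htd)
  · have e : T.comb x y (0 : I) = x := by simp [comb_zero]
    obtain ⟨N, hN, hsm⟩ := T.exists_isSmall (T.comb x y (0 : I))
    have : (𝓝[>] (0 : I)).NeBot := nhdsGT_neBot_of_exists_gt ⟨1, zero_lt_one⟩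
    obtain ⟨t, ht, ht1⟩ := (((unitInterval.eventually_uIcc (hc.continuousAt.eventually hN)).filter_mono
      nhdsWithin_le_nhds).and self_mem_nhdsWithin).exists (f := 𝓝[>] (0 : I))
    have ht1 : 0 < t := ht1
    rw [uIcc_of_ge ht1.le] at ht
    have hout := (hsm.in_out hc hd ht ht1.le).2 (Out.refl _)
    have htd : T.comb x y t ∉ M.defect := fun h => h2 (((hm t).1 h).2 ht1)
    exact (outb_face_iff hs (T.car_mem _) (hsub t) (hbulk t htd) hout.1 (by rwa [e])).1
      (hout.2 (by rwa [e]) htd)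

theorem _root_.ManifoldWithDefect.PurePath.stratumOf_eq (p : Path x y) (h : M.PurePath p) :
    M.stratumOf x = M.stratumOf y := by
  have key : ∀ {A : Set X} (h : ∀ t, p t ∈ A) (hx : x ∈ A) (hy : y ∈ A),
      ConnectedComponents.mk (⟨x, hx⟩ : ↥A) = ConnectedComponents.mk ⟨y, hy⟩ := by
    intro A h hx hy
    have hj : Joined (⟨y, hy⟩ : ↥A) ⟨x, hx⟩ :=
      ⟨⟨⟨fun t => ⟨p.symm t, h _⟩, by fun_prop⟩, by simp, by simp⟩⟩
    exact ConnectedComponents.coe_eq_coe'.2 (pathComponent_subset_component _ hj)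
  rcases h with h | h
  · have hx : x ∈ M.defect := by simpa using h 0
    have hy : y ∈ M.defect := by simpa using h 1
    rw [stratumOf, stratumOf, dif_pos hx, dif_pos hy, key h hx hy]
  · have hx : x ∉ M.defect := by simpa using h 0
    have hy : y ∉ M.defect := by simpa using h 1
    rw [stratumOf, stratumOf, dif_neg hx, dif_neg hy]
    exact congrArg Sum.inl (key (A := M.defectᶜ) h hx hy)

theorem lin_of_kind_eq {s : Finset (EuclideanSpace ℝ (Fin T.dim))} (hs : s ∈ T.K.faces)
    (hx : T.car x ⊆ s) (hy : T.car y ⊆ s) (h : M.kind x = M.kind y) : T.Lin x y := by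
  refine ⟨s, hs, hx, hy, fun h1 h2 => ?_, fun h1 h2 => ?_⟩
  · rw [kind_of_notMem h1, kind_of_mem h2] at h
    cases h
  · rw [kind_of_notMem h2, kind_of_mem h1] at h
    cases h

theorem Lin.symm (l : T.Lin x y) (h : M.kind x = M.kind y) : T.Lin y x := by
  obtain ⟨s, hs, hx, hy, -⟩ := l
  exact lin_of_kind_eq hs hy hx h.symm

theorem Lin.stratumOf_eq (l : T.Lin x y) (h : M.kind x = M.kind y) :
    M.stratumOf x = M.stratumOf y := by
  refine PurePath.stratumOf_eq (line l).1 ?_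
  obtain ⟨s, hs, hx, hy, -⟩ := id l
  by_cases h1 : x ∈ M.defect
  · have h2 : y ∈ M.defect := by rwa [← kind_eq_delta, ← h, kind_eq_delta]
    exact Or.inl fun t => (comb_mem_defect_iff hs hx hy t).2 ⟨fun _ => h1, fun _ => h2⟩
  · have h2 : y ∉ M.defect := by rwa [← kind_eq_beta, ← h, kind_eq_beta]
    refine Or.inr fun t ht => ?_
    have := (comb_mem_defect_iff hs hx hy t).1 ht
    rcases lt_or_ge t 1 with ht | ht
    · exact h1 (this.1 ht)
    · exact h2 (this.2 (zero_lt_one.trans_le ht))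

variable {u v w : ↥T.K.vertices}

theorem car_pos_subset {s : Finset (EuclideanSpace ℝ (Fin T.dim))} :
    T.car (T.pos v) ⊆ s ↔ v.1 ∈ s := by
  rw [car_pos, Finset.singleton_subset_iff]

theorem Dir.lin (h : T.Dir v w) : T.Lin (T.pos v) (T.pos w) := by
  obtain ⟨-, ⟨s, hs, e⟩, h⟩ := h
  have hv : T.car (T.pos v) ⊆ s := car_pos_subset.2 (by
    rw [← Finset.mem_coe, e]; exact mem_insert _ _)
  have hw : T.car (T.pos w) ⊆ s := car_pos_subset.2 (by
    rw [← Finset.mem_coe, e]; exact mem_insert_of_mem _ rfl)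
  rcases h with ⟨h, -⟩ | ⟨-, p, hp, hpe⟩
  · exact lin_of_kind_eq hs hv hw (kind_eq_of_stratumOf_eq h)
  · refine lin_of_isDirected hs hv hw ?_
    have : (fun t : I => T.comb (T.pos v) (T.pos w) t) = p := by
      funext t
      apply T.isEmbedding_coord.injective
      rw [coord_comb hs hv hw t.2, coord_pos, coord_pos]
      exact (hpe t).symm
    rw [this]
    exact hp

/-- A mixed segment directed both ways would lie in a simplex that is both inbound and outbound. -/
theorem Lin.not_symm (l : T.Lin x y) (l' : T.Lin y x) : M.kind x = M.kind y := by
  obtain ⟨s, hs, hx, hy, -⟩ := id l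
  by_cases h1 : x ∈ M.defect <;> by_cases h2 : y ∈ M.defect
  · rw [kind_of_mem h1, kind_of_mem h2]
  · exact absurd (l.outb hs hx hy h1 h2) ((l'.inb hs hy hx h2 h1).not_outb hs)
  · exact absurd (l'.outb hs hy hx h2 h1) ((l.inb hs hx hy h1 h2).not_outb hs)
  · rw [kind_of_notMem h1, kind_of_notMem h2]

theorem Dir.lt (h : T.Dir v w) (hk : M.kind (T.pos v) = M.kind (T.pos w)) : T.lt v w := by
  obtain ⟨-, -, h'⟩ := id h
  exact (h'.resolve_right fun h'' => h''.1 (h.lin.stratumOf_eq hk)).2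

theorem lt_trans (huv : M.stratumOf (T.pos u) = M.stratumOf (T.pos v))
    (hvw : M.stratumOf (T.pos v) = M.stratumOf (T.pos w)) (h : T.lt u v) (h' : T.lt v w) :
    T.lt u w := by
  have := T.lt_total (M.stratumOf (T.pos w))
  exact this.toIsStrictOrder.toIsTrans.trans ⟨u, huv.trans hvw⟩ ⟨v, hvw⟩ ⟨w, rfl⟩ h h'

theorem not_lt_self : ¬ T.lt v v := by
  have := T.lt_total (M.stratumOf (T.pos v))
  exact this.toIsStrictOrder.toIrrefl.irrefl ⟨v, rfl⟩

theorem Dir.not_symm (h : T.Dir v w) : ¬ T.Dir w v := fun h' => by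
  have hk := h.lin.not_symm h'.lin
  have hs := h.lin.stratumOf_eq hk
  exact not_lt_self (lt_trans hs hs.symm (h.lt hk) (h'.lt hk.symm))

/-- In a cycle each vertex is joined to each other by directed segments both ways, so all are of one
kind and in one stratum, where the order is strict. Thus every triangle has a unique pair of
composable edges. -/
theorem Dir.not_cyclic {s : Finset (EuclideanSpace ℝ (Fin T.dim))} (hs : s ∈ T.K.faces)
    (hu : u.1 ∈ s) (hv : v.1 ∈ s) (hw : w.1 ∈ s) (huv : T.Dir u v) (hvw : T.Dir v w) :
    ¬ T.Dir w u := fun hwu => by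
  rw [← car_pos_subset] at hu hv hw
  have l1 := Lin.trans hs hu hv hw huv.lin hvw.lin
  have l2 := Lin.trans hs hv hw hu hvw.lin hwu.lin
  have k1 := l1.not_symm hwu.lin
  have k2 := l2.not_symm huv.lin
  have s1 := huv.lin.stratumOf_eq k2.symm
  have s2 := hvw.lin.stratumOf_eq (k2.trans k1)
  exact not_lt_self (lt_trans (s1.trans s2) (s1.trans s2).symm
    (lt_trans s1 s2 (huv.lt k2.symm) (hvw.lt (k2.trans k1))) (hwu.lt k1.symm))

theorem Lin.dir_or (l : T.Lin (T.pos v) (T.pos w)) (hne : v ≠ w) :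
    T.Dir v w ∨ (T.Dir w v ∧ M.kind (T.pos v) = M.kind (T.pos w)) := by
  classical
  obtain ⟨s, hs, hv, hw, -⟩ := id l
  have hf : ({v.1, w.1} : Finset _) ∈ T.K.faces := T.K.down_closed hs
    (Finset.insert_subset (car_pos_subset.1 hv) (Finset.singleton_subset_iff.2 (car_pos_subset.1 hw)))
    (Finset.insert_nonempty _ _)
  by_cases hst : M.stratumOf (T.pos v) = M.stratumOf (T.pos w)
  · have := T.lt_total (M.stratumOf (T.pos w))
    by_cases hlt : T.lt v w
    · exact Or.inl ⟨hne, ⟨_, hf, by simp⟩, Or.inl ⟨hst, hlt⟩⟩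
    · by_cases hlt' : T.lt w v
      · exact Or.inr ⟨⟨hne.symm, ⟨_, hf, by simp [Set.pair_comm]⟩, Or.inl ⟨hst.symm, hlt'⟩⟩,
          kind_eq_of_stratumOf_eq hst⟩
      · exact absurd (congrArg Subtype.val (this.toTrichotomous.trichotomous ⟨v, hst⟩ ⟨w, rfl⟩ hlt hlt'))
          hne
  · refine Or.inl ⟨hne, ⟨_, hf, by simp⟩, Or.inr ⟨hst, (line l).1.toContinuousMap, (line l).2,
      fun t => ?_⟩⟩
    change T.coord (T.comb _ _ _) = _
    rw [coord_comb hs hv hw t.2, coord_pos, coord_pos]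

/-! ### A vertex near each point -/

variable (T) in
theorem exists_vertex (x : X) : ∃ v : ↥T.K.vertices, v.1 ∈ T.car x ∧ M.kind (T.pos v) = M.kind x := by
  by_cases hx : x ∈ M.defect
  · obtain ⟨v, hv⟩ := Geometry.SimplicialComplex.nonempty_of_mem_faces (T.car_mem x)
    obtain ⟨h1, h2⟩ := (T.mem_defect_iff x).1 hx hv
    exact ⟨⟨v, h1⟩, hv, by rw [kind_of_mem h2, kind_of_mem hx]⟩
  · obtain ⟨v, hv, h⟩ := Set.not_subset.1 (mt (T.mem_defect_iff x).2 hx)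
    refine ⟨⟨v, mem_vertices_of_mem_face (T.car_mem x) hv⟩, hv, ?_⟩
    rw [kind_of_notMem hx, kind_of_notMem ((T.pos_mem_defect_iff _).not.2 h)]

variable (T) in
/-- A vertex of the same kind in the carrier of a point. -/
noncomputable def vert (x : X) : ↥T.K.vertices := (T.exists_vertex x).choose

theorem vert_mem (x : X) : (T.vert x).1 ∈ T.car x := (T.exists_vertex x).choose_spec.1

theorem kind_vert (x : X) : M.kind (T.pos (T.vert x)) = M.kind x :=
  (T.exists_vertex x).choose_spec.2

theorem vert_pos (v : ↥T.K.vertices) : T.vert (T.pos v) = v := by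
  have := T.vert_mem (T.pos v)
  rw [car_pos, Finset.mem_singleton] at this
  exact Subtype.ext this

theorem lin_vert (x : X) : T.Lin x (T.pos (T.vert x)) :=
  lin_of_kind_eq (T.car_mem x) subset_rfl (car_pos_subset.2 (vert_mem x)) (kind_vert x).symm

theorem vert_lin (x : X) : T.Lin (T.pos (T.vert x)) x := (lin_vert x).symm (kind_vert x).symm

theorem stratumOf_vert (x : X) : M.stratumOf (T.pos (T.vert x)) = M.stratumOf x :=
  (vert_lin x).stratumOf_eq (kind_vert x)

theorem car_vert_subset {s : Finset (EuclideanSpace ℝ (Fin T.dim))} (h : T.car x ⊆ s) :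
    T.car (T.pos (T.vert x)) ⊆ s := car_pos_subset.2 (h (vert_mem x))

theorem Lin.vert (l : T.Lin x y) : T.Lin (T.pos (T.vert x)) (T.pos (T.vert y)) := by
  obtain ⟨s, hs, hx, hy, -⟩ := id l
  exact ((vert_lin x).trans hs (car_vert_subset hx) hx hy l).trans hs (car_vert_subset hx) hy
    (car_vert_subset hy) (lin_vert y)

/-! ### Induction over arrows of the fundamental category -/

-- Transport in `univCocycle` displays the class of any directed path as a finite composition of
-- classes of segments.
variable (T) in
theorem hom_induction {Q : ∀ x y : X, (M.dSpace.fundObj x ⟶ M.dSpace.fundObj y) → Prop}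
    (line : ∀ {x y : X} (l : T.Lin x y), Q x y (M.dSpace.homotopyClass (line l)))
    (comp : ∀ {x y z : X} (f : M.dSpace.fundObj x ⟶ M.dSpace.fundObj y)
      (g : M.dSpace.fundObj y ⟶ M.dSpace.fundObj z), Q x y f → Q y z g → Q x z (f ≫ g))
    (f : M.dSpace.fundObj x ⟶ M.dSpace.fundObj y) : Q x y f := by
  obtain ⟨p, rfl⟩ := DSpace.exists_homotopyClass f
  have ht := (univCocycle T).tr_transport p
  have key : ∀ {s t : I} {x y : X} {g : (univCocycle T).obj x ⟶ (univCocycle T).obj y},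
      (univCocycle T).Tr p.1 s t x y g → Q x y g := by
    intro s t x y g h
    induction h with
    | arrive _ _ _ _ l | depart _ _ _ _ l => exact line l
    | comp _ _ h1 h2 => exact comp _ _ h1 h2
  rw [← ht.eq_homotopyClass]
  exact key ht

/-- The transport along a segment. -/
theorem Cocycle.functor_map_line {C : Type*} [Category C] (c : T.Cocycle C) (l : T.Lin x y) :
    c.functor.map (M.dSpace.homotopyClass (line l)) = c.map l := by
  obtain ⟨s, hs, hx, hy, -⟩ := id l
  have hm := comb_mem_defect_iff hs hx hy
  have hsub : ∀ t : I, T.car (T.comb x y t) ⊆ s := fun t => comb_subset hs hx hy t.2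
  have hcar : ∀ t : I, 0 < t → t < 1 → T.car (T.comb x y t) = T.car x ∪ T.car y :=
    fun t h0 h1 => car_comb hs hx hy (by exact_mod_cast h0) (by exact_mod_cast h1)
  have hbulk : ∀ t : I, T.comb x y t ∉ M.defect →
      ¬ (T.car (T.comb x y t) : Set _) ⊆ T.defectVertices := fun t ht h =>
    ht ((T.mem_defect_iff _).2 h)
  have hout : ∀ t : I, t < 1 → T.Out (T.comb x y t) x := by
    intro t ht
    rcases (show (0 : I) ≤ t from unitInterval.nonneg t).eq_or_lt with rfl | h0
    · simpa [comb_zero] using Out.refl x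
    · have hxt : T.car x ⊆ T.car (T.comb x y t) := by
        rw [hcar t h0 ht]; exact Finset.subset_union_left
      refine ⟨hxt, fun h1 h2 => ?_⟩
      exact (outb_face_iff hs (T.car_mem _) (hsub t) (hbulk t h2) hxt h1).2
        (l.outb hs hx hy h1 fun h3 => h2 ((hm t).2 ⟨fun _ => h1, fun _ => h3⟩))
  have hin : ∀ t : I, 0 < t → T.In (T.comb x y t) y := by
    intro t ht
    rcases (show t ≤ (1 : I) from unitInterval.le_one t).eq_or_lt with rfl | h1
    · simpa [comb_one] using In.refl y
    · have hyt : T.car y ⊆ T.car (T.comb x y t) := by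
        rw [hcar t ht h1]; exact Finset.subset_union_right
      refine ⟨hyt, fun h1 h2 => ?_⟩
      exact (inb_face_iff hs (T.car_mem _) (hsub t) (hbulk t h2) hyt h1).2
        (l.inb hs hx hy (fun h3 => h2 ((hm t).2 ⟨fun _ => h3, fun _ => h1⟩)) h1)
  -- Before an interior time all points of the segment depart from `x`, and after it all arrive at
  -- `y`, so two steps form a chain and the triangle relation merges them.
  obtain ⟨r, r0, r1⟩ := exists_between (zero_lt_one (α := I))
  have h1 : c.Tr (line l).1 0 r x (T.comb x y r) (c.map (hout r r1).lin) :=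
    .depart r0.le (line l).1.source rfl (fun t ht => hout t (ht.2.trans_lt r1)) _
  have h2 : c.Tr (line l).1 r 1 (T.comb x y r) y (c.map (hin r r0).lin) :=
    .arrive r1.le rfl (line l).1.target (fun t ht => hin t (r0.trans_le ht.1)) _
  rw [functor_map_homotopyClass, ← (h1.comp h2).eq_transport,
    c.map_comp hs hx (hsub r) hy _ _ l]

end ManifoldWithDefect.DirectedTriangulation

/-! ### Lifts of a functor on a full subcategory -/

namespace CategoryTheory

variable {P B C : Type*} [Category P] [Category B] [Category C] (Φ : P ⥤ B) (γ : C ⥤ B) (O : P → C)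

/-- Arrows above a given one. -/
def LiftHom {x y : P} (f : x ⟶ y) : Type _ :=
  {g : O x ⟶ O y // Arrow.mk (γ.map g) = Arrow.mk (Φ.map f)}

theorem Arrow.mk_eq_of_heq {a b a' b' : C} {f : a ⟶ b} {f' : a' ⟶ b'} (h : a = a') (h' : b = b')
    (hf : HEq f f') : Arrow.mk f = Arrow.mk f' := by
  subst h h'
  rw [eq_of_heq hf]

/-- Functors on the full subcategory with objects `pt j` that lift `Φ` along `γ`, with values `O` on
objects. -/
@[ext]
structure Lift {J : Type*} (pt : J → P) where
  map : ∀ {j k : J}, (pt j ⟶ pt k) → (O (pt j) ⟶ O (pt k))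
  map_id : ∀ j, map (𝟙 (pt j)) = 𝟙 (O (pt j))
  map_comp : ∀ {j k l : J} (f : pt j ⟶ pt k) (g : pt k ⟶ pt l), map (f ≫ g) = map f ≫ map g
  map_over : ∀ {j k : J} (f : pt j ⟶ pt k), Arrow.mk (γ.map (map f)) = Arrow.mk (Φ.map f)

variable {Φ γ O}

theorem Arrow.mk_eqToHom {a b a' b' : C} (h : a' = a) (f : a ⟶ b) (h' : b = b') :
    Arrow.mk (eqToHom h ≫ f ≫ eqToHom h') = Arrow.mk f := by
  subst h h'
  simp

theorem isIso_of_arrow_eq {a b a' b' : C} {f : a ⟶ b} {f' : a' ⟶ b'} [IsIso f']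
    (h : Arrow.mk f = Arrow.mk f') : IsIso f := by
  obtain ⟨rfl, rfl, h⟩ := Arrow.mk_eq_cases h
  rw [eq_of_heq h]
  infer_instance

theorem Arrow.mk_inv_congr {a b a' b' : C} {f : a ⟶ b} {f' : a' ⟶ b'} [IsIso f] [IsIso f']
    (h : Arrow.mk f = Arrow.mk f') : Arrow.mk (inv f) = Arrow.mk (inv f') := by
  obtain ⟨rfl, rfl, h⟩ := Arrow.mk_eq_cases h
  obtain rfl := eq_of_heq h
  rfl

theorem isIso_of_lift [γ.ReflectsIsomorphisms] {x y : P} (f : x ⟶ y) [IsIso f] {g : O x ⟶ O y}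
    (h : Arrow.mk (γ.map g) = Arrow.mk (Φ.map f)) : IsIso g :=
  have := isIso_of_arrow_eq h
  isIso_of_reflects_iso g γ

namespace Lift

section Extend

variable {J J' : Type*} {pt : J → P} {pt' : J' → P}

/-- Restriction to the first summand. -/
def restrict (φ : Lift Φ γ O (Sum.elim pt pt')) : Lift Φ γ O pt where
  map {j k} f := φ.map (j := Sum.inl j) (k := Sum.inl k) f
  map_id j := φ.map_id (Sum.inl j)
  map_comp {j k l} f g := φ.map_comp (j := Sum.inl j) (k := Sum.inl k) (l := Sum.inl l) f g
  map_over {j k} f := φ.map_over (j := Sum.inl j) (k := Sum.inl k) f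

/-- Interchange of the summands. -/
def swap (φ : Lift Φ γ O (Sum.elim pt pt')) : Lift Φ γ O (Sum.elim pt' pt) where
  map {j k} := match j, k with
    | .inl j, .inl k => fun f => φ.map (j := .inr j) (k := .inr k) f
    | .inl j, .inr k => fun f => φ.map (j := .inr j) (k := .inl k) f
    | .inr j, .inl k => fun f => φ.map (j := .inl j) (k := .inr k) f
    | .inr j, .inr k => fun f => φ.map (j := .inl j) (k := .inl k) f
  map_id := by
    rintro (j | j)
    · exact φ.map_id (.inr j)
    · exact φ.map_id (.inl j)
  map_comp {j k l} := by
    rcases j with j | j <;> rcases k with k | k <;> rcases l with l | l <;> intro f g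
    · exact φ.map_comp (j := .inr j) (k := .inr k) (l := .inr l) f g
    · exact φ.map_comp (j := .inr j) (k := .inr k) (l := .inl l) f g
    · exact φ.map_comp (j := .inr j) (k := .inl k) (l := .inr l) f g
    · exact φ.map_comp (j := .inr j) (k := .inl k) (l := .inl l) f g
    · exact φ.map_comp (j := .inl j) (k := .inr k) (l := .inr l) f g
    · exact φ.map_comp (j := .inl j) (k := .inr k) (l := .inl l) f g
    · exact φ.map_comp (j := .inl j) (k := .inl k) (l := .inr l) f g
    · exact φ.map_comp (j := .inl j) (k := .inl k) (l := .inl l) f g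
  map_over {j k} := by
    rcases j with j | j <;> rcases k with k | k <;> intro f <;> exact φ.map_over _

theorem swap_swap (φ : Lift Φ γ O (Sum.elim pt pt')) : φ.swap.swap = φ := by
  ext j k f
  rcases j with j | j <;> rcases k with k | k <;> rfl

/-- Interchange of the summands as an equivalence. -/
def swapEquiv : Lift Φ γ O (Sum.elim pt pt') ≃ Lift Φ γ O (Sum.elim pt' pt) :=
  ⟨swap, swap, swap_swap, swap_swap⟩

variable (r : J' → J) (k : ∀ j', pt' j' ≅ pt (r j'))

/-- The retraction onto the first summand. -/
def retract : J ⊕ J' → J := Sum.elim id r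

/-- The isomorphisms onto the first summand. -/
def retractIso : ∀ a : J ⊕ J', Sum.elim pt pt' a ≅ pt (retract r a)
  | .inl j => Iso.refl (pt j)
  | .inr j' => k j'

/-- Lifts of the isomorphisms onto the first summand. -/
def retractLift (g : ∀ j', LiftHom Φ γ O (k j').hom) :
    ∀ a : J ⊕ J', O (Sum.elim pt pt' a) ⟶ O (pt (retract r a))
  | .inl j => 𝟙 (O (pt j))
  | .inr j' => (g j').1

theorem retractLift_over (hO : ∀ x, γ.obj (O x) = Φ.obj x) (g : ∀ j', LiftHom Φ γ O (k j').hom)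
    (a : J ⊕ J') :
    Arrow.mk (γ.map (retractLift r k g a)) = Arrow.mk (Φ.map (retractIso r k a).hom) := by
  rcases a with j | j'
  · change Arrow.mk (γ.map (𝟙 (O (pt j)))) = Arrow.mk (Φ.map (𝟙 (pt j)))
    rw [γ.map_id, Φ.map_id, hO]
  · exact (g j').2

theorem retractLift_isIso [γ.ReflectsIsomorphisms] (hO : ∀ x, γ.obj (O x) = Φ.obj x) (g : ∀ j', LiftHom Φ γ O (k j').hom)
    (a : J ⊕ J') : IsIso (retractLift r k g a) := isIso_of_lift _ (retractLift_over r k hO g a)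

theorem over_inv {x y : P} (k : x ≅ y) {g : O x ⟶ O y} [IsIso g]
    (h : Arrow.mk (γ.map g) = Arrow.mk (Φ.map k.hom)) :
    Arrow.mk (γ.map (inv g)) = Arrow.mk (Φ.map k.inv) := by
  have := Arrow.mk_inv_congr h
  rwa [← Functor.map_inv, ← Functor.map_inv, IsIso.Iso.inv_hom] at this

/-- Extension of a lift to points isomorphic to the given ones. -/
noncomputable def extend [γ.ReflectsIsomorphisms] (hO : ∀ x, γ.obj (O x) = Φ.obj x) (ψ : Lift Φ γ O pt)
    (g : ∀ j', LiftHom Φ γ O (k j').hom) : Lift Φ γ O (Sum.elim pt pt') :=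
  have := retractLift_isIso r k hO g
  { map := fun {a b} f => retractLift r k g a ≫
      ψ.map ((retractIso r k a).inv ≫ f ≫ (retractIso r k b).hom) ≫ inv (retractLift r k g b)
    map_id := fun a => by simp [ψ.map_id]
    map_comp := fun {a b c} f f' => by
      have e : (retractIso r k a).inv ≫ (f ≫ f') ≫ (retractIso r k c).hom =
        ((retractIso r k a).inv ≫ f ≫ (retractIso r k b).hom) ≫
          ((retractIso r k b).inv ≫ f' ≫ (retractIso r k c).hom) := by simp
      rw [e, ψ.map_comp]
      simp
    map_over := fun {a b} f => by
      have e : f = (retractIso r k a).hom ≫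
        ((retractIso r k a).inv ≫ f ≫ (retractIso r k b).hom) ≫ (retractIso r k b).inv := by simp
      conv_rhs => rw [e]
      rw [γ.map_comp, γ.map_comp, Φ.map_comp, Φ.map_comp _ (retractIso r k b).inv]
      exact Arrow.mk_comp_congr (retractLift_over r k hO g a) (Arrow.mk_comp_congr (ψ.map_over _)
        (over_inv _ (retractLift_over r k hO g b))) }

/-- The values of the extension are characterized by an equation without inverses, which is easier
to check. -/
theorem extend_map_eq [γ.ReflectsIsomorphisms] (hO : ∀ x, γ.obj (O x) = Φ.obj x) (ψ : Lift Φ γ O pt)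
    (g : ∀ j', LiftHom Φ γ O (k j').hom) {a b : J ⊕ J'}
    (f : Sum.elim pt pt' a ⟶ Sum.elim pt pt' b)
    (h : O (Sum.elim pt pt' a) ⟶ O (Sum.elim pt pt' b)) (e : h ≫ retractLift r k g b =
      retractLift r k g a ≫ ψ.map ((retractIso r k a).inv ≫ f ≫ (retractIso r k b).hom)) :
    (extend r k hO ψ g).map f = h := by
  have := retractLift_isIso r k hO g
  change retractLift r k g a ≫ ψ.map ((retractIso r k a).inv ≫ f ≫ (retractIso r k b).hom) ≫
    inv (retractLift r k g b) = h
  rw [← Category.assoc, ← e]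
  simp

/-- A lift on a sum is given by its restriction and its values on the isomorphisms. -/
noncomputable def extendEquiv [γ.ReflectsIsomorphisms] (hO : ∀ x, γ.obj (O x) = Φ.obj x) :
    Lift Φ γ O (Sum.elim pt pt') ≃ Lift Φ γ O pt × ∀ j', LiftHom Φ γ O (k j').hom where
  toFun φ := (φ.restrict, fun j' =>
    ⟨φ.map (j := .inr j') (k := .inl (r j')) (k j').hom, φ.map_over _⟩)
  invFun z := extend r k hO z.1 z.2
  left_inv φ := by
    -- The recorded arrows are values of `φ` itself, so functoriality of `φ` yields the conjugation
    -- formula that defines the extension.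
    have hr : ∀ a, retractLift r k (fun j' => (⟨φ.map (j := .inr j') (k := .inl (r j')) (k j').hom,
        φ.map_over _⟩ : LiftHom Φ γ O (k j').hom)) a
        = φ.map (j := a) (k := .inl (retract r a)) (retractIso r k a).hom := by
      rintro (j | j')
      · exact (φ.map_id (.inl j)).symm
      · rfl
    ext a b f
    refine extend_map_eq r k hO _ _ _ _ ?_
    refine (congrArg (φ.map f ≫ ·) (hr b)).trans (Eq.trans ?_
      (congrArg (· ≫ φ.map (j := .inl (retract r a)) (k := .inl (retract r b))
        ((retractIso r k a).inv ≫ f ≫ (retractIso r k b).hom)) (hr a)).symm)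
    refine (φ.map_comp (l := .inl (retract r b)) _ _).symm.trans (Eq.trans ?_
      (φ.map_comp (k := .inl (retract r a)) (l := .inl (retract r b)) _ _))
    exact congrArg φ.map (Iso.hom_inv_id_assoc (retractIso r k a) _).symm
  right_inv := by
    rintro ⟨ψ, g⟩
    refine Prod.ext ?_ ?_
    · ext i j f
      refine extend_map_eq r k hO ψ g (a := .inl i) (b := .inl j) f _ ?_
      change ψ.map f ≫ 𝟙 (O (pt j)) = 𝟙 (O (pt i)) ≫ ψ.map (𝟙 (pt i) ≫ f ≫ 𝟙 (pt j))
      simp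
    · funext j'
      refine Subtype.ext ?_
      refine extend_map_eq r k hO ψ g (a := .inr j') (b := .inl (r j')) (k j').hom _ ?_
      change (g j').1 ≫ 𝟙 (O (pt (r j'))) =
        (g j').1 ≫ ψ.map ((k j').inv ≫ (k j').hom ≫ 𝟙 (pt (r j')))
      simp [ψ.map_id]

end Extend

/-- Lifts are functors on the full subcategory above the given one. -/
noncomputable def functorEquiv (hγ : Function.Injective γ.obj) (hO : ∀ x, γ.obj (O x) = Φ.obj x)
    {J : Type*} (pt : J → P) :
    Lift Φ γ O pt ≃ {F : InducedCategory P pt ⥤ C // F ⋙ γ = inducedFunctor pt ⋙ Φ} := by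
  refine Equiv.ofBijective (fun φ => ⟨{
      obj := fun j => O (pt j)
      map := fun f => φ.map f.hom
      map_id := fun j => φ.map_id j
      map_comp := fun f g => φ.map_comp _ _ },
      Functor.ext_of_arrow fun f => φ.map_over f.hom⟩) ⟨fun φ φ' h => ?_, ?_⟩
  · have h := congrArg Subtype.val h
    ext j k f
    have := Functor.hcongr_hom h (InducedCategory.homMk (F := pt) f)
    exact eq_of_heq this
  · rintro ⟨F, hF⟩
    -- Injectivity on objects leaves no choice for the objects; the equality is only propositional,
    -- which is why `eqToHom` enters.
    have hobj : ∀ j, F.obj j = O (pt j) := fun j =>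
      hγ ((Functor.congr_obj hF j).trans (hO _).symm)
    refine ⟨⟨fun {j k} f => eqToHom (hobj j).symm ≫ F.map (InducedCategory.homMk f) ≫
      eqToHom (hobj k), fun j => ?_, fun {j k l} f g => ?_, fun {j k} f => ?_⟩, Subtype.ext ?_⟩
    · have : InducedCategory.homMk (F := pt) (𝟙 (pt j)) = 𝟙 (show InducedCategory P pt from j) := rfl
      rw [this, F.map_id]
      simp
    · have : InducedCategory.homMk (F := pt) (f ≫ g) = InducedCategory.homMk (F := pt) f ≫
        InducedCategory.homMk (F := pt) g := rfl
      rw [this, F.map_comp]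
      simp
    · have h1 := congrArg Arrow.mk (γ.map_comp (eqToHom (hobj j).symm)
        (F.map (InducedCategory.homMk f) ≫ eqToHom (hobj k)))
      rw [h1, γ.map_comp, eqToHom_map, eqToHom_map, Arrow.mk_eqToHom]
      have h2 := Functor.hcongr_hom hF (InducedCategory.homMk (F := pt) f)
      exact Arrow.mk_eq_of_heq (Functor.congr_obj hF j) (Functor.congr_obj hF k) h2
    · refine Functor.ext_of_arrow fun f => ?_
      exact Arrow.mk_eqToHom _ _ _

end Lift

end CategoryTheory

/-! ### Colorings and lifts -/

namespace ManifoldWithDefect.DirectedTriangulation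

variable {n : ℕ} {X : Type*} [TopologicalSpace X] {M : ManifoldWithDefect n X}
  (T : M.DirectedTriangulation) {C : Type*} [Category C] (γ : C ⥤ Paths Gamma2) (O : Gamma2 → C)

/-- The values on objects of a functor above the standard one. -/
noncomputable def pointObj (x : M.dSpace.FundamentalCategory) : C := O (M.kind x.as.pt)

/-- Colorings by arrows with prescribed source and target. -/
@[ext]
structure TypedColoring where
  map : ∀ {v w : ↥T.K.vertices}, T.Dir v w → (O (M.kind (T.pos v)) ⟶ O (M.kind (T.pos w)))
  map_over : ∀ {v w : ↥T.K.vertices} (h : T.Dir v w),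
    Arrow.mk (γ.map (map h)) = Arrow.mk (std (M.kind (T.pos v)) (M.kind (T.pos w)))
  map_comp : ∀ {u v w : ↥T.K.vertices} {s : Finset (EuclideanSpace ℝ (Fin T.dim))},
    s ∈ T.K.faces → u.1 ∈ s → v.1 ∈ s → w.1 ∈ s →
    ∀ (huv : T.Dir u v) (hvw : T.Dir v w) (huw : T.Dir u w), map huv ≫ map hvw = map huw

variable {T γ O}

theorem _root_.CategoryTheory.exists_mk_eq {B : Type*} [Category B] {F : C ⥤ B}
    (hF : Function.Injective F.obj) {f : Arrow C} {a b : C} {a' b' : B} {g : a' ⟶ b'}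
    (h : F.mapArrow.obj f = Arrow.mk g) (ha : F.obj a = a') (hb : F.obj b = b') :
    ∃ k : a ⟶ b, Arrow.mk k = f := by
  have h1 : f.left = a := hF ((congrArg Comma.left h).trans ha.symm)
  have h2 : f.right = b := hF ((congrArg Comma.right h).trans hb.symm)
  subst h1 h2
  exact ⟨f.hom, rfl⟩

theorem IsColoring.map_over {col : T.OrientedEdge → Arrow C} (h : T.IsColoring γ col)
    (e : T.OrientedEdge) : γ.mapArrow.obj (col e) =
      Arrow.mk (std (M.kind (T.pos e.1.1)) (M.kind (T.pos e.1.2))) := by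
  by_cases h1 : T.pos e.1.1 ∈ M.defect <;> by_cases h2 : T.pos e.1.2 ∈ M.defect
  · rw [arrow_std_defect h1 h2, h.defect e h1 h2]
  · rw [arrow_std_outbound h1 h2, h.outbound e h1 h2]
  · rw [arrow_std_inbound h1 h2, h.inbound e h1 h2]
  · rw [arrow_std_bulk h1 h2, h.bulk e h1 h2]

/-- The source and target of the arrows of a coloring are determined. -/
noncomputable def typedColoringEquiv (hγ : Function.Injective γ.obj)
    (hO : ∀ k, γ.obj (O k) = (Paths.of Gamma2).obj k) : T.TypedColoring γ O ≃ T.Coloring γ := by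
  refine Equiv.ofBijective (fun c => ⟨fun e => Arrow.mk (c.map e.2), ?_⟩) ⟨?_, ?_⟩
  · refine ⟨fun e h1 h2 => ?_, fun e h1 h2 => ?_, fun e h1 h2 => ?_, fun e h1 h2 => ?_,
      fun x y z hxy hyz hxz hs => ?_⟩
    · exact (c.map_over e.2).trans (arrow_std_bulk h1 h2)
    · exact (c.map_over e.2).trans (arrow_std_defect h1 h2)
    · exact (c.map_over e.2).trans (arrow_std_inbound h1 h2)
    · exact (c.map_over e.2).trans (arrow_std_outbound h1 h2)
    · obtain ⟨s, hs, e⟩ := hs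
      have hm : ∀ a ∈ ({x.1, y.1, z.1} : Set _), a ∈ s := fun a ha => by
        rw [← Finset.mem_coe, e]; exact ha
      exact ⟨_, _, _, c.map hxy, c.map hyz, rfl, rfl, congrArg Arrow.mk (c.map_comp hs
        (hm _ (by simp)) (hm _ (by simp)) (hm _ (by simp)) hxy hyz hxz).symm⟩
  · intro c c' h
    ext v w hd
    exact Arrow.mk_injective _ _ (congrFun (congrArg Subtype.val h) ⟨(v, w), hd⟩)
  · rintro ⟨col, hc⟩
    have key : ∀ e : T.OrientedEdge, ∃ k : O (M.kind (T.pos e.1.1)) ⟶ O (M.kind (T.pos e.1.2)),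
        Arrow.mk k = col e := fun e => exists_mk_eq hγ (hc.map_over e) (hO _) (hO _)
    choose m hm using key
    refine ⟨⟨fun {v w} h => m ⟨(v, w), h⟩, fun {v w} h => ?_, fun {u v w s} hs hu hv hw huv hvw huw =>
      ?_⟩, Subtype.ext (funext fun e => hm e)⟩
    · exact (congrArg γ.mapArrow.obj (hm ⟨(v, w), h⟩)).trans (hc.map_over _)
    · classical
      have hf : ({u.1, v.1, w.1} : Finset _) ∈ T.K.faces := T.K.down_closed hs
        (by simp [Finset.insert_subset_iff, hu, hv, hw]) (Finset.insert_nonempty _ _)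
      obtain ⟨a, b, d, f, g, e1, e2, e3⟩ := hc.face u v w huv hvw huw ⟨_, hf, by simp⟩
      exact Arrow.mk_injective _ _ ((Arrow.mk_comp_congr ((hm _).trans e1) ((hm _).trans e2)).trans
        (e3.symm.trans (hm _).symm))

/-! ### From colorings to cocycles -/

namespace TypedColoring

variable (c : T.TypedColoring γ O) [γ.ReflectsIsomorphisms] {u v w : ↥T.K.vertices}

/-- An edge between vertices of the same kind lies above an identity, and conservativity lifts
invertibility. -/
theorem isIso (h : T.Dir v w) (hk : M.kind (T.pos v) = M.kind (T.pos w)) : IsIso (c.map h) := by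
  have : IsIso (std (M.kind (T.pos v)) (M.kind (T.pos w))) := by
    rw [hk, std_self]
    infer_instance
  have := isIso_of_arrow_eq (c.map_over h)
  exact isIso_of_reflects_iso _ γ

open Classical in
/-- Extension of a coloring to all directed segments between vertices. -/
noncomputable def seg (l : T.Lin (T.pos v) (T.pos w)) :
    O (M.kind (T.pos v)) ⟶ O (M.kind (T.pos w)) :=
  if h : v = w then eqToHom (by rw [h])
  else if hd : T.Dir v w then c.map hd
  else
    have h' := (l.dir_or h).resolve_left hd
    have := c.isIso h'.1 h'.2.symm
    inv (c.map h'.1)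

theorem seg_self (l : T.Lin (T.pos v) (T.pos v)) : c.seg l = 𝟙 _ := by
  rw [seg, dif_pos rfl]
  rfl

theorem seg_dir (l : T.Lin (T.pos v) (T.pos w)) (h : T.Dir v w) : c.seg l = c.map h := by
  rw [seg, dif_neg h.1, dif_pos h]

theorem seg_inv (l : T.Lin (T.pos v) (T.pos w)) (h : T.Dir w v) [IsIso (c.map h)] :
    c.seg l = inv (c.map h) := by
  rw [seg, dif_neg h.1.symm, dif_neg h.not_symm]

/-- Of the eight orientations of a triangle two are cyclic and do not occur. In each other one the
coloring relation holds for the oriented edges, and the reversed edges are moved across as inverses.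
-/
theorem seg_comp {s : Finset (EuclideanSpace ℝ (Fin T.dim))} (hs : s ∈ T.K.faces) (hu : u.1 ∈ s)
    (hv : v.1 ∈ s) (hw : w.1 ∈ s) (luv : T.Lin (T.pos u) (T.pos v))
    (lvw : T.Lin (T.pos v) (T.pos w)) (luw : T.Lin (T.pos u) (T.pos w)) :
    c.seg luv ≫ c.seg lvw = c.seg luw := by
  by_cases h1 : u = v
  · subst h1
    rw [seg_self, Category.id_comp]
  by_cases h2 : v = w
  · subst h2
    rw [seg_self, Category.comp_id]
  by_cases h3 : u = w
  · subst h3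
    have hk := luv.not_symm lvw
    rw [seg_self]
    rcases luv.dir_or h1 with d | ⟨d, -⟩
    · have := c.isIso d hk
      rw [c.seg_dir luv d, c.seg_inv lvw d, IsIso.hom_inv_id]
    · have := c.isIso d hk.symm
      rw [c.seg_dir lvw d, c.seg_inv luv d, IsIso.inv_hom_id]
  rcases luv.dir_or h1 with d1 | ⟨d1, k1⟩ <;> rcases lvw.dir_or h2 with d2 | ⟨d2, k2⟩ <;>
    rcases luw.dir_or h3 with d3 | ⟨d3, k3⟩
  · rw [c.seg_dir luv d1, c.seg_dir lvw d2, c.seg_dir luw d3, c.map_comp hs hu hv hw]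
  · exact absurd d3 (Dir.not_cyclic hs hu hv hw d1 d2)
  · have := c.isIso d2 k2.symm
    rw [c.seg_dir luv d1, c.seg_inv lvw d2, c.seg_dir luw d3, IsIso.comp_inv_eq,
      c.map_comp hs hu hw hv]
  · have := c.isIso d2 k2.symm
    have := c.isIso d3 k3.symm
    rw [c.seg_dir luv d1, c.seg_inv lvw d2, c.seg_inv luw d3, IsIso.comp_inv_eq,
      IsIso.eq_inv_comp, c.map_comp hs hw hu hv]
  · have := c.isIso d1 k1.symm
    rw [c.seg_inv luv d1, c.seg_dir lvw d2, c.seg_dir luw d3, IsIso.inv_comp_eq,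
      c.map_comp hs hv hu hw]
  · have := c.isIso d1 k1.symm
    have := c.isIso d3 k3.symm
    rw [c.seg_inv luv d1, c.seg_dir lvw d2, c.seg_inv luw d3, IsIso.inv_comp_eq,
      IsIso.eq_comp_inv, c.map_comp hs hv hw hu]
  · exact absurd d3 (fun d3 => Dir.not_cyclic hs hw hv hu d2 d1 d3)
  · have := c.isIso d1 k1.symm
    have := c.isIso d2 k2.symm
    have := c.isIso d3 k3.symm
    rw [c.seg_inv luv d1, c.seg_inv lvw d2, c.seg_inv luw d3, ← IsIso.inv_comp]
    congr 1
    exact c.map_comp hs hw hv hu d2 d1 d3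

theorem seg_over (hO : ∀ k, γ.obj (O k) = (Paths.of Gamma2).obj k)
    (l : T.Lin (T.pos v) (T.pos w)) :
    Arrow.mk (γ.map (c.seg l)) = Arrow.mk (std (M.kind (T.pos v)) (M.kind (T.pos w))) := by
  by_cases h : v = w
  · subst h
    rw [seg_self, std_self, γ.map_id, hO]
  rcases l.dir_or h with d | ⟨d, k⟩
  · rw [c.seg_dir l d, c.map_over]
  · have := c.isIso d k.symm
    have h' := c.map_over d
    rw [c.seg_inv l d]
    have hs : IsIso (std (M.kind (T.pos w)) (M.kind (T.pos v))) := by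
      rw [k, std_self]
      infer_instance
    rw [Functor.map_inv, Arrow.mk_inv_congr h']
    congr 1
    rw [IsIso.inv_eq_of_hom_inv_id]
    rw [k, std_self, Category.comp_id]

/-- The cocycle of a coloring. -/
noncomputable def cocycle : T.Cocycle C where
  obj x := O (M.kind x)
  map {x y} l := eqToHom (by rw [kind_vert]) ≫ c.seg l.vert ≫ eqToHom (by rw [kind_vert])
  map_self _ := by simp [seg_self]
  map_comp {x y z s} hs hx hy hz hxy hyz hxz := by
    simp only [Category.assoc, eqToHom_trans_assoc, eqToHom_refl, Category.id_comp]
    rw [← c.seg_comp hs (hx (vert_mem x)) (hy (vert_mem y)) (hz (vert_mem z)) hxy.vert hyz.vert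
      hxz.vert]
    simp

theorem cocycle_map_arrow {x y : X} (l : T.Lin x y) :
    Arrow.mk (c.cocycle.map l) = Arrow.mk (c.seg l.vert) := Arrow.mk_eqToHom _ _ _

/-- The vertex chosen near a vertex is that vertex itself, but only propositionally, so the
comparison is made between arrows with variable ends. -/
theorem cocycle_map_dir (h : T.Dir v w) : c.cocycle.map h.lin = c.map h := by
  refine Arrow.mk_injective _ _ ((c.cocycle_map_arrow h.lin).trans ?_)
  have key : ∀ {v' w' : ↥T.K.vertices} (l : T.Lin (T.pos v') (T.pos w')), v' = v → w' = w →
      Arrow.mk (c.seg l) = Arrow.mk (c.map h) := by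
    rintro v' w' l rfl rfl
    rw [c.seg_dir l h]
  exact key _ (vert_pos v) (vert_pos w)

theorem std_map_line {x y : X} (l : T.Lin x y) :
    (stdCocycle T).functor.map (M.dSpace.homotopyClass (line l)) = std (M.kind x) (M.kind y) :=
  (stdCocycle T).functor_map_line l

/-- Both sides respect composition, so it suffices to compare them on segments. -/
theorem cocycle_functor_over (hO : ∀ k, γ.obj (O k) = (Paths.of Gamma2).obj k) {x y : X}
    (f : M.dSpace.fundObj x ⟶ M.dSpace.fundObj y) :
    Arrow.mk (γ.map (c.cocycle.functor.map f)) = Arrow.mk ((stdCocycle T).functor.map f) := by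
  refine hom_induction T (Q := fun x y f => Arrow.mk (γ.map (c.cocycle.functor.map f)) =
    Arrow.mk ((stdCocycle T).functor.map f)) (fun {x y} l => ?_) (fun f g hf hg => ?_) f
  · rw [std_map_line, c.cocycle.functor_map_line]
    refine (congrArg γ.mapArrow.obj (c.cocycle_map_arrow l)).trans ((c.seg_over hO l.vert).trans ?_)
    rw [kind_vert, kind_vert]
    rfl
  · rw [Functor.map_comp, Functor.map_comp, Functor.map_comp]
    exact Arrow.mk_comp_congr hf hg

end TypedColoring

/-! ### Functors on the vertices and their colorings -/

variable (T γ O) in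
/-- Functors on the fundamental category of the vertices. -/
abbrev VertexLift : Type _ := Lift (stdCocycle T).functor γ (pointObj (M := M) O)
  fun v : ↥T.K.vertices => M.dSpace.fundObj (T.pos v)

/-- The coloring of the edges by the values of a functor. -/
noncomputable def VertexLift.coloring (φ : T.VertexLift γ O) : T.TypedColoring γ O where
  map {v w} h := φ.map (M.dSpace.homotopyClass (line h.lin))
  map_over {v w} h := by
    exact (φ.map_over _).trans (congrArg Arrow.mk (TypedColoring.std_map_line h.lin))
  map_comp {u v w s} hs hu hv hw huv hvw huw := by
    exact (φ.map_comp _ _).symm.trans (congrArg φ.map (homotopyClass_triangle hs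
      (car_pos_subset.2 hu) (car_pos_subset.2 hv) (car_pos_subset.2 hw) huv.lin hvw.lin huw.lin))

/-- A segment that runs against the order is inverse to the oriented edge, so its value is the
inverse of a color. -/
theorem VertexLift.map_line_eq {φ φ' : T.VertexLift γ O} (h : φ.coloring = φ'.coloring)
    {v w : ↥T.K.vertices} (l : T.Lin (T.pos v) (T.pos w)) :
    φ.map (M.dSpace.homotopyClass (line l)) = φ'.map (M.dSpace.homotopyClass (line l)) := by
  have hd : ∀ {v w : ↥T.K.vertices} (d : T.Dir v w), φ.map (M.dSpace.homotopyClass (line d.lin)) =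
      φ'.map (M.dSpace.homotopyClass (line d.lin)) := by
    intro v w d
    have : ∀ c : T.TypedColoring γ O, φ.coloring = c → φ.coloring.map d = c.map d := by
      rintro _ rfl
      rfl
    exact this _ h
  by_cases hne : v = w
  · subst hne
    rw [homotopyClass_line_self, φ.map_id, φ'.map_id]
  rcases l.dir_or hne with d | ⟨d, -⟩
  · exact hd d
  · obtain ⟨s, hs, hv, hw, -⟩ := id l
    have e1 : M.dSpace.homotopyClass (line l) ≫ M.dSpace.homotopyClass (line d.lin) = 𝟙 _ := by
      rw [homotopyClass_triangle hs hv hw hv l d.lin (Lin.refl _), homotopyClass_line_self]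
    have e2 : M.dSpace.homotopyClass (line d.lin) ≫ M.dSpace.homotopyClass (line l) = 𝟙 _ := by
      rw [homotopyClass_triangle hs hw hv hw d.lin l (Lin.refl _), homotopyClass_line_self]
    have e1' := (φ.map_comp _ _).symm.trans ((congrArg φ.map e1).trans (φ.map_id _))
    have e2' := (φ'.map_comp _ _).symm.trans ((congrArg φ'.map e2).trans (φ'.map_id _))
    rw [hd d] at e1'
    rw [← Category.comp_id (φ.map _), ← e2', ← Category.assoc, e1', Category.id_comp]

/-- The isomorphism from a point to the vertex near it. -/
noncomputable def vertIso (T : M.DirectedTriangulation) (x : X) : M.dSpace.fundObj x ≅ M.dSpace.fundObj (T.pos (T.vert x)) where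
  hom := M.dSpace.homotopyClass (line (lin_vert x))
  inv := M.dSpace.homotopyClass (line (vert_lin x))
  hom_inv_id := by
    rw [homotopyClass_triangle (T.car_mem x) subset_rfl (car_vert_subset subset_rfl) subset_rfl _ _
      (Lin.refl _), homotopyClass_line_self]
  inv_hom_id := by
    rw [homotopyClass_triangle (T.car_mem x) (car_vert_subset subset_rfl) subset_rfl
      (car_vert_subset subset_rfl) _ _ (Lin.refl _), homotopyClass_line_self]

/-- An arrow between vertices is a composition of segments through points that are not vertices.
Conjugating by the isomorphisms to nearby vertices turns each of these segments into a segment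
between vertices. -/
theorem VertexLift.ext_of_coloring {φ φ' : T.VertexLift γ O} (h : φ.coloring = φ'.coloring) :
    φ = φ' := by
  have key : ∀ {x y : X} (f : M.dSpace.fundObj x ⟶ M.dSpace.fundObj y),
      φ.map (j := T.vert x) (k := T.vert y) ((vertIso T x).inv ≫ f ≫ (vertIso T y).hom) =
      φ'.map (j := T.vert x) (k := T.vert y) ((vertIso T x).inv ≫ f ≫ (vertIso T y).hom) := by
    intro x y f
    refine hom_induction T (Q := fun x y f =>
      φ.map (j := T.vert x) (k := T.vert y) ((vertIso T x).inv ≫ f ≫ (vertIso T y).hom) =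
      φ'.map (j := T.vert x) (k := T.vert y) ((vertIso T x).inv ≫ f ≫ (vertIso T y).hom))
      (fun {x y} l => ?_) (fun {x y z} f g hf hg => ?_) f
    · obtain ⟨s, hs, hx, hy, -⟩ := id l
      have e : (vertIso T x).inv ≫ M.dSpace.homotopyClass (line l) ≫ (vertIso T y).hom =
          M.dSpace.homotopyClass (line l.vert) := by
        change M.dSpace.homotopyClass _ ≫ M.dSpace.homotopyClass _ ≫ M.dSpace.homotopyClass _ = _
        have l' : T.Lin x (T.pos (T.vert y)) := l.trans hs hx hy (car_vert_subset hy) (lin_vert y)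
        rw [homotopyClass_triangle hs hx hy (car_vert_subset hy) l (lin_vert y) l',
          homotopyClass_triangle hs (car_vert_subset hx) hx (car_vert_subset hy) (vert_lin x) l'
            l.vert]
      rw [e]
      exact map_line_eq h _
    · have e : (vertIso T x).inv ≫ (f ≫ g) ≫ (vertIso T z).hom =
          ((vertIso T x).inv ≫ f ≫ (vertIso T y).hom) ≫ ((vertIso T y).inv ≫ g ≫ (vertIso T z).hom) :=
        comp_split_iso _ _ _ _ (vertIso T y)
      rw [e, φ.map_comp, φ'.map_comp, hf, hg]
  ext v w f
  -- The vertex near `T.pos v` is not definitionally `v`. The correcting isomorphisms are themselves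
  -- segments between vertices, on which the two functors agree already.
  have e : f = (vertIso T (T.pos v)).hom ≫ ((vertIso T (T.pos v)).inv ≫ f ≫ (vertIso T (T.pos w)).hom) ≫
    (vertIso T (T.pos w)).inv := by simp
  rw [e, φ.map_comp (k := T.vert (T.pos v)), φ'.map_comp (k := T.vert (T.pos v)),
    φ.map_comp (k := T.vert (T.pos w)), φ'.map_comp (k := T.vert (T.pos w)), key f]
  have e1 := map_line_eq h (lin_vert (T.pos v))
  have e2 := map_line_eq h (vert_lin (T.pos w))
  exact congrArg₂ (fun a b => a ≫ _ ≫ b) e1 e2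

/-- Colorings are the same as functors on the vertices. -/
noncomputable def coloringEquiv [γ.ReflectsIsomorphisms]
    (hO : ∀ k, γ.obj (O k) = (Paths.of Gamma2).obj k) : T.VertexLift γ O ≃ T.TypedColoring γ O := by
  refine Equiv.ofBijective VertexLift.coloring ⟨fun φ φ' h => VertexLift.ext_of_coloring h, fun c => ?_⟩
  refine ⟨⟨fun f => c.cocycle.functor.map f, fun v => c.cocycle.functor.map_id _,
    fun f g => c.cocycle.functor.map_comp f g, fun f => c.cocycle_functor_over hO f⟩, ?_⟩
  ext v w h
  exact (c.cocycle.functor_map_line h.lin).trans (c.cocycle_map_dir h)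

end ManifoldWithDefect.DirectedTriangulation

/-! ### Counting -/

section Fibers

variable {C : Type*} [Category C] {γ : C ⥤ Paths Gamma2}

theorem IsParcel.exists_obj (h : IsParcel γ) :
    ∃ O : Gamma2 → C, ∀ k, γ.obj (O k) = (Paths.of Gamma2).obj k := by
  have (k : Gamma2) : ∃ c : C, γ.obj c = (Paths.of Gamma2).obj k := by
    obtain ⟨f, hf⟩ := h.surjective (Arrow.mk (𝟙 ((Paths.of Gamma2).obj k)))
    exact ⟨f.left, congrArg Comma.left hf⟩
  choose O hO using this
  exact ⟨O, hO⟩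

variable (γ) in
/-- The number of arrows above an identity. -/
noncomputable def fiberCard (k : Gamma2) : ℕ :=
  Nat.card (ArrowFiber γ (Arrow.mk (𝟙 ((Paths.of Gamma2).obj k))))

theorem IsFiberFinite.fiberCard_ne_zero (hfin : IsFiberFinite γ) (h : IsParcel γ) (k : Gamma2) :
    fiberCard γ k ≠ 0 := by
  have := hfin (Arrow.mk (𝟙 ((Paths.of Gamma2).obj k)))
  obtain ⟨f, hf⟩ := h.surjective (Arrow.mk (𝟙 ((Paths.of Gamma2).obj k)))
  have : Nonempty (ArrowFiber γ (Arrow.mk (𝟙 ((Paths.of Gamma2).obj k)))) := ⟨f, hf⟩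
  exact Nat.card_pos.ne'

/-- The arrows above a given one have the same source and target. -/
noncomputable def liftHomEquiv {P : Type*} [Category P] {Φ : P ⥤ Paths Gamma2} {O : P → C}
    (hγ : Function.Injective γ.obj) (hO : ∀ x, γ.obj (O x) = Φ.obj x) {x y : P} (f : x ⟶ y) :
    LiftHom Φ γ O f ≃ ArrowFiber γ (Arrow.mk (Φ.map f)) :=
  Equiv.ofBijective (fun g => ⟨Arrow.mk g.1, g.2⟩)
    ⟨fun _ _ h => Subtype.ext (Arrow.mk_injective _ _ (congrArg Subtype.val h)), by
      rintro ⟨f', hf'⟩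
      obtain ⟨k, rfl⟩ := exists_mk_eq hγ hf' (hO x) (hO y)
      exact ⟨⟨k, hf'⟩, rfl⟩⟩

end Fibers

namespace ManifoldWithDefect.DirectedTriangulation

variable {n : ℕ} {X : Type*} [TopologicalSpace X] {M : ManifoldWithDefect n X}
  (T : M.DirectedTriangulation) {C : Type*} [Category C] {γ : C ⥤ Paths Gamma2} {O : Gamma2 → C}

theorem finite_vertices : Finite ↥T.K.vertices := by
  have h : T.K.vertices = (fun v => ({v} : Finset _)) ⁻¹' T.K.faces := rfl
  rw [h]
  exact (T.finite_faces.preimage (Finset.singleton_injective.injOn)).to_subtype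

/-- Every stratum contains a vertex, namely one near its base point. -/
theorem finite_strata (T : M.DirectedTriangulation) (b : M.BasePoints) : Finite M.Strata := by
  have := T.finite_vertices
  refine Finite.of_surjective (fun v : ↥T.K.vertices => M.stratumOf (T.pos v)) fun st =>
    ⟨T.vert (b.pt st), ?_⟩
  exact (stratumOf_vert _).trans (b.stratumOf_pt st)

theorem finite_coloring (hfin : IsFiberFinite γ) : Finite (T.Coloring γ) := by
  have := T.finite_vertices
  have : Finite T.OrientedEdge := inferInstanceAs (Finite {e : _ × _ // T.Dir e.1 e.2})
  have := fun e : T.OrientedEdge =>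
    hfin (Arrow.mk (std (M.kind (T.pos e.1.1)) (M.kind (T.pos e.1.2))))
  refine Finite.of_injective (β := ∀ e : T.OrientedEdge,
    ArrowFiber γ (Arrow.mk (std (M.kind (T.pos e.1.1)) (M.kind (T.pos e.1.2)))))
    (fun c e => ⟨c.1 e, c.2.map_over e⟩) fun c c' h => Subtype.ext (funext fun e => ?_)
  exact congrArg Subtype.val (congrFun h e)

variable {T}

theorem obj_pointObj (hO : ∀ k, γ.obj (O k) = (Paths.of Gamma2).obj k)
    (x : M.dSpace.FundamentalCategory) : γ.obj (pointObj O x) = (stdCocycle T).functor.obj x :=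
  hO _

/-- Points of the same stratum are isomorphic by an isomorphism above an identity. -/
theorem exists_iso_fiber (hγ : Function.Injective γ.obj)
    (hO : ∀ k, γ.obj (O k) = (Paths.of Gamma2).obj k) {x y : X}
    (h : M.stratumOf x = M.stratumOf y) :
    ∃ k : M.dSpace.fundObj x ≅ M.dSpace.fundObj y,
      Nonempty (LiftHom (stdCocycle T).functor γ (pointObj O) k.hom ≃
        ArrowFiber γ (Arrow.mk (𝟙 ((Paths.of Gamma2).obj (M.kind x))))) := by
  obtain ⟨k, p, -, hk, -, hp, -⟩ := exists_iso T h
  have e : Arrow.mk ((stdCocycle T).functor.map k.hom) =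
      Arrow.mk (𝟙 ((Paths.of Gamma2).obj (M.kind x))) := by
    rw [hk, std_map_of_upper_or_lower p (Or.inl hp.upper), ← std_self]
    exact congrArg (fun l => Arrow.mk (std (M.kind x) l)) (kind_eq_of_stratumOf_eq h).symm
  have := liftHomEquiv hγ (obj_pointObj (T := T) hO) k.hom
  rw [e] at this
  exact ⟨k, ⟨this⟩⟩

end ManifoldWithDefect.DirectedTriangulation

/-- Each additional object contributes an independent factor, the fiber above the identity of its
kind. The lemma is used twice, with base points and vertices exchanging roles. -/
theorem CategoryTheory.Lift.sum_equiv {P C : Type*} [Category P] [Category C] {Φ : P ⥤ Paths Gamma2}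
    {γ : C ⥤ Paths Gamma2} [γ.ReflectsIsomorphisms] {O : P → C}
    (hO : ∀ x, γ.obj (O x) = Φ.obj x) {J J' : Type*} {pt : J → P} {pt' : J' → P}
    (κ : J' → Gamma2) (h : ∀ j', ∃ (j : J) (k : pt' j' ≅ pt j), Nonempty (LiftHom Φ γ O k.hom ≃
      ArrowFiber γ (Arrow.mk (𝟙 ((Paths.of Gamma2).obj (κ j')))))) :
    Nonempty (Lift Φ γ O (Sum.elim pt pt') ≃ Lift Φ γ O pt ×
      ∀ j', ArrowFiber γ (Arrow.mk (𝟙 ((Paths.of Gamma2).obj (κ j'))))) := by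
  choose r k e using h
  exact ⟨(Lift.extendEquiv r k hO).trans
    (Equiv.prodCongrRight fun _ => Equiv.piCongrRight fun j' => (e j').some)⟩

theorem card_pi_arrowFiber {C : Type*} [Category C] {γ : C ⥤ Paths Gamma2}
    {J : Type*} [Finite J] (κ : J → Gamma2) :
    Nat.card (∀ j, ArrowFiber γ (Arrow.mk (𝟙 ((Paths.of Gamma2).obj (κ j))))) =
      fiberCard γ .beta ^ Nat.card {j // κ j = .beta} *
        fiberCard γ .delta ^ Nat.card {j // κ j = .delta} := by
  classical
  have := Fintype.ofFinite J
  have h : ∀ j, κ j = .delta ↔ ¬ κ j = .beta := fun j => by cases κ j <;> simp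
  simp_rw [h]
  rw [Nat.card_pi, ← Fintype.prod_subtype_mul_prod_subtype (fun j => κ j = .beta)]
  congr 1
  · rw [Finset.prod_congr rfl fun j _ => show _ = fiberCard γ .beta by rw [j.2]; rfl]
    simp [Nat.card_eq_fintype_card]
  · rw [Finset.prod_congr rfl fun j _ => show _ = fiberCard γ .delta by rw [(h _).2 j.2]; rfl]
    simp [Nat.card_eq_fintype_card]

namespace ManifoldWithDefect.DirectedTriangulation

variable {n : ℕ} {X : Type*} [TopologicalSpace X] {M : ManifoldWithDefect n X}
  (T : M.DirectedTriangulation) {C : Type*} [Category C] {γ : C ⥤ Paths Gamma2} {O : Gamma2 → C}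

theorem card_vertices_beta :
    Nat.card {v : ↥T.K.vertices // M.kind (T.pos v) = .beta} = T.bulkVertexCount :=
  Nat.card_congr (Equiv.subtypeEquivRight fun _ => kind_eq_beta)

theorem card_vertices_delta :
    Nat.card {v : ↥T.K.vertices // M.kind (T.pos v) = .delta} = T.defectVertexCount :=
  Nat.card_congr (Equiv.subtypeEquivRight fun _ => kind_eq_delta)

theorem card_strata_beta (b : M.BasePoints) : Nat.card {st : M.Strata // M.kind (b.pt st) = .beta} =
    Nat.card (ConnectedComponents ↥(M.defectᶜ)) := by
  refine (Nat.card_congr (Equiv.ofBijective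
    (fun B => ⟨Sum.inl B, kind_of_notMem (b.pt_inl_notMem B)⟩) ⟨fun B B' h => ?_, ?_⟩)).symm
  · exact Sum.inl_injective (congrArg Subtype.val h)
  · rintro ⟨B | S, h⟩
    · exact ⟨B, rfl⟩
    · exact absurd (b.pt_inr_mem S) (kind_eq_beta.1 h)

theorem card_strata_delta (b : M.BasePoints) :
    Nat.card {st : M.Strata // M.kind (b.pt st) = .delta} =
      Nat.card (ConnectedComponents ↥M.defect) := by
  refine (Nat.card_congr (Equiv.ofBijective
    (fun S => ⟨Sum.inr S, kind_of_mem (b.pt_inr_mem S)⟩) ⟨fun S S' h => ?_, ?_⟩)).symm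
  · exact Sum.inr_injective (congrArg Subtype.val h)
  · rintro ⟨B | S, h⟩
    · exact absurd (kind_eq_delta.1 h) (b.pt_inl_notMem B)
    · exact ⟨S, rfl⟩

/-- Both sides count functors on the fundamental category of the base points and the vertices. -/
theorem exists_equiv_prod (b : M.BasePoints) (hparcel : IsParcel γ) (hreg : IsRegularParcel γ) :
    Nonempty (ParcelMap (T.structuralFunctor b) γ × (∀ v : ↥T.K.vertices,
        ArrowFiber γ (Arrow.mk (𝟙 ((Paths.of Gamma2).obj (M.kind (T.pos v)))))) ≃
      T.Coloring γ × (∀ st : M.Strata,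
        ArrowFiber γ (Arrow.mk (𝟙 ((Paths.of Gamma2).obj (M.kind (b.pt st))))))) := by
  have := hparcel.conservative
  obtain ⟨O, hO⟩ := hparcel.exists_obj
  have hP := obj_pointObj (T := T) hO
  let ptB : M.Strata → M.dSpace.FundamentalCategory := fun st => M.dSpace.fundObj (b.pt st)
  let ptV : ↥T.K.vertices → M.dSpace.FundamentalCategory := fun v => M.dSpace.fundObj (T.pos v)
  obtain ⟨e1⟩ := Lift.sum_equiv hP (pt := ptB) (pt' := ptV) (fun v => M.kind (T.pos v)) fun v =>
    ⟨M.stratumOf (T.pos v), exists_iso_fiber hreg hO (b.stratumOf_pt _).symm⟩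
  obtain ⟨e2⟩ := Lift.sum_equiv hP (pt := ptV) (pt' := ptB) (fun st => M.kind (b.pt st)) fun st =>
    ⟨T.vert (b.pt st), exists_iso_fiber hreg hO (stratumOf_vert _).symm⟩
  have e3 : Lift (stdCocycle T).functor γ (pointObj O) ptB ≃ ParcelMap (T.structuralFunctor b) γ :=
    Lift.functorEquiv hreg hP ptB
  have e4 : Lift (stdCocycle T).functor γ (pointObj O) ptV ≃ T.Coloring γ :=
    (coloringEquiv hO).trans (typedColoringEquiv hreg hO)
  exact ⟨(Equiv.prodCongrLeft fun _ => e3.symm).trans (e1.symm.trans (Lift.swapEquiv.trans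
    (e2.trans (Equiv.prodCongrLeft fun _ => e4))))⟩

end ManifoldWithDefect.DirectedTriangulation

theorem mainTheorem2 {n : ℕ} {X : Type*} [TopologicalSpace X] [CompactSpace X] [T2Space X]
    (M : ManifoldWithDefect n X) (T : M.DirectedTriangulation) (b : M.BasePoints)
    {C : Type*} [Category C]
    (γ : C ⥤ Paths Gamma2)
    (hparcel : IsParcel γ) (hfin : IsFiberFinite γ) (hreg : IsRegularParcel γ) :
    ∃ Φ : b.FundamentalParcel ⥤ Paths Gamma2,
      ManifoldWithDefect.IsStructuralFunctor b Φ ∧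
      (∀ Ψ, ManifoldWithDefect.IsStructuralFunctor b Ψ → Ψ = Φ) ∧
      Finite (ManifoldWithDefect.ParcelMap Φ γ) ∧
      Finite (T.Coloring γ) ∧
      (Nat.card (ManifoldWithDefect.ParcelMap Φ γ) : ℚ) =
        (Nat.card (T.Coloring γ) : ℚ) /
          ((Nat.card (ArrowFiber γ (Arrow.mk (𝟙 Gamma2.objBeta))) : ℚ) ^
              ((T.bulkVertexCount : ℤ) - (Nat.card (ConnectedComponents ↥(M.defectᶜ)) : ℤ)) *
            (Nat.card (ArrowFiber γ (Arrow.mk (𝟙 Gamma2.objDelta))) : ℚ) ^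
              ((T.defectVertexCount : ℤ) - (Nat.card (ConnectedComponents ↥M.defect) : ℤ))) := by
  have hst := T.isStructuralFunctor b
  have hV := T.finite_vertices
  have hS := ManifoldWithDefect.DirectedTriangulation.finite_strata T b
  have hC := T.finite_coloring hfin
  have hF := fun k : Gamma2 => hfin (Arrow.mk (𝟙 ((Paths.of Gamma2).obj k)))
  have hne := hfin.fiberCard_ne_zero hparcel
  have hF' : ∀ k : Gamma2, Nonempty (ArrowFiber γ (Arrow.mk (𝟙 ((Paths.of Gamma2).obj k)))) :=
    fun k => (Nat.card_ne_zero.1 (hne k)).1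
  obtain ⟨e⟩ := T.exists_equiv_prod b hparcel hreg
  refine ⟨T.structuralFunctor b, hst, fun Ψ hΨ => hΨ.unique T hst, ?_, hC, ?_⟩
  -- The product with the vertex fibers is finite, and since these fibers are nonempty the
  -- projection to the parcel maps is onto.
  · have := Finite.of_equiv _ e.symm
    exact Finite.of_surjective _ (Prod.fst_surjective (β := ∀ v : ↥T.K.vertices,
      ArrowFiber γ (Arrow.mk (𝟙 ((Paths.of Gamma2).obj (M.kind (T.pos v)))))))
  · have hcard := Nat.card_congr e
    rw [Nat.card_prod, Nat.card_prod, card_pi_arrowFiber (fun v => M.kind (T.pos v)),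
      card_pi_arrowFiber (fun st => M.kind (b.pt st)), T.card_vertices_beta,
      T.card_vertices_delta, ManifoldWithDefect.DirectedTriangulation.card_strata_beta,
      ManifoldWithDefect.DirectedTriangulation.card_strata_delta] at hcard
    change _ = _ / ((fiberCard γ .beta : ℚ) ^ _ * (fiberCard γ .delta : ℚ) ^ _)
    have h1 : (fiberCard γ .beta : ℚ) ≠ 0 := Nat.cast_ne_zero.2 (hne _)
    have h2 : (fiberCard γ .delta : ℚ) ≠ 0 := Nat.cast_ne_zero.2 (hne _)
    have hq := congrArg (Nat.cast (R := ℚ)) hcard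
    push_cast at hq
    -- Both fibers above identities are nonempty, so the powers may be split and the denominators
    -- cleared; what remains is the double count.
    rw [zpow_sub₀ h1, zpow_sub₀ h2, eq_div_iff (by positivity)]
    simp only [zpow_natCast]
    field_simp
    linear_combination hq
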